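/- Work on a real RAM whose memory cells and registers hold either a real number or a word of $w=\Theta(\log n)$ bits. Reals can be added, subtracted, multiplied, divided and compared (there is no rounding); words admit the usual arithmetic, bitwise and comparison operations and can be used as addresses. Each elementary operation costs one unit of time, and space is the number of memory cells. For a finite set $S\subset\mathbb{R}^2$, a $2$-clustering is a partition $\mathcal{C}$ of $S$ into at most two clusters; its rectilinear cost is $\max_{C\in\mathcal{C}}\mathrm{rad}_\infty(C)$, where $\mathrm{rad}_\infty(C)$ is half the edge length of a smallest axis-aligned square enclosing $C$ (the cost is $0$ for $S=\emptyset$). An optimal solution to the rectilinear $2$-center problem on $S$ consists of two congruent axis-aligned squares whose union covers $S$ and whose half edge length equals the minimum cost of a $2$-clustering of $S$. Theorem. For every fixed $\delta>0$ there are a query program and constants $c\in\mathbb{N}$ and $K$, depending only on $\delta$, such that the following holds for every set $P$ of $n\ge 2$ points in $\mathbb{R}^2$, with words of $w=c\lceil\log_2 n\rceil$ bits. There is a data structure for $P$ that occupies at most $K\,n\log^{\delta}n$ memory cells, all of whose real cells contain coordinates of points of $P$, and with which the program, given any axis-aligned rectangle $Q=[a_1,b_1]\times[a_2,b_2]$ with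 $a_1\le b_1$ and $a_2\le b_2$, reports in at most $K\log n$ elementary operations an optimal solution to the rectilinear $2$-center problem on $P\cap Q$ (the centres of the two squares and their half edge length). That is, the space is $O(n\log^{\delta}n)$ and the query time is $O(\log n)$. -/

import Mathlib

open scoped NNReal

namespace RangeClustering

/-! ### The rectilinear `k`-center problem in the plane -/

/-- Points of the plane. The distance that Mathlib puts on `ℝ × ℝ` is the `L∞`-distance, so
`Metric.closedBall c r` is the axis-aligned square with centre `c` and edge length `2 * r`. -/
abbrev Point : Type := ℝ × ℝ

/-- Half the edge length of a smallest axis-aligned square that encloses the cluster `C`. -/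
noncomputable def clusterRadius (C : Finset Point) : ℝ≥0 :=
  sInf {r : ℝ≥0 | ∃ c : Point, (C : Set Point) ⊆ Metric.closedBall c (r : ℝ)}

/-- The rectilinear center cost of a clustering: the largest radius of its clusters. -/
noncomputable def clusteringCost {S : Finset Point} (𝒞 : Finpartition S) : ℝ≥0 :=
  𝒞.parts.sup clusterRadius

/-- `r` is the minimum cost of a `k`-clustering of `S`, that is, of a partition of `S`
into at most `k` clusters. -/
def IsOptCost (k : ℕ) (S : Finset Point) (r : ℝ) : Prop :=
  IsLeast {x : ℝ | ∃ 𝒞 : Finpartition S, 𝒞.parts.card ≤ k ∧ x = (clusteringCost 𝒞 : ℝ)} r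

open Classical in
/-- The points of `P` in the closed axis-aligned rectangle with bottom-left corner `a` and
top-right corner `b`. -/
noncomputable def inRange (P : Finset Point) (a b : Point) : Finset Point :=
  P.filter (fun p => p ∈ Set.Icc a b)

/-- The two congruent squares with centres `c`, `c'` and edge length `2 * r` form an optimal
solution to the rectilinear 2-center problem on `S`. -/
def IsOptimalTwoCenter (S : Finset Point) (c c' : Point) (r : ℝ) : Prop :=
  (S : Set Point) ⊆ Metric.closedBall c r ∪ Metric.closedBall c' r ∧ IsOptCost 2 S r

/-! ### The machine: a real RAM with words of `w` bits

Memory cells and registers hold either a real number or a word of `w` bits. Real numbers can be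
added, subtracted, multiplied, divided and compared. Words can moreover be used as addresses. There
is no conversion between the two sorts (in particular no rounding of reals). -/

/-- The content of the memory: an array of words and an array of reals. -/
structure Memory (w : ℕ) where
  words : List (BitVec w)
  reals : List ℝ

/-- The number of memory cells in use. -/
def Memory.space {w : ℕ} (M : Memory w) : ℕ := M.words.length + M.reals.length

/-- The content of the registers; a program mentions only finitely many of them. -/
structure Registers (w : ℕ) where
  word : ℕ → BitVec w
  real : ℕ → ℝ

/-- Word-valued expressions; `read e` reads the memory word with address `e`. -/
inductive WordExpr : Type
  | reg (i : ℕ)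
  | const (k : ℕ)
  | read (e : WordExpr)
  | add (e f : WordExpr)
  | sub (e f : WordExpr)
  | mul (e f : WordExpr)
  | div (e f : WordExpr)
  | mod (e f : WordExpr)
  | and (e f : WordExpr)
  | or (e f : WordExpr)
  | xor (e f : WordExpr)
  | shiftLeft (e f : WordExpr)
  | shiftRight (e f : WordExpr)

/-- Real-valued expressions; `read e` reads the memory real with address `e`. -/
inductive RealExpr : Type
  | reg (i : ℕ)
  | const (z : ℤ)
  | read (e : WordExpr)
  | add (e f : RealExpr)
  | sub (e f : RealExpr)
  | mul (e f : RealExpr)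
  | div (e f : RealExpr)

/-- Tests. -/
inductive Cond : Type
  | wordLt (e f : WordExpr)
  | realLt (e f : RealExpr)
  | not (b : Cond)
  | and (b b' : Cond)

/-- Programs. A program can change registers only; the memory is read-only. -/
inductive Program : Type
  | skip
  | setWord (i : ℕ) (e : WordExpr)
  | setReal (i : ℕ) (e : RealExpr)
  | seq (p q : Program)
  | ite (b : Cond) (p q : Program)
  | loop (b : Cond) (p : Program)

/-- The value of a word expression: unsigned arithmetic modulo `2 ^ w`. Reading an address outside
the memory gives `0`. -/
def WordExpr.eval {w : ℕ} (M : Memory w) (s : Registers w) : WordExpr → BitVec w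
  | .reg i => s.word i
  | .const k => BitVec.ofNat w k
  | .read e => M.words.getD (e.eval M s).toNat 0
  | .add e f => e.eval M s + f.eval M s
  | .sub e f => e.eval M s - f.eval M s
  | .mul e f => e.eval M s * f.eval M s
  | .div e f => e.eval M s / f.eval M s
  | .mod e f => e.eval M s % f.eval M s
  | .and e f => e.eval M s &&& f.eval M s
  | .or e f => e.eval M s ||| f.eval M s
  | .xor e f => e.eval M s ^^^ f.eval M s
  | .shiftLeft e f => e.eval M s <<< f.eval M s
  | .shiftRight e f => e.eval M s >>> f.eval M s

/-- The value of a real expression. -/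
noncomputable def RealExpr.eval {w : ℕ} (M : Memory w) (s : Registers w) : RealExpr → ℝ
  | .reg i => s.real i
  | .const z => (z : ℝ)
  | .read e => M.reals.getD (e.eval M s).toNat 0
  | .add e f => e.eval M s + f.eval M s
  | .sub e f => e.eval M s - f.eval M s
  | .mul e f => e.eval M s * f.eval M s
  | .div e f => e.eval M s / f.eval M s

/-- The truth of a test. -/
def Cond.Holds {w : ℕ} (M : Memory w) (s : Registers w) : Cond → Prop
  | .wordLt e f => (e.eval M s).toNat < (f.eval M s).toNat
  | .realLt e f => e.eval M s < f.eval M s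
  | .not b => ¬ b.Holds M s
  | .and b b' => b.Holds M s ∧ b'.Holds M s

/-- The number of elementary operations in the evaluation of a word expression. -/
def WordExpr.cost : WordExpr → ℕ
  | .reg _ => 1
  | .const _ => 1
  | .read e => e.cost + 1
  | .add e f => e.cost + f.cost + 1
  | .sub e f => e.cost + f.cost + 1
  | .mul e f => e.cost + f.cost + 1
  | .div e f => e.cost + f.cost + 1
  | .mod e f => e.cost + f.cost + 1
  | .and e f => e.cost + f.cost + 1
  | .or e f => e.cost + f.cost + 1
  | .xor e f => e.cost + f.cost + 1
  | .shiftLeft e f => e.cost + f.cost + 1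
  | .shiftRight e f => e.cost + f.cost + 1

/-- The number of elementary operations in the evaluation of a real expression. -/
def RealExpr.cost : RealExpr → ℕ
  | .reg _ => 1
  | .const _ => 1
  | .read e => e.cost + 1
  | .add e f => e.cost + f.cost + 1
  | .sub e f => e.cost + f.cost + 1
  | .mul e f => e.cost + f.cost + 1
  | .div e f => e.cost + f.cost + 1

/-- The number of elementary operations in a test. -/
def Cond.cost : Cond → ℕ
  | .wordLt e f => e.cost + f.cost + 1
  | .realLt e f => e.cost + f.cost + 1
  | .not b => b.cost + 1
  | .and b b' => b.cost + b'.cost + 1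

/-- `Runs M p s t s'`: with memory `M`, the program `p` started with registers `s` halts after
exactly `t` elementary operations, with registers `s'`. -/
inductive Runs {w : ℕ} (M : Memory w) : Program → Registers w → ℕ → Registers w → Prop
  | skip (s : Registers w) : Runs M .skip s 1 s
  | setWord (s : Registers w) (i : ℕ) (e : WordExpr) :
      Runs M (.setWord i e) s (e.cost + 1)
        { s with word := Function.update s.word i (e.eval M s) }
  | setReal (s : Registers w) (i : ℕ) (e : RealExpr) :
      Runs M (.setReal i e) s (e.cost + 1)
        { s with real := Function.update s.real i (e.eval M s) }
  | seq {s s' s'' : Registers w} {t t' : ℕ} {p q : Program}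
      (hp : Runs M p s t s') (hq : Runs M q s' t' s'') :
      Runs M (.seq p q) s (t + t') s''
  | iteTrue {s s' : Registers w} {t : ℕ} {b : Cond} {p q : Program}
      (hb : b.Holds M s) (hp : Runs M p s t s') :
      Runs M (.ite b p q) s (b.cost + t) s'
  | iteFalse {s s' : Registers w} {t : ℕ} {b : Cond} {p q : Program}
      (hb : ¬ b.Holds M s) (hq : Runs M q s t s') :
      Runs M (.ite b p q) s (b.cost + t) s'
  | loopDone {s : Registers w} {b : Cond} {p : Program}
      (hb : ¬ b.Holds M s) :
      Runs M (.loop b p) s b.cost s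
  | loopStep {s s' s'' : Registers w} {t t' : ℕ} {b : Cond} {p : Program}
      (hb : b.Holds M s) (hp : Runs M p s t s') (hq : Runs M (.loop b p) s' t' s'') :
      Runs M (.loop b p) s (b.cost + t + t') s''

/-- The registers at the start of a query: the first four real registers hold the corners
`a` and `b` of the query rectangle, all other registers hold `0`. -/
def queryInput (w : ℕ) (a b : Point) : Registers w where
  word := fun _ => 0
  real := fun i =>
    match i with
    | 0 => a.1
    | 1 => a.2
    | 2 => b.1
    | 3 => b.2
    | _ => 0

/-- The program `p`, run with the data structure `M` in memory, answers the rectilinear 2-center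
query with the rectangle `[a.1, b.1] × [a.2, b.2]` on the point set `P` in at most `T` elementary
operations. It reports the centres of the two squares in the real registers `0, 1` and `2, 3`, and
half their edge length in the real register `4`. -/
def AnswersTwoCenterQuery {w : ℕ} (p : Program) (M : Memory w) (P : Finset Point) (a b : Point)
    (T : ℝ) : Prop :=
  ∃ (t : ℕ) (s : Registers w), Runs M p (queryInput w a b) t s ∧ (t : ℝ) ≤ T ∧
    IsOptimalTwoCenter (inRange P a b) (s.real 0, s.real 1) (s.real 2, s.real 3) (s.real 4)

/-- All real numbers stored in `M` are coordinates of points of `P`. Everything else that `M`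
stores is in words of `w` bits, so no real cell can encode additional information. -/
def StoresCoordinatesOf {w : ℕ} (M : Memory w) (P : Finset Point) : Prop :=
  ∀ x ∈ M.reals, ∃ q ∈ P, x = q.1 ∨ x = q.2

end RangeClustering

namespace RangeClustering

/-! ### Optimal pairs of squares sit in opposite corners of the bounding box -/

/-! Geometry. Two congruent squares that cover a set can be slid into two opposite corners of its
bounding box, so the optimal edge length is the smaller of two numbers, one for each diagonal pair
of corners (`inCorners_or_inAnticorners_of_cover`, `isOptimalTwoCenter_of_minimal`). For a fixed
pair, the condition that every point lies in one of the two corner squares is, by distributivity, a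
conjunction of four conditions `min (f p) (g p) ≤ s`, where `f` and `g` are distances to sides of
the box (`inCorners_iff_of_isMaxMin`). Each maximum of such a minimum splits along the line `f = g`
into two linear maximization problems with three half-plane constraints. Points outside the box that
satisfy these constraints contribute only nonpositive values and do no harm. A two-center query thus
becomes a constant number of dominance queries for twelve fixed triples of functionals.

Data structure. For one triple, the points are sorted by each functional, and binary search turns
the three bounds into ranks `X`, `Y`, `Z`. The answer is the last position before `X` in the first
order whose second rank is less than `Y` and whose third rank is at least `Z` (`spec_search`). It is
found by descending a balanced binary tree over the positions (`spec_walk`). At a node one needs the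
local ranks of `Y` and `Z` in a child and a test whether a node contains a valid entry. The local
rank in the child is a function of the local rank in the parent (`subCount_cnt`). Emptiness is
monotone in the two local ranks, so it is described by a staircase, read along antidiagonals
(`stair_lt_cnt_iff`). All these functions start at zero and grow by at most one per step, so a node
with `H` leaves stores each of them in `2 * H` bits.

Bounds. The `O(n log n)` bits are cut into blocks of about `log n / 2` bits. Sampled ranks and a
lookup table shared by all blocks give ranks in constant time (`bitRank_eq_sample_add_rankTable`)
and only `O(n)` words. The space is therefore linear, which is `O(n log ^ δ n)` for `n ≥ 2` and
every `δ > 0`. The query program has no nested loops, and each loop takes at most `O(log n)` rounds,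
which gives the query time. -/

theorem mem_closedBall_iff_abs (p c : Point) (r : ℝ) :
    p ∈ Metric.closedBall c r ↔ |p.1 - c.1| ≤ r ∧ |p.2 - c.2| ≤ r := by
  rw [Metric.mem_closedBall, Prod.dist_eq, max_le_iff, Real.dist_eq, Real.dist_eq]

theorem clusterRadius_le {C : Finset Point} {c : Point} {r : ℝ≥0}
    (h : (C : Set Point) ⊆ Metric.closedBall c (r : ℝ)) : clusterRadius C ≤ r :=
  csInf_le (OrderBot.bddBelow _) ⟨c, h⟩

/-- The strict inequality makes it unnecessary to show that the infimum is attained. -/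
theorem exists_closedBall_of_clusterRadius_lt {C : Finset Point} {r : ℝ≥0}
    (h : clusterRadius C < r) : ∃ c : Point, (C : Set Point) ⊆ Metric.closedBall c (r : ℝ) := by
  have hne : {r : ℝ≥0 | ∃ c : Point, (C : Set Point) ⊆ Metric.closedBall c (r : ℝ)}.Nonempty := by
    obtain ⟨r, hr⟩ := (C.finite_toSet.isBounded).subset_closedBall (0 : Point)
    exact ⟨r.toNNReal, 0, hr.trans (Metric.closedBall_subset_closedBall (Real.le_coe_toNNReal r))⟩
  obtain ⟨r', ⟨c, hc⟩, hr'⟩ := exists_lt_of_csInf_lt hne h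
  exact ⟨c, hc.trans (Metric.closedBall_subset_closedBall (by exact_mod_cast hr'.le))⟩

/-- A cover by two balls of radius `r` yields a clustering of cost at most `r`. -/
theorem exists_clustering_of_cover {S : Finset Point} {c c' : Point} {r : ℝ≥0}
    (h : (S : Set Point) ⊆ Metric.closedBall c r ∪ Metric.closedBall c' r) :
    ∃ 𝒞 : Finpartition S, 𝒞.parts.card ≤ 2 ∧ clusteringCost 𝒞 ≤ r := by
  classical
  let A := S.filter (fun p => p ∈ Metric.closedBall c (r : ℝ))
  -- The atoms generated by the single set `A` are its points and the remaining points of `S`; empty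
  -- atoms are dropped, so there are at most `2 ^ 1` parts.
  refine ⟨Finpartition.atomise S {A}, by simpa using Finpartition.card_atomise_le (s := S) (F := {A}),
    Finset.sup_le ?_⟩
  intro C hC
  obtain ⟨-, Q, hQ, rfl⟩ := Finpartition.mem_atomise.1 hC
  rcases Finset.subset_singleton_iff.1 hQ with rfl | rfl
  · refine clusterRadius_le (c := c') ?_
    intro p hp
    simp only [Finset.coe_filter, Set.mem_ofPred_eq, Finset.mem_singleton, Finset.notMem_empty,
      false_iff, forall_eq] at hp
    rcases h hp.1 with h1 | h1
    · exact absurd (Finset.mem_filter.2 ⟨hp.1, h1⟩) hp.2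
    · exact h1
  · refine clusterRadius_le (c := c) ?_
    intro p hp
    simp only [Finset.coe_filter, Set.mem_ofPred_eq, Finset.mem_singleton, forall_eq, true_iff] at hp
    exact (Finset.mem_filter.1 hp.2).2

/-- A clustering into at most two clusters yields a cover by two balls of any larger radius. -/
theorem exists_cover_of_clustering {S : Finset Point} (𝒞 : Finpartition S)
    (hcard : 𝒞.parts.card ≤ 2) {r : ℝ≥0} (hr : clusteringCost 𝒞 < r) :
    ∃ c c' : Point, (S : Set Point) ⊆ Metric.closedBall c r ∪ Metric.closedBall c' r := by
  classical
  have hball : ∀ C ∈ 𝒞.parts, ∃ c : Point, (C : Set Point) ⊆ Metric.closedBall c (r : ℝ) :=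
    fun C hC => exists_closedBall_of_clusterRadius_lt
      ((Finset.le_sup (f := clusterRadius) hC).trans_lt hr)
  choose! f hf using hball
  -- With fewer than two clusters both squares may be taken for the same set `A`.
  obtain ⟨A, B, hAB⟩ : ∃ A B, 𝒞.parts ⊆ {A, B} := by
    rcases Nat.lt_or_ge 𝒞.parts.card 2 with h1 | h2
    · obtain ⟨A, hA⟩ := Finset.card_le_one_iff_subset_singleton.1 (Nat.lt_succ_iff.1 h1)
      exact ⟨A, A, by simpa using hA⟩
    · obtain ⟨A, B, -, h⟩ := Finset.card_eq_two.1 (le_antisymm hcard h2)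
      exact ⟨A, B, h.le⟩
  refine ⟨f A, f B, fun p hp => ?_⟩
  obtain ⟨C, hC, hpC⟩ := 𝒞.exists_mem hp
  have hpf := hf C hC hpC
  have := hAB hC
  simp only [Finset.mem_insert, Finset.mem_singleton] at this
  rcases this with rfl | rfl
  · exact Or.inl hpf
  · exact Or.inr hpf

/-- The square with edge length `s` in the corner `(x₀, y₀)`, or the one in the corner `(x₁, y₁)`,
contains `p`, provided that `p` lies in the box `[x₀, x₁] × [y₀, y₁]`. -/
def InCorners (x₀ y₀ x₁ y₁ s : ℝ) (p : Point) : Prop :=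
  (p.1 - x₀ ≤ s ∧ p.2 - y₀ ≤ s) ∨ (x₁ - p.1 ≤ s ∧ y₁ - p.2 ≤ s)

/-- As `InCorners`, for the corners `(x₀, y₁)` and `(x₁, y₀)`. -/
def InAnticorners (x₀ y₀ x₁ y₁ s : ℝ) (p : Point) : Prop :=
  (p.1 - x₀ ≤ s ∧ y₁ - p.2 ≤ s) ∨ (x₁ - p.1 ≤ s ∧ p.2 - y₀ ≤ s)

/-- `[x₀, x₁] × [y₀, y₁]` is the bounding box of `S`. -/
structure IsBoundingBox (S : Finset Point) (x₀ y₀ x₁ y₁ : ℝ) : Prop where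
  left : ∃ p ∈ S, p.1 = x₀
  bottom : ∃ p ∈ S, p.2 = y₀
  right : ∃ p ∈ S, p.1 = x₁
  top : ∃ p ∈ S, p.2 = y₁
  mem : ∀ p ∈ S, x₀ ≤ p.1 ∧ p.1 ≤ x₁ ∧ y₀ ≤ p.2 ∧ p.2 ≤ y₁

/-- Some point on the left side of the box lies in one of the squares, and since `c` is the left
centre, the square of `c` reaches at least as far left. In the same way the square of `c'` reaches
the right side. Which of the two reaches the bottom and which the top depends on the order of the
second coordinates of the centres, and this selects the diagonal. A square of edge `2 * r` that
reaches beyond both sides at a corner covers no more of the box than the one placed exactly in the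
corner. -/
theorem inCorners_or_inAnticorners_of_cover {S : Finset Point} {x₀ y₀ x₁ y₁ : ℝ}
    (hB : IsBoundingBox S x₀ y₀ x₁ y₁) {c c' : Point} {r : ℝ}
    (h : (S : Set Point) ⊆ Metric.closedBall c r ∪ Metric.closedBall c' r) :
    (∀ p ∈ S, InCorners x₀ y₀ x₁ y₁ (2 * r) p) ∨ (∀ p ∈ S, InAnticorners x₀ y₀ x₁ y₁ (2 * r) p) := by
  wlog hcc : c.1 ≤ c'.1 generalizing c c'
  · exact this (by rwa [Set.union_comm]) (le_of_not_ge hcc)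
  have h' : ∀ p ∈ S, (|p.1 - c.1| ≤ r ∧ |p.2 - c.2| ≤ r) ∨ (|p.1 - c'.1| ≤ r ∧ |p.2 - c'.2| ≤ r) := by
    intro p hp
    have := h hp
    rwa [Set.mem_union, mem_closedBall_iff_abs, mem_closedBall_iff_abs] at this
  simp only [abs_le] at h'
  obtain ⟨⟨pl, hpl, el⟩, ⟨pb, hpb, eb⟩, ⟨pr, hpr, er⟩, ⟨pt, hpt, et⟩, -⟩ := hB
  have hl : c.1 - r ≤ x₀ := by rcases h' pl hpl with h | h <;> linarith [h.1.1]
  have hr : x₁ ≤ c'.1 + r := by rcases h' pr hpr with h | h <;> linarith [h.1.2]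
  rcases le_total c.2 c'.2 with hc2 | hc2
  · left
    have hb : c.2 - r ≤ y₀ := by rcases h' pb hpb with h | h <;> linarith [h.2.1]
    have ht : y₁ ≤ c'.2 + r := by rcases h' pt hpt with h | h <;> linarith [h.2.2]
    intro p hp
    rcases h' p hp with h | h
    · left; constructor <;> linarith [h.1.2, h.2.2]
    · right; constructor <;> linarith [h.1.1, h.2.1]
  · right
    have hb : c'.2 - r ≤ y₀ := by rcases h' pb hpb with h | h <;> linarith [h.2.1]
    have ht : y₁ ≤ c.2 + r := by rcases h' pt hpt with h | h <;> linarith [h.2.2]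
    intro p hp
    rcases h' p hp with h | h
    · left; constructor <;> linarith [h.1.2, h.2.1]
    · right; constructor <;> linarith [h.1.1, h.2.2]

theorem isOptimalTwoCenter_empty (c c' : Point) : IsOptimalTwoCenter ∅ c c' 0 := by
  refine ⟨by simp, ⟨⊥, by simp, by simp [clusteringCost]⟩, ?_⟩
  rintro x ⟨𝒞, -, rfl⟩
  exact NNReal.coe_nonneg _

/-- A cover by two squares is optimal if no smaller pair of squares in opposite corners of the
bounding box covers. -/
theorem isOptimalTwoCenter_of_minimal {S : Finset Point} {x₀ y₀ x₁ y₁ s : ℝ}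
    (hB : IsBoundingBox S x₀ y₀ x₁ y₁) {c c' : Point} (hs : 0 ≤ s)
    (hcov : (S : Set Point) ⊆ Metric.closedBall c (s / 2) ∪ Metric.closedBall c' (s / 2))
    (hmin : ∀ σ, 0 ≤ σ → (∀ p ∈ S, InCorners x₀ y₀ x₁ y₁ σ p) → s ≤ σ)
    (hmin' : ∀ σ, 0 ≤ σ → (∀ p ∈ S, InAnticorners x₀ y₀ x₁ y₁ σ p) → s ≤ σ) :
    IsOptimalTwoCenter S c c' (s / 2) := by
  have hlow : ∀ 𝒞 : Finpartition S, 𝒞.parts.card ≤ 2 → s / 2 ≤ (clusteringCost 𝒞 : ℝ) := by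
    intro 𝒞 hcard
    -- Cluster radii are infima, so a cover is available only for radii above the cost; the slack
    -- `ε` is arbitrary.
    refine le_of_forall_pos_le_add fun ε hε => ?_
    let r : ℝ≥0 := clusteringCost 𝒞 + ⟨ε, hε.le⟩
    have hr : clusteringCost 𝒞 < r := lt_add_of_pos_right _ (by exact_mod_cast hε)
    obtain ⟨d, d', hd⟩ := exists_cover_of_clustering 𝒞 hcard hr
    have h2 : s ≤ 2 * (r : ℝ) := by
      rcases inCorners_or_inAnticorners_of_cover hB hd with h | h
      · exact hmin _ (by positivity) h
      · exact hmin' _ (by positivity) h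
    have : (r : ℝ) = clusteringCost 𝒞 + ε := rfl
    linarith
  refine ⟨hcov, ?_, ?_⟩
  · obtain ⟨𝒞, hcard, hcost⟩ := exists_clustering_of_cover (r := ⟨s / 2, by linarith⟩) hcov
    exact ⟨𝒞, hcard, le_antisymm (hlow 𝒞 hcard) (by exact_mod_cast hcost)⟩
  · rintro x ⟨𝒞, hcard, rfl⟩
    exact hlow 𝒞 hcard

theorem isOptimalTwoCenter_corners {S : Finset Point} {x₀ y₀ x₁ y₁ s : ℝ}
    (hB : IsBoundingBox S x₀ y₀ x₁ y₁) (hs : 0 ≤ s)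
    (hcov : ∀ p ∈ S, InCorners x₀ y₀ x₁ y₁ s p)
    (hmin : ∀ σ, 0 ≤ σ → (∀ p ∈ S, InCorners x₀ y₀ x₁ y₁ σ p) → s ≤ σ)
    (hmin' : ∀ σ, 0 ≤ σ → (∀ p ∈ S, InAnticorners x₀ y₀ x₁ y₁ σ p) → s ≤ σ) :
    IsOptimalTwoCenter S (x₀ + s / 2, y₀ + s / 2) (x₁ - s / 2, y₁ - s / 2) (s / 2) := by
  refine isOptimalTwoCenter_of_minimal hB hs (fun p hp => ?_) hmin hmin'
  rw [Set.mem_union, mem_closedBall_iff_abs, mem_closedBall_iff_abs]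
  simp only [abs_le]
  obtain ⟨h1, h2, h3, h4⟩ := hB.mem p hp
  rcases hcov p hp with ⟨h, h'⟩ | ⟨h, h'⟩
  · left; refine ⟨⟨?_, ?_⟩, ?_, ?_⟩ <;> linarith
  · right; refine ⟨⟨?_, ?_⟩, ?_, ?_⟩ <;> linarith

theorem isOptimalTwoCenter_anticorners {S : Finset Point} {x₀ y₀ x₁ y₁ s : ℝ}
    (hB : IsBoundingBox S x₀ y₀ x₁ y₁) (hs : 0 ≤ s)
    (hcov : ∀ p ∈ S, InAnticorners x₀ y₀ x₁ y₁ s p)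
    (hmin : ∀ σ, 0 ≤ σ → (∀ p ∈ S, InCorners x₀ y₀ x₁ y₁ σ p) → s ≤ σ)
    (hmin' : ∀ σ, 0 ≤ σ → (∀ p ∈ S, InAnticorners x₀ y₀ x₁ y₁ σ p) → s ≤ σ) :
    IsOptimalTwoCenter S (x₀ + s / 2, y₁ - s / 2) (x₁ - s / 2, y₀ + s / 2) (s / 2) := by
  refine isOptimalTwoCenter_of_minimal hB hs (fun p hp => ?_) hmin hmin'
  rw [Set.mem_union, mem_closedBall_iff_abs, mem_closedBall_iff_abs]
  simp only [abs_le]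
  obtain ⟨h1, h2, h3, h4⟩ := hB.mem p hp
  rcases hcov p hp with ⟨h, h'⟩ | ⟨h, h'⟩
  · left; refine ⟨⟨?_, ?_⟩, ?_, ?_⟩ <;> linarith
  · right; refine ⟨⟨?_, ?_⟩, ?_, ?_⟩ <;> linarith

/-! ### Reduction to dominance queries -/

/-- The linear functional with integer coefficients `c`. -/
def lin (c : ℤ × ℤ) (p : Point) : ℝ := (c.1 : ℝ) * p.1 + (c.2 : ℝ) * p.2

/-- The point `p` satisfies the three constraints of a dominance query. -/
def Dominated (c : ℕ → ℤ × ℤ) (α β γ : ℝ) (p : Point) : Prop :=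
  lin (c 0) p ≤ α ∧ lin (c 1) p ≤ β ∧ γ ≤ lin (c 2) p

/-- `v` is the maximum of the functional `c 0` on the points of `P` that satisfy the constraints,
and `d` if there are none. -/
structure IsDomMax (P : Finset Point) (c : ℕ → ℤ × ℤ) (α β γ d v : ℝ) : Prop where
  upper : ∀ p ∈ P, Dominated c α β γ p → lin (c 0) p ≤ v
  attained : (v = d ∧ ∀ p ∈ P, ¬ Dominated c α β γ p) ∨
    ∃ p ∈ P, Dominated c α β γ p ∧ v = lin (c 0) p

def triple (u v t : ℤ × ℤ) (l : ℕ) : ℤ × ℤ := if l = 0 then u else if l = 1 then v else t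

/-- The functionals of the dominance queries that a two-center query consists of. -/
def coef : ℕ → ℕ → ℤ × ℤ
  | 0 => triple (1, 0) (0, 1) (0, 1)
  | 1 => triple (-1, 0) (0, 1) (0, 1)
  | 2 => triple (0, 1) (1, 0) (1, 0)
  | 3 => triple (0, -1) (1, 0) (1, 0)
  -- The pairs 4–5, 6–7, 8–9 and 10–11 belong to the four corners top-left, bottom-right,
  -- bottom-left and top-right. Each pair lies on the two sides of the line of slope `±1` through
  -- its corner that bisects the right angle there.
  | 4 => triple (1, 0) (1, 1) (0, 1)
  | 5 => triple (0, -1) (1, 0) (1, 1)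
  | 6 => triple (0, 1) (1, 1) (1, 0)
  | 7 => triple (-1, 0) (0, 1) (1, 1)
  | 8 => triple (1, 0) (1, -1) (0, -1)
  | 9 => triple (0, 1) (1, 0) (1, -1)
  | 10 => triple (-1, 0) (-1, 1) (0, 1)
  | _ => triple (0, -1) (1, -1) (1, 0)

theorem mem_inRange {P : Finset Point} {a b p : Point} :
    p ∈ inRange P a b ↔ p ∈ P ∧ a.1 ≤ p.1 ∧ p.1 ≤ b.1 ∧ a.2 ≤ p.2 ∧ p.2 ≤ b.2 := by
  simp only [inRange, Finset.mem_filter, Set.mem_Icc, Prod.le_def]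
  tauto

/-- The left side of the rectangle is not among the constraints; it is tested on the rightmost
point. The default `a.1 - 1` makes this test also detect that no point satisfies the constraints. -/
theorem inRange_eq_empty_of_isDomMax {P : Finset Point} {a b : Point} {x₁ : ℝ}
    (h : IsDomMax P (coef 0) b.1 b.2 a.2 (a.1 - 1) x₁) (hx : x₁ < a.1) : inRange P a b = ∅ := by
  refine Finset.eq_empty_of_forall_notMem fun p hp => ?_
  obtain ⟨hP, h1, h2, h3, h4⟩ := mem_inRange.1 hp
  have := h.upper
  obtain ⟨p, q⟩ := p
  simp only [Dominated, coef, triple, lin, reduceIte, one_ne_zero, OfNat.ofNat_ne_zero,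
    OfNat.ofNat_ne_one, Int.cast_zero, Int.cast_one, zero_mul, one_mul,
    zero_add, add_zero, Prod.forall, and_imp] at this
  linarith [this p q hP h2 h4 h3]

/-- The bounding box from four dominance queries. -/
theorem isBoundingBox_of_isDomMax {P : Finset Point} {a b : Point} {x₀ y₀ x₁ y₁ : ℝ}
    (hx₁ : IsDomMax P (coef 0) b.1 b.2 a.2 (a.1 - 1) x₁)
    (hx₀ : IsDomMax P (coef 1) (-a.1) b.2 a.2 0 (-x₀))
    (hy₁ : IsDomMax P (coef 2) b.2 b.1 a.1 0 y₁)
    (hy₀ : IsDomMax P (coef 3) (-a.2) b.1 a.1 0 (-y₀)) (hne : a.1 ≤ x₁) :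
    IsBoundingBox (inRange P a b) x₀ y₀ x₁ y₁ := by
  obtain ⟨u1, t1⟩ := hx₁
  obtain ⟨u2, t2⟩ := hx₀
  obtain ⟨u3, t3⟩ := hy₁
  obtain ⟨u4, t4⟩ := hy₀
  simp only [Dominated, coef, triple, lin, reduceIte, one_ne_zero, OfNat.ofNat_ne_zero,
    OfNat.ofNat_ne_one, Int.cast_zero, Int.cast_one, Int.cast_neg, zero_mul, one_mul, neg_mul,
    zero_add, add_zero, Prod.forall, Prod.exists, and_imp] at u1 u2 u3 u4 t1 t2 t3 t4
  -- The default `a.1 - 1` contradicts `hne`, so there is a rightmost point. It satisfies the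
  -- constraints of the other three queries, so their defaults do not occur either.
  rcases t1 with ⟨t1, -⟩ | ⟨p, q, hpq, ⟨hp1, hp2, hp3⟩, e₁⟩
  · linarith
  subst x₁
  have hm : (p, q) ∈ inRange P a b := mem_inRange.2 ⟨hpq, hne, hp1, hp3, hp2⟩
  refine ⟨?_, ?_, ⟨_, hm, rfl⟩, ?_, ?_⟩
  · rcases t2 with ⟨-, t2⟩ | ⟨p', q', hp', ⟨h1, h2, h3⟩, e⟩
    · exact absurd ⟨neg_le_neg hne, hp2, hp3⟩ (t2 p q hpq)
    · have := u2 p q hpq (neg_le_neg hne) hp2 hp3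
      refine ⟨(p', q'), mem_inRange.2 ⟨hp', ?_, ?_, h3, h2⟩, ?_⟩ <;> dsimp only <;> linarith
  · rcases t4 with ⟨-, t4⟩ | ⟨p', q', hp', ⟨h1, h2, h3⟩, e⟩
    · exact absurd ⟨neg_le_neg hp3, hp1, hne⟩ (t4 p q hpq)
    · have := u4 p q hpq (neg_le_neg hp3) hp1 hne
      refine ⟨(p', q'), mem_inRange.2 ⟨hp', h3, h2, ?_, ?_⟩, ?_⟩ <;> dsimp only <;> linarith
  · rcases t3 with ⟨-, t3⟩ | ⟨p', q', hp', ⟨h1, h2, h3⟩, e⟩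
    · exact absurd ⟨hp2, hp1, hne⟩ (t3 p q hpq)
    · have := u3 p q hpq hp2 hp1 hne
      refine ⟨(p', q'), mem_inRange.2 ⟨hp', h3, h2, ?_, ?_⟩, ?_⟩ <;> dsimp only <;> linarith
  · rintro ⟨p', q'⟩ h
    obtain ⟨hP, h1, h2, h3, h4⟩ := mem_inRange.1 h
    dsimp only at *
    exact ⟨neg_le_neg_iff.1 (u2 _ _ hP (neg_le_neg h1) h4 h3), u1 _ _ hP h2 h4 h3,
      neg_le_neg_iff.1 (u4 _ _ hP (neg_le_neg h3) h2 h1), u3 _ _ hP h4 h2 h1⟩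

/-! ### Maximin problems, split into dominance queries -/

/-- `m` is the maximum of `min (f p) (g p)` over `p ∈ S`, or an upper bound that is at most zero. -/
def IsMaxMin (S : Finset Point) (f g : Point → ℝ) (m : ℝ) : Prop :=
  (∀ p ∈ S, f p ≤ m ∨ g p ≤ m) ∧ (m ≤ 0 ∨ ∃ p ∈ S, m ≤ f p ∧ m ≤ g p)

/-- Edge lengths are nonnegative, so the alternative `m ≤ 0` loses nothing. It absorbs the defaults
of empty queries and the values of points outside the box. -/
theorem IsMaxMin.le_of_forall {S : Finset Point} {f g : Point → ℝ} {m σ : ℝ}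
    (h : IsMaxMin S f g m) (hσ : 0 ≤ σ) (hS : ∀ p ∈ S, f p ≤ σ ∨ g p ≤ σ) : m ≤ σ := by
  rcases h.2 with h | ⟨p, hp, h1, h2⟩
  · linarith
  · rcases hS p hp with h | h <;> linarith

/-- On the left half of the box the minimum is the distance to the left side, on the right half the
distance to the right side. The side of the box that is missing among the three constraints is not
needed: points beyond it have a negative distance. -/
theorem isMaxMin_left_right {P : Finset Point} {a b : Point} {x₀ y₀ x₁ y₁ u v : ℝ}
    (hB : IsBoundingBox (inRange P a b) x₀ y₀ x₁ y₁)
    (hu : IsDomMax P (coef 0) ((x₀ + x₁) / 2) b.2 a.2 x₀ u)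
    (hv : IsDomMax P (coef 1) (-((x₀ + x₁) / 2)) b.2 a.2 (-x₁) v) :
    IsMaxMin (inRange P a b) (fun p => p.1 - x₀) (fun p => x₁ - p.1) (max (u - x₀) (x₁ + v)) := by
  obtain ⟨u1, t1⟩ := hu
  obtain ⟨u2, t2⟩ := hv
  simp only [Dominated, coef, triple, lin, reduceIte, one_ne_zero, OfNat.ofNat_ne_zero,
    OfNat.ofNat_ne_one, Int.cast_zero, Int.cast_one, Int.cast_neg, zero_mul, one_mul, neg_mul,
    zero_add, add_zero, Prod.forall, Prod.exists, and_imp] at u1 u2 t1 t2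
  obtain ⟨pl, hpl, el⟩ := hB.left
  obtain ⟨pr, hpr, er⟩ := hB.right
  have hl := mem_inRange.1 hpl
  have hr := mem_inRange.1 hpr
  refine ⟨fun p hp => ?_, ?_⟩
  · obtain ⟨hP, h1, h2, h3, h4⟩ := mem_inRange.1 hp
    obtain ⟨p, q⟩ := p
    dsimp only at *
    rcases le_total p ((x₀ + x₁) / 2) with h | h
    · have := u1 p q hP (by linarith) (by linarith) (by linarith)
      left; exact le_max_of_le_left (by linarith)
    · have := u2 p q hP (by linarith) (by linarith) (by linarith)
      right; exact le_max_of_le_right (by linarith)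
  · rcases le_total (u - x₀) (x₁ + v) with h | h
    · rw [max_eq_right h]
      rcases t2 with ⟨e, -⟩ | ⟨p, q, hp, ⟨g1, g2, g3⟩, e⟩
      · left; linarith
      · rcases le_or_gt (x₁ + v) 0 with h0 | h0
        · left; exact h0
        · right
          refine ⟨(p, q), mem_inRange.2 ⟨hp, ?_, ?_, g3, g2⟩, ?_⟩ <;> dsimp only
          · have := (hB.mem _ hpr).1; linarith
          · linarith
          · constructor <;> linarith
    · rw [max_eq_left h]
      rcases t1 with ⟨e, -⟩ | ⟨p, q, hp, ⟨g1, g2, g3⟩, e⟩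
      · left; linarith
      · rcases le_or_gt (u - x₀) 0 with h0 | h0
        · left; exact h0
        · right
          refine ⟨(p, q), mem_inRange.2 ⟨hp, ?_, ?_, g3, g2⟩, ?_⟩ <;> dsimp only
          · linarith
          · have := (hB.mem _ hpl).2.1; linarith
          · constructor <;> linarith

theorem isMaxMin_bottom_top {P : Finset Point} {a b : Point} {x₀ y₀ x₁ y₁ u v : ℝ}
    (hB : IsBoundingBox (inRange P a b) x₀ y₀ x₁ y₁)
    (hu : IsDomMax P (coef 2) ((y₀ + y₁) / 2) b.1 a.1 y₀ u)
    (hv : IsDomMax P (coef 3) (-((y₀ + y₁) / 2)) b.1 a.1 (-y₁) v) :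
    IsMaxMin (inRange P a b) (fun p => p.2 - y₀) (fun p => y₁ - p.2) (max (u - y₀) (y₁ + v)) := by
  obtain ⟨u1, t1⟩ := hu
  obtain ⟨u2, t2⟩ := hv
  simp only [Dominated, coef, triple, lin, reduceIte, one_ne_zero, OfNat.ofNat_ne_zero,
    OfNat.ofNat_ne_one, Int.cast_zero, Int.cast_one, Int.cast_neg, zero_mul, one_mul, neg_mul,
    zero_add, add_zero, Prod.forall, Prod.exists, and_imp] at u1 u2 t1 t2
  obtain ⟨pl, hpl, el⟩ := hB.bottom
  obtain ⟨pr, hpr, er⟩ := hB.top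
  have hl := mem_inRange.1 hpl
  have hr := mem_inRange.1 hpr
  refine ⟨fun p hp => ?_, ?_⟩
  · obtain ⟨hP, h1, h2, h3, h4⟩ := mem_inRange.1 hp
    obtain ⟨p, q⟩ := p
    dsimp only at *
    rcases le_total q ((y₀ + y₁) / 2) with h | h
    · have := u1 p q hP (by linarith) (by linarith) (by linarith)
      left; exact le_max_of_le_left (by linarith)
    · have := u2 p q hP (by linarith) (by linarith) (by linarith)
      right; exact le_max_of_le_right (by linarith)
  · rcases le_total (u - y₀) (y₁ + v) with h | h
    · rw [max_eq_right h]
      rcases t2 with ⟨e, -⟩ | ⟨p, q, hp, ⟨g1, g2, g3⟩, e⟩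
      · left; linarith
      · rcases le_or_gt (y₁ + v) 0 with h0 | h0
        · left; exact h0
        · right
          refine ⟨(p, q), mem_inRange.2 ⟨hp, g3, g2, ?_, ?_⟩, ?_⟩ <;> dsimp only
          · have := (hB.mem _ hpr).2.2.1; linarith
          · linarith
          · constructor <;> linarith
    · rw [max_eq_left h]
      rcases t1 with ⟨e, -⟩ | ⟨p, q, hp, ⟨g1, g2, g3⟩, e⟩
      · left; linarith
      · rcases le_or_gt (u - y₀) 0 with h0 | h0
        · left; exact h0
        · right
          refine ⟨(p, q), mem_inRange.2 ⟨hp, g3, g2, ?_, ?_⟩, ?_⟩ <;> dsimp only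
          · linarith
          · have := (hB.mem _ hpl).2.2.2; linarith
          · constructor <;> linarith

theorem IsBoundingBox.mem_inRange_of_le {P : Finset Point} {a b : Point} {x₀ y₀ x₁ y₁ : ℝ}
    (hB : IsBoundingBox (inRange P a b) x₀ y₀ x₁ y₁) {p q : ℝ} (hp : (p, q) ∈ P) (h1 : x₀ ≤ p)
    (h2 : p ≤ x₁) (h3 : y₀ ≤ q) (h4 : q ≤ y₁) : (p, q) ∈ inRange P a b := by
  obtain ⟨⟨pl, hl, el⟩, ⟨pb, hb, eb⟩, ⟨pr, hr, er⟩, ⟨pt, ht, et⟩, -⟩ := hB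
  have := mem_inRange.1 hl
  have := mem_inRange.1 hb
  have := mem_inRange.1 hr
  have := mem_inRange.1 ht
  refine mem_inRange.2 ⟨hp, ?_, ?_, ?_, ?_⟩ <;> dsimp only <;> linarith

theorem isMaxMin_left_top {P : Finset Point} {a b : Point} {x₀ y₀ x₁ y₁ u v : ℝ}
    (hB : IsBoundingBox (inRange P a b) x₀ y₀ x₁ y₁)
    (hu : IsDomMax P (coef 4) x₁ (x₀ + y₁) y₀ x₀ u)
    (hv : IsDomMax P (coef 5) (-y₀) x₁ (x₀ + y₁) (-y₁) v) :
    IsMaxMin (inRange P a b) (fun p => p.1 - x₀) (fun p => y₁ - p.2) (max (u - x₀) (y₁ + v)) := by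
  obtain ⟨u1, t1⟩ := hu
  obtain ⟨u2, t2⟩ := hv
  simp only [Dominated, coef, triple, lin, reduceIte, one_ne_zero, OfNat.ofNat_ne_zero,
    OfNat.ofNat_ne_one, Int.cast_zero, Int.cast_one, Int.cast_neg, zero_mul, one_mul, neg_mul,
    zero_add, add_zero, Prod.forall, Prod.exists, and_imp] at u1 u2 t1 t2
  refine ⟨fun p hp => ?_, ?_⟩
  · obtain ⟨hP, -⟩ := mem_inRange.1 hp
    obtain ⟨h1, h2, h3, h4⟩ := hB.mem p hp
    obtain ⟨p, q⟩ := p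
    dsimp only at *
    rcases le_total (p + q) (x₀ + y₁) with h | h
    · have := u1 p q hP (by linarith) (by linarith) (by linarith)
      left; exact le_max_of_le_left (by linarith)
    · have := u2 p q hP (by linarith) (by linarith) (by linarith)
      right; exact le_max_of_le_right (by linarith)
  · rcases le_total (u - x₀) (y₁ + v) with h | h
    · rw [max_eq_right h]
      rcases t2 with ⟨e, -⟩ | ⟨p, q, hp, ⟨g1, g2, g3⟩, e⟩
      · left; linarith
      · rcases le_or_gt (y₁ + v) 0 with h0 | h0
        · left; exact h0
        · right
          refine ⟨(p, q), hB.mem_inRange_of_le hp ?_ ?_ ?_ ?_, ?_, ?_⟩ <;>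
            (try dsimp only) <;> linarith
    · rw [max_eq_left h]
      rcases t1 with ⟨e, -⟩ | ⟨p, q, hp, ⟨g1, g2, g3⟩, e⟩
      · left; linarith
      · rcases le_or_gt (u - x₀) 0 with h0 | h0
        · left; exact h0
        · right
          refine ⟨(p, q), hB.mem_inRange_of_le hp ?_ ?_ ?_ ?_, ?_, ?_⟩ <;>
            (try dsimp only) <;> linarith

theorem isMaxMin_bottom_right {P : Finset Point} {a b : Point} {x₀ y₀ x₁ y₁ u v : ℝ}
    (hB : IsBoundingBox (inRange P a b) x₀ y₀ x₁ y₁)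
    (hu : IsDomMax P (coef 6) y₁ (y₀ + x₁) x₀ y₀ u)
    (hv : IsDomMax P (coef 7) (-x₀) y₁ (y₀ + x₁) (-x₁) v) :
    IsMaxMin (inRange P a b) (fun p => p.2 - y₀) (fun p => x₁ - p.1) (max (u - y₀) (x₁ + v)) := by
  obtain ⟨u1, t1⟩ := hu
  obtain ⟨u2, t2⟩ := hv
  simp only [Dominated, coef, triple, lin, reduceIte, one_ne_zero, OfNat.ofNat_ne_zero,
    OfNat.ofNat_ne_one, Int.cast_zero, Int.cast_one, Int.cast_neg, zero_mul, one_mul, neg_mul,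
    zero_add, add_zero, Prod.forall, Prod.exists, and_imp] at u1 u2 t1 t2
  refine ⟨fun p hp => ?_, ?_⟩
  · obtain ⟨hP, -⟩ := mem_inRange.1 hp
    obtain ⟨h1, h2, h3, h4⟩ := hB.mem p hp
    obtain ⟨p, q⟩ := p
    dsimp only at *
    rcases le_total (p + q) (y₀ + x₁) with h | h
    · have := u1 p q hP (by linarith) (by linarith) (by linarith)
      left; exact le_max_of_le_left (by linarith)
    · have := u2 p q hP (by linarith) (by linarith) (by linarith)
      right; exact le_max_of_le_right (by linarith)
  · rcases le_total (u - y₀) (x₁ + v) with h | h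
    · rw [max_eq_right h]
      rcases t2 with ⟨e, -⟩ | ⟨p, q, hp, ⟨g1, g2, g3⟩, e⟩
      · left; linarith
      · rcases le_or_gt (x₁ + v) 0 with h0 | h0
        · left; exact h0
        · right
          refine ⟨(p, q), hB.mem_inRange_of_le hp ?_ ?_ ?_ ?_, ?_, ?_⟩ <;>
            (try dsimp only) <;> linarith
    · rw [max_eq_left h]
      rcases t1 with ⟨e, -⟩ | ⟨p, q, hp, ⟨g1, g2, g3⟩, e⟩
      · left; linarith
      · rcases le_or_gt (u - y₀) 0 with h0 | h0
        · left; exact h0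
        · right
          refine ⟨(p, q), hB.mem_inRange_of_le hp ?_ ?_ ?_ ?_, ?_, ?_⟩ <;>
            (try dsimp only) <;> linarith

theorem isMaxMin_left_bottom {P : Finset Point} {a b : Point} {x₀ y₀ x₁ y₁ u v : ℝ}
    (hB : IsBoundingBox (inRange P a b) x₀ y₀ x₁ y₁)
    (hu : IsDomMax P (coef 8) x₁ (x₀ - y₀) (-y₁) x₀ u)
    (hv : IsDomMax P (coef 9) y₁ x₁ (x₀ - y₀) y₀ v) :
    IsMaxMin (inRange P a b) (fun p => p.1 - x₀) (fun p => p.2 - y₀) (max (u - x₀) (v - y₀)) := by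
  obtain ⟨u1, t1⟩ := hu
  obtain ⟨u2, t2⟩ := hv
  simp only [Dominated, coef, triple, lin, reduceIte, one_ne_zero, OfNat.ofNat_ne_zero,
    OfNat.ofNat_ne_one, Int.cast_zero, Int.cast_one, Int.cast_neg, zero_mul, one_mul, neg_mul,
    zero_add, add_zero, Prod.forall, Prod.exists, and_imp] at u1 u2 t1 t2
  refine ⟨fun p hp => ?_, ?_⟩
  · obtain ⟨hP, -⟩ := mem_inRange.1 hp
    obtain ⟨h1, h2, h3, h4⟩ := hB.mem p hp
    obtain ⟨p, q⟩ := p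
    dsimp only at *
    rcases le_total (p - q) (x₀ - y₀) with h | h
    · have := u1 p q hP (by linarith) (by linarith) (by linarith)
      left; exact le_max_of_le_left (by linarith)
    · have := u2 p q hP (by linarith) (by linarith) (by linarith)
      right; exact le_max_of_le_right (by linarith)
  · rcases le_total (u - x₀) (v - y₀) with h | h
    · rw [max_eq_right h]
      rcases t2 with ⟨e, -⟩ | ⟨p, q, hp, ⟨g1, g2, g3⟩, e⟩
      · left; linarith
      · rcases le_or_gt (v - y₀) 0 with h0 | h0
        · left; exact h0
        · right
          refine ⟨(p, q), hB.mem_inRange_of_le hp ?_ ?_ ?_ ?_, ?_, ?_⟩ <;>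
            (try dsimp only) <;> linarith
    · rw [max_eq_left h]
      rcases t1 with ⟨e, -⟩ | ⟨p, q, hp, ⟨g1, g2, g3⟩, e⟩
      · left; linarith
      · rcases le_or_gt (u - x₀) 0 with h0 | h0
        · left; exact h0
        · right
          refine ⟨(p, q), hB.mem_inRange_of_le hp ?_ ?_ ?_ ?_, ?_, ?_⟩ <;>
            (try dsimp only) <;> linarith

theorem isMaxMin_right_top {P : Finset Point} {a b : Point} {x₀ y₀ x₁ y₁ u v : ℝ}
    (hB : IsBoundingBox (inRange P a b) x₀ y₀ x₁ y₁)
    (hu : IsDomMax P (coef 10) (-x₀) (y₁ - x₁) y₀ (-x₁) u)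
    (hv : IsDomMax P (coef 11) (-y₀) (x₁ - y₁) x₀ (-y₁) v) :
    IsMaxMin (inRange P a b) (fun p => x₁ - p.1) (fun p => y₁ - p.2) (max (x₁ + u) (y₁ + v)) := by
  obtain ⟨u1, t1⟩ := hu
  obtain ⟨u2, t2⟩ := hv
  simp only [Dominated, coef, triple, lin, reduceIte, one_ne_zero, OfNat.ofNat_ne_zero,
    OfNat.ofNat_ne_one, Int.cast_zero, Int.cast_one, Int.cast_neg, zero_mul, one_mul, neg_mul,
    zero_add, add_zero, Prod.forall, Prod.exists, and_imp] at u1 u2 t1 t2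
  refine ⟨fun p hp => ?_, ?_⟩
  · obtain ⟨hP, -⟩ := mem_inRange.1 hp
    obtain ⟨h1, h2, h3, h4⟩ := hB.mem p hp
    obtain ⟨p, q⟩ := p
    dsimp only at *
    rcases le_total (q - p) (y₁ - x₁) with h | h
    · have := u1 p q hP (by linarith) (by linarith) (by linarith)
      left; exact le_max_of_le_left (by linarith)
    · have := u2 p q hP (by linarith) (by linarith) (by linarith)
      right; exact le_max_of_le_right (by linarith)
  · rcases le_total (x₁ + u) (y₁ + v) with h | h
    · rw [max_eq_right h]
      rcases t2 with ⟨e, -⟩ | ⟨p, q, hp, ⟨g1, g2, g3⟩, e⟩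
      · left; linarith
      · rcases le_or_gt (y₁ + v) 0 with h0 | h0
        · left; exact h0
        · right
          refine ⟨(p, q), hB.mem_inRange_of_le hp ?_ ?_ ?_ ?_, ?_, ?_⟩ <;>
            (try dsimp only) <;> linarith
    · rw [max_eq_left h]
      rcases t1 with ⟨e, -⟩ | ⟨p, q, hp, ⟨g1, g2, g3⟩, e⟩
      · left; linarith
      · rcases le_or_gt (x₁ + u) 0 with h0 | h0
        · left; exact h0
        · right
          refine ⟨(p, q), hB.mem_inRange_of_le hp ?_ ?_ ?_ ?_, ?_, ?_⟩ <;>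
            (try dsimp only) <;> linarith

/-- Distributivity: `(A ∧ B) ∨ (C ∧ D)` is the conjunction of `A ∨ C`, `B ∨ D`, `A ∨ D` and `B ∨ C`,
and each disjunction, over all points, is one maximin problem. -/
theorem inCorners_iff_of_isMaxMin {S : Finset Point} {x₀ y₀ x₁ y₁ m₁ m₂ m₃ m₄ σ : ℝ}
    (h₁ : IsMaxMin S (fun p => p.1 - x₀) (fun p => x₁ - p.1) m₁)
    (h₂ : IsMaxMin S (fun p => p.2 - y₀) (fun p => y₁ - p.2) m₂)
    (h₃ : IsMaxMin S (fun p => p.1 - x₀) (fun p => y₁ - p.2) m₃)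
    (h₄ : IsMaxMin S (fun p => p.2 - y₀) (fun p => x₁ - p.1) m₄) (hσ : 0 ≤ σ) :
    (∀ p ∈ S, InCorners x₀ y₀ x₁ y₁ σ p) ↔ max (max m₁ m₂) (max m₃ m₄) ≤ σ := by
  simp only [max_le_iff]
  constructor
  · intro h
    refine ⟨⟨h₁.le_of_forall hσ ?_, h₂.le_of_forall hσ ?_⟩,
      h₃.le_of_forall hσ ?_, h₄.le_of_forall hσ ?_⟩ <;>
    · intro p hp
      have := h p hp
      unfold InCorners at this
      tauto
  · rintro ⟨⟨g1, g2⟩, g3, g4⟩ p hp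
    have k1 := (h₁.1 p hp).imp (fun h => h.trans g1) (fun h => h.trans g1)
    have k2 := (h₂.1 p hp).imp (fun h => h.trans g2) (fun h => h.trans g2)
    have k3 := (h₃.1 p hp).imp (fun h => h.trans g3) (fun h => h.trans g3)
    have k4 := (h₄.1 p hp).imp (fun h => h.trans g4) (fun h => h.trans g4)
    unfold InCorners
    tauto

theorem inAnticorners_iff_of_isMaxMin {S : Finset Point} {x₀ y₀ x₁ y₁ m₁ m₂ m₃ m₄ σ : ℝ}
    (h₁ : IsMaxMin S (fun p => p.1 - x₀) (fun p => x₁ - p.1) m₁)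
    (h₂ : IsMaxMin S (fun p => p.2 - y₀) (fun p => y₁ - p.2) m₂)
    (h₃ : IsMaxMin S (fun p => p.1 - x₀) (fun p => p.2 - y₀) m₃)
    (h₄ : IsMaxMin S (fun p => x₁ - p.1) (fun p => y₁ - p.2) m₄) (hσ : 0 ≤ σ) :
    (∀ p ∈ S, InAnticorners x₀ y₀ x₁ y₁ σ p) ↔ max (max m₁ m₂) (max m₃ m₄) ≤ σ := by
  simp only [max_le_iff]
  constructor
  · intro h
    refine ⟨⟨h₁.le_of_forall hσ ?_, h₂.le_of_forall hσ ?_⟩,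
      h₃.le_of_forall hσ ?_, h₄.le_of_forall hσ ?_⟩ <;>
    · intro p hp
      have := h p hp
      unfold InAnticorners at this
      tauto
  · rintro ⟨⟨g1, g2⟩, g3, g4⟩ p hp
    have k1 := (h₁.1 p hp).imp (fun h => h.trans g1) (fun h => h.trans g1)
    have k2 := (h₂.1 p hp).imp (fun h => h.trans g2) (fun h => h.trans g2)
    have k3 := (h₃.1 p hp).imp (fun h => h.trans g3) (fun h => h.trans g3)
    have k4 := (h₄.1 p hp).imp (fun h => h.trans g4) (fun h => h.trans g4)
    unfold InAnticorners
    tauto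

/-- At a leftmost point both distances are nonnegative. This one value therefore makes the whole
maximum a legitimate edge length. -/
theorem IsBoundingBox.nonneg_of_isMaxMin {S : Finset Point} {x₀ y₀ x₁ y₁ m : ℝ}
    (hB : IsBoundingBox S x₀ y₀ x₁ y₁)
    (h : IsMaxMin S (fun p => p.1 - x₀) (fun p => x₁ - p.1) m) : 0 ≤ m := by
  obtain ⟨p, hp, -⟩ := hB.left
  obtain ⟨h1, h2, -⟩ := hB.mem p hp
  rcases h.1 p hp with h | h <;> dsimp only at h <;> linarith

/-- The two-center problem solved from the values of the maximin problems. -/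
theorem isOptimalTwoCenter_of_isMaxMin {S : Finset Point} {x₀ y₀ x₁ y₁ m₁ m₂ m₃ m₄ m₅ m₆ : ℝ}
    (hB : IsBoundingBox S x₀ y₀ x₁ y₁)
    (h₁ : IsMaxMin S (fun p => p.1 - x₀) (fun p => x₁ - p.1) m₁)
    (h₂ : IsMaxMin S (fun p => p.2 - y₀) (fun p => y₁ - p.2) m₂)
    (h₃ : IsMaxMin S (fun p => p.1 - x₀) (fun p => y₁ - p.2) m₃)
    (h₄ : IsMaxMin S (fun p => p.2 - y₀) (fun p => x₁ - p.1) m₄)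
    (h₅ : IsMaxMin S (fun p => p.1 - x₀) (fun p => p.2 - y₀) m₅)
    (h₆ : IsMaxMin S (fun p => x₁ - p.1) (fun p => y₁ - p.2) m₆)
    {s s' : ℝ} (hs : s = max (max m₁ m₂) (max m₃ m₄)) (hs' : s' = max (max m₁ m₂) (max m₅ m₆)) :
    (s ≤ s' → IsOptimalTwoCenter S (x₀ + s / 2, y₀ + s / 2) (x₁ - s / 2, y₁ - s / 2) (s / 2)) ∧
    (s' ≤ s → IsOptimalTwoCenter S (x₀ + s' / 2, y₁ - s' / 2) (x₁ - s' / 2, y₀ + s' / 2)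
      (s' / 2)) := by
  have h0 := hB.nonneg_of_isMaxMin h₁
  have hs0 : 0 ≤ s := hs ▸ le_max_of_le_left (le_max_of_le_left h0)
  have hs0' : 0 ≤ s' := hs' ▸ le_max_of_le_left (le_max_of_le_left h0)
  have key : ∀ σ, 0 ≤ σ → ((∀ p ∈ S, InCorners x₀ y₀ x₁ y₁ σ p) ↔ s ≤ σ) := fun σ hσ => by
    rw [hs, inCorners_iff_of_isMaxMin h₁ h₂ h₃ h₄ hσ]
  have key' : ∀ σ, 0 ≤ σ → ((∀ p ∈ S, InAnticorners x₀ y₀ x₁ y₁ σ p) ↔ s' ≤ σ) := fun σ hσ => by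
    rw [hs', inAnticorners_iff_of_isMaxMin h₁ h₂ h₅ h₆ hσ]
  constructor
  · intro hle
    exact isOptimalTwoCenter_corners hB hs0 ((key s hs0).2 le_rfl) (fun σ h => (key σ h).1)
      (fun σ h h' => hle.trans ((key' σ h).1 h'))
  · intro hle
    exact isOptimalTwoCenter_anticorners hB hs0' ((key' s' hs0').2 le_rfl)
      (fun σ h h' => hle.trans ((key σ h).1 h')) (fun σ h => (key' σ h).1)

/-! ### Reasoning about programs with words read as natural numbers -/

/-- The content of registers, or of the memory, with words read as natural numbers. -/
structure State where
  word : ℕ → ℕ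
  real : ℕ → ℝ

def Registers.abs {w : ℕ} (s : Registers w) : State where
  word := fun i => (s.word i).toNat
  real := s.real

noncomputable def Memory.abs {w : ℕ} (M : Memory w) : State where
  word := fun a => (M.words.getD a 0).toNat
  real := fun a => M.reals.getD a 0

/-- The value of a word expression in the natural numbers. Bitwise operations are not supported. -/
def WordExpr.nval (m σ : State) : WordExpr → ℕ
  | .reg i => σ.word i
  | .const k => k
  | .read e => m.word (e.nval m σ)
  | .add e f => e.nval m σ + f.nval m σ
  | .sub e f => e.nval m σ - f.nval m σ
  | .mul e f => e.nval m σ * f.nval m σ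
  | .div e f => e.nval m σ / f.nval m σ
  | .mod e f => e.nval m σ % f.nval m σ
  | _ => 0

/-- No operation in the evaluation of a word expression overflows. -/
def WordExpr.Safe (w : ℕ) (m σ : State) : WordExpr → Prop
  | .reg _ => True
  | .const k => k < 2 ^ w
  | .read e => e.Safe w m σ
  | .add e f => e.Safe w m σ ∧ f.Safe w m σ ∧ e.nval m σ + f.nval m σ < 2 ^ w
  | .sub e f => e.Safe w m σ ∧ f.Safe w m σ ∧ f.nval m σ ≤ e.nval m σ
  | .mul e f => e.Safe w m σ ∧ f.Safe w m σ ∧ e.nval m σ * f.nval m σ < 2 ^ w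
  | .div e f => e.Safe w m σ ∧ f.Safe w m σ
  | .mod e f => e.Safe w m σ ∧ f.Safe w m σ
  | _ => False

noncomputable def RealExpr.rval (m σ : State) : RealExpr → ℝ
  | .reg i => σ.real i
  | .const z => (z : ℝ)
  | .read e => m.real (e.nval m σ)
  | .add e f => e.rval m σ + f.rval m σ
  | .sub e f => e.rval m σ - f.rval m σ
  | .mul e f => e.rval m σ * f.rval m σ
  | .div e f => e.rval m σ / f.rval m σ

def RealExpr.Safe (w : ℕ) (m σ : State) : RealExpr → Prop
  | .reg _ => True
  | .const _ => True
  | .read e => e.Safe w m σ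
  | .add e f => e.Safe w m σ ∧ f.Safe w m σ
  | .sub e f => e.Safe w m σ ∧ f.Safe w m σ
  | .mul e f => e.Safe w m σ ∧ f.Safe w m σ
  | .div e f => e.Safe w m σ ∧ f.Safe w m σ

def Cond.Sat (m σ : State) : Cond → Prop
  | .wordLt e f => e.nval m σ < f.nval m σ
  | .realLt e f => e.rval m σ < f.rval m σ
  | .not b => ¬ b.Sat m σ
  | .and b b' => b.Sat m σ ∧ b'.Sat m σ

def Cond.Safe (w : ℕ) (m σ : State) : Cond → Prop
  | .wordLt e f => e.Safe w m σ ∧ f.Safe w m σ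
  | .realLt e f => e.Safe w m σ ∧ f.Safe w m σ
  | .not b => b.Safe w m σ
  | .and b b' => b.Safe w m σ ∧ b'.Safe w m σ

theorem WordExpr.toNat_eval {w : ℕ} (M : Memory w) (s : Registers w) (e : WordExpr)
    (h : e.Safe w M.abs s.abs) : (e.eval M s).toNat = e.nval M.abs s.abs := by
  induction e with
  | reg i => rfl
  | const k => simpa [WordExpr.eval, WordExpr.nval] using Nat.mod_eq_of_lt h
  | read e ih => simp only [WordExpr.eval, WordExpr.nval, ih h]; rfl
  | add e f ihe ihf =>
    obtain ⟨he, hf, h⟩ := h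
    simp only [WordExpr.eval, WordExpr.nval, BitVec.toNat_add, ihe he, ihf hf, Nat.mod_eq_of_lt h]
  | sub e f ihe ihf =>
    obtain ⟨he, hf, h⟩ := h
    rw [← ihe he, ← ihf hf] at h
    simp only [WordExpr.eval, WordExpr.nval, ← ihe he, ← ihf hf]
    exact BitVec.toNat_sub_of_le (BitVec.le_def.2 h)
  | mul e f ihe ihf =>
    obtain ⟨he, hf, h⟩ := h
    simp only [WordExpr.eval, WordExpr.nval, BitVec.toNat_mul, ihe he, ihf hf, Nat.mod_eq_of_lt h]
  | div e f ihe ihf =>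
    simp only [WordExpr.eval, WordExpr.nval, BitVec.toNat_udiv, ihe h.1, ihf h.2]
  | mod e f ihe ihf =>
    simp only [WordExpr.eval, WordExpr.nval, BitVec.toNat_umod, ihe h.1, ihf h.2]
  | _ => exact h.elim

theorem RealExpr.eval_eq_rval {w : ℕ} (M : Memory w) (s : Registers w) (e : RealExpr)
    (h : e.Safe w M.abs s.abs) : e.eval M s = e.rval M.abs s.abs := by
  induction e with
  | reg i => rfl
  | const k => rfl
  | read e => simp only [RealExpr.eval, RealExpr.rval, WordExpr.toNat_eval M s e h]; rfl
  | add e f ihe ihf => simp only [RealExpr.eval, RealExpr.rval, ihe h.1, ihf h.2]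
  | sub e f ihe ihf => simp only [RealExpr.eval, RealExpr.rval, ihe h.1, ihf h.2]
  | mul e f ihe ihf => simp only [RealExpr.eval, RealExpr.rval, ihe h.1, ihf h.2]
  | div e f ihe ihf => simp only [RealExpr.eval, RealExpr.rval, ihe h.1, ihf h.2]

theorem Cond.holds_iff_sat {w : ℕ} (M : Memory w) (s : Registers w) (b : Cond)
    (h : b.Safe w M.abs s.abs) : b.Holds M s ↔ b.Sat M.abs s.abs := by
  induction b with
  | wordLt e f =>
    simp only [Cond.Holds, Cond.Sat, WordExpr.toNat_eval M s e h.1, WordExpr.toNat_eval M s f h.2]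
  | realLt e f =>
    simp only [Cond.Holds, Cond.Sat, RealExpr.eval_eq_rval M s e h.1,
      RealExpr.eval_eq_rval M s f h.2]
  | not b ih => simp only [Cond.Holds, Cond.Sat, ih h]
  | and b b' ih ih' => simp only [Cond.Holds, Cond.Sat, ih h.1, ih' h.2]

/-! ### Running times and rules for total correctness -/

/-- An upper bound on the number of elementary operations of a program whose loops
take at most `L` rounds. -/
def Program.maxCost (L : ℕ) : Program → ℕ
  | .skip => 1
  | .setWord _ e => e.cost + 1
  | .setReal _ e => e.cost + 1
  | .seq p q => p.maxCost L + q.maxCost L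
  | .ite b p q => b.cost + max (p.maxCost L) (q.maxCost L)
  | .loop b p => L * (b.cost + p.maxCost L) + b.cost

def Program.IsLoopFree : Program → Bool
  | .seq p q => p.IsLoopFree && q.IsLoopFree
  | .ite _ p q => p.IsLoopFree && q.IsLoopFree
  | .loop _ _ => false
  | _ => true

/-- The program has no nested loops. -/
def Program.IsFlat : Program → Bool
  | .seq p q => p.IsFlat && q.IsFlat
  | .ite _ p q => p.IsFlat && q.IsFlat
  | .loop _ p => p.IsLoopFree
  | _ => true

theorem Program.IsLoopFree.maxCost_eq {p : Program} (h : p.IsLoopFree) (L L' : ℕ) :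
    p.maxCost L = p.maxCost L' := by
  induction p with
  | seq p q ihp ihq =>
    simp only [Program.IsLoopFree, Bool.and_eq_true] at h
    simp only [Program.maxCost, ihp h.1, ihq h.2]
  | ite b p q ihp ihq =>
    simp only [Program.IsLoopFree, Bool.and_eq_true] at h
    simp only [Program.maxCost, ihp h.1, ihq h.2]
  | loop b p => simp [Program.IsLoopFree] at h
  | _ => rfl

/-- Without nested loops the cost bound is affine in the number of rounds. A logarithmic number of
rounds per loop therefore yields logarithmic time for the whole program. -/
theorem Program.IsFlat.maxCost_le {p : Program} (h : p.IsFlat) (L : ℕ) :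
    p.maxCost L ≤ p.maxCost 1 * (L + 1) := by
  induction p with
  | seq p q ihp ihq =>
    simp only [Program.IsFlat, Bool.and_eq_true] at h
    simp only [Program.maxCost]
    nlinarith [ihp h.1, ihq h.2]
  | ite b p q ihp ihq =>
    simp only [Program.IsFlat, Bool.and_eq_true] at h
    simp only [Program.maxCost, add_mul]
    refine add_le_add (Nat.le_mul_of_pos_right _ L.succ_pos) (max_le ?_ ?_)
    · exact (ihp h.1).trans (Nat.mul_le_mul_right _ (le_max_left _ _))
    · exact (ihq h.2).trans (Nat.mul_le_mul_right _ (le_max_right _ _))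
  | loop b p =>
    have := Program.IsLoopFree.maxCost_eq h L 1
    simp only [Program.maxCost, this]
    nlinarith
  | _ => exact Nat.le_mul_of_pos_right _ L.succ_pos

/-- Started in the state `σ`, the program `p` halts in a state that satisfies `Q`,
and its loops take at most `L` rounds. -/
def Spec {w : ℕ} (M : Memory w) (L : ℕ) (p : Program) (σ : State) (Q : State → Prop) : Prop :=
  ∀ s : Registers w, s.abs = σ → ∃ t s', Runs M p s t s' ∧ t ≤ p.maxCost L ∧ Q s'.abs

section Rules

variable {w : ℕ} {M : Memory w} {L : ℕ}

theorem Spec.skip {σ : State} {Q : State → Prop} (h : Q σ) : Spec M L .skip σ Q :=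
  fun s hs => ⟨1, s, .skip s, le_rfl, hs ▸ h⟩

theorem Spec.setWord {σ : State} {Q : State → Prop} {i : ℕ} {e : WordExpr}
    (he : e.Safe w M.abs σ) (h : Q ⟨Function.update σ.word i (e.nval M.abs σ), σ.real⟩) :
    Spec M L (.setWord i e) σ Q := by
  rintro s rfl
  refine ⟨_, _, .setWord s i e, le_rfl, ?_⟩
  convert h using 1
  simp only [Registers.abs, State.mk.injEq, and_true]
  funext j
  by_cases hj : j = i
  · subst hj
    simp only [Function.update_self]
    exact WordExpr.toNat_eval M s e he
  · simp [hj]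

theorem Spec.setReal {σ : State} {Q : State → Prop} {i : ℕ} {e : RealExpr}
    (he : e.Safe w M.abs σ) (h : Q ⟨σ.word, Function.update σ.real i (e.rval M.abs σ)⟩) :
    Spec M L (.setReal i e) σ Q := by
  rintro s rfl
  refine ⟨_, _, .setReal s i e, le_rfl, ?_⟩
  convert h using 1
  simp only [Registers.abs, State.mk.injEq, true_and]
  rw [RealExpr.eval_eq_rval M s e he]
  rfl

theorem Spec.seq {σ : State} {Q : State → Prop} {p q : Program}
    (h : Spec M L p σ (fun σ' => Spec M L q σ' Q)) : Spec M L (.seq p q) σ Q := by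
  intro s hs
  obtain ⟨t, s', h1, h2, h3⟩ := h s hs
  obtain ⟨t', s'', h1', h2', h3'⟩ := h3 s' rfl
  exact ⟨_, _, .seq h1 h1', add_le_add h2 h2', h3'⟩

theorem Spec.ite {σ : State} {Q : State → Prop} {b : Cond} {p q : Program}
    (hb : b.Safe w M.abs σ) (hp : b.Sat M.abs σ → Spec M L p σ Q)
    (hq : ¬ b.Sat M.abs σ → Spec M L q σ Q) : Spec M L (.ite b p q) σ Q := by
  rintro s rfl
  by_cases h : b.Sat M.abs s.abs
  · obtain ⟨t, s', h1, h2, h3⟩ := hp h s rfl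
    exact ⟨_, _, .iteTrue ((b.holds_iff_sat M s hb).2 h) h1,
      Nat.add_le_add_left (h2.trans (le_max_left _ _)) _, h3⟩
  · obtain ⟨t, s', h1, h2, h3⟩ := hq h s rfl
    exact ⟨_, _, .iteFalse (mt (b.holds_iff_sat M s hb).1 h) h1,
      Nat.add_le_add_left (h2.trans (le_max_right _ _)) _, h3⟩

/-- A loop with an invariant that is indexed by the number of remaining rounds. -/
theorem Spec.loop {σ : State} {Q : State → Prop} {b : Cond} {p : Program}
    (Inv : ℕ → State → Prop) (j : ℕ) (hj : j ≤ L) (hσ : Inv j σ)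
    (hb : ∀ i σ, Inv i σ → b.Safe w M.abs σ ∧ (b.Sat M.abs σ ↔ 0 < i))
    (hp : ∀ i σ, i < j → Inv (i + 1) σ → Spec M L p σ (Inv i)) (hQ : ∀ σ, Inv 0 σ → Q σ) :
    Spec M L (.loop b p) σ Q := by
  have key : ∀ i, i ≤ j → ∀ s : Registers w, Inv i s.abs → ∃ t s', Runs M (.loop b p) s t s' ∧
      t ≤ i * (b.cost + p.maxCost L) + b.cost ∧ Inv 0 s'.abs := by
    intro i
    induction i with
    | zero =>
      intro _ s hs
      obtain ⟨h1, h2⟩ := hb 0 _ hs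
      refine ⟨_, s, .loopDone ?_, by simp, hs⟩
      rw [b.holds_iff_sat M s h1, h2]
      exact lt_irrefl 0
    | succ i ih =>
      intro hi s hs
      obtain ⟨h1, h2⟩ := hb _ _ hs
      obtain ⟨t, s', r, ht, hs'⟩ := hp i _ hi hs s rfl
      obtain ⟨t', s'', r', ht', hs''⟩ := ih (Nat.le_of_succ_le hi) s' hs'
      refine ⟨_, s'', .loopStep ((b.holds_iff_sat M s h1).2 (h2.2 i.succ_pos)) r r', ?_, hs''⟩
      rw [Nat.succ_mul]
      omega
  rintro s rfl
  obtain ⟨t, s', r, ht, hs'⟩ := key j le_rfl s hσ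
  refine ⟨t, s', r, ht.trans ?_, hQ _ hs'⟩
  exact Nat.add_le_add_right (Nat.mul_le_mul_right _ hj) _

end Rules

/-! ### Functions that grow by at most one per step, stored as bit sequences -/

def IsUnitStep (f : ℕ → ℕ) : Prop := f 0 = 0 ∧ ∀ t, f t ≤ f (t + 1) ∧ f (t + 1) ≤ f t + 1

/-- The number of ones among the first `q` bits. -/
def bitRank (β : ℕ → Bool) (q : ℕ) : ℕ := Nat.count (fun j => β j = true) q

theorem bitRank_succ (β : ℕ → Bool) (q : ℕ) :
    bitRank β (q + 1) = bitRank β q + if β q = true then 1 else 0 := Nat.count_succ _ _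

theorem bitRank_le (β : ℕ → Bool) (q : ℕ) : bitRank β q ≤ q := Nat.count_le _

theorem bitRank_mono (β : ℕ → Bool) {q q' : ℕ} (h : q ≤ q') : bitRank β q ≤ bitRank β q' :=
  Nat.count_monotone _ h

/-- The bits are the increments of `f`, so the sum telescopes and a value of `f` is the difference
of two ranks. The offset `q` allows many functions to share one sequence. -/
theorem bitRank_add_of_isUnitStep {f : ℕ → ℕ} (hf : IsUnitStep f) {β : ℕ → Bool} {q t : ℕ}
    (h : ∀ j < t, (β (q + j) = true ↔ f j < f (j + 1))) :
    bitRank β (q + t) = bitRank β q + f t := by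
  induction t with
  | zero => simp [hf.1]
  | succ t ih =>
    rw [← add_assoc, bitRank_succ, ih fun j hj => h j (hj.trans t.lt_succ_self)]
    have := hf.2 t
    split_ifs with hb
    · have := (h t t.lt_succ_self).1 hb
      omega
    · have := mt (h t t.lt_succ_self).2 hb
      omega

/-! ### Ranks in constant time from samples and a lookup table -/

/-- A numbering of the bit patterns of length `b`. -/
noncomputable def patternEquiv (b : ℕ) : (Fin b → Bool) ≃ Fin (2 ^ b) :=
  Fintype.equivFinOfCardEq (by simp)

/-- The number of the `k`-th block of length `b`. -/
noncomputable def blockCode (b : ℕ) (β : ℕ → Bool) (k : ℕ) : ℕ :=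
  patternEquiv b (fun i => β (b * k + i))

/-- The lookup table: at `x * b + i`, the rank of the position `i` in the `x`-th pattern. -/
noncomputable def rankTable (b : ℕ) (x : ℕ) : ℕ :=
  if h : x / b < 2 ^ b then
    bitRank (fun i => if hi : i < b then (patternEquiv b).symm ⟨x / b, h⟩ ⟨i, hi⟩ else false) (x % b)
  else 0

theorem blockCode_lt (b : ℕ) (β : ℕ → Bool) (k : ℕ) : blockCode b β k < 2 ^ b := Fin.is_lt _

theorem rankTable_le (b x : ℕ) : rankTable b x ≤ x := by
  unfold rankTable
  split_ifs
  · exact (bitRank_le _ _).trans (Nat.mod_le _ _)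
  · exact Nat.zero_le _

/-- The rank at the block boundary is sampled. The remainder depends only on the pattern of the
block and the offset, so one table serves all blocks. -/
theorem bitRank_eq_sample_add_rankTable {b : ℕ} (hb : 0 < b) (β : ℕ → Bool) (q : ℕ) :
    bitRank β q =
      bitRank β (b * (q / b)) + rankTable b (blockCode b β (q / b) * b + q % b) := by
  have hlt := Nat.mod_lt q hb
  have hdiv : (blockCode b β (q / b) * b + q % b) / b = blockCode b β (q / b) := by
    rw [mul_comm, Nat.mul_add_div hb, Nat.div_eq_of_lt hlt, add_zero]
  have hmod : (blockCode b β (q / b) * b + q % b) % b = q % b := by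
    rw [mul_comm, Nat.mul_add_mod, Nat.mod_mod]
  rw [rankTable, dif_pos (by rw [hdiv]; exact blockCode_lt _ _ _), hmod]
  conv_lhs => rw [← Nat.div_add_mod q b]
  have key : ∀ t ≤ b, bitRank β (b * (q / b) + t) = bitRank β (b * (q / b)) +
      bitRank (fun i => if hi : i < b then
        (patternEquiv b).symm ⟨_, hdiv.symm ▸ blockCode_lt b β (q / b)⟩ ⟨i, hi⟩ else false) t := by
    intro t
    induction t with
    | zero => simp [bitRank]
    | succ t ih =>
      intro ht
      rw [← add_assoc, bitRank_succ, ih (Nat.le_of_succ_le ht), bitRank_succ, add_assoc]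
      congr 2
      have : (⟨_, hdiv.symm ▸ blockCode_lt b β (q / b)⟩ : Fin (2 ^ b)) =
        patternEquiv b (fun i => β (b * (q / b) + i)) := Fin.ext hdiv
      rw [dif_pos (Nat.lt_of_succ_le ht), this, Equiv.symm_apply_apply]
  exact key _ hlt.le

/-! ### One bit sequence for all nodes of the tree -/

/-- The bits of all nodes of a binary tree with `2 ^ L` leaves. Node `a` of level `l` covers the
leaves from `a` to `a + 2 ^ (L - l)`, and its bits describe the function `g l a`. -/
def treeBits (L : ℕ) (g : ℕ → ℕ → ℕ → ℕ) (q : ℕ) : Bool :=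
  -- Every level has two bits per leaf, since the staircase of a node with `H` leaves is evaluated
  -- at sums of two local ranks, hence up to `2 * H`. The bits of the node at leaf `a` of level `l`
  -- start at `2 * (l * 2 ^ L + a)`.
  let l := q / (2 * 2 ^ L)
  let H := 2 ^ (L - l)
  let a := (q % (2 * 2 ^ L)) / (2 * H) * H
  let j := q % (2 * H)
  decide (g l a j < g l a (j + 1))

theorem bitRank_treeBits {L : ℕ} {g : ℕ → ℕ → ℕ → ℕ} {l a : ℕ} (hl : l ≤ L)
    (hg : IsUnitStep (g l a)) (ha : 2 ^ (L - l) ∣ a) (haN : a < 2 ^ L) {t : ℕ}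
    (ht : t ≤ 2 * 2 ^ (L - l)) :
    bitRank (treeBits L g) (2 * (l * 2 ^ L + a) + t) =
      bitRank (treeBits L g) (2 * (l * 2 ^ L + a)) + g l a t := by
  refine bitRank_add_of_isUnitStep hg fun j hj => ?_
  obtain ⟨k, rfl⟩ := ha
  have hN : 2 ^ L = 2 ^ (L - l) * 2 ^ l := by rw [← pow_add]; congr 1; omega
  have hH : 0 < 2 ^ (L - l) := by positivity
  have hj' : j < 2 * 2 ^ (L - l) := hj.trans_le ht
  set H := 2 ^ (L - l) with hHd
  have hk : k < 2 ^ l := by rw [hN] at haN; exact Nat.lt_of_mul_lt_mul_left haN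
  have hlt : 2 * H * k + j < 2 * 2 ^ L := by
    rw [hN]
    calc 2 * H * k + j < 2 * H * k + 2 * H := by omega
      _ = 2 * H * (k + 1) := by ring
      _ ≤ 2 * H * 2 ^ l := Nat.mul_le_mul_left _ hk
      _ = _ := by ring
  have e1 : 2 * (l * 2 ^ L + H * k) + j = 2 * 2 ^ L * l + (2 * H * k + j) := by ring
  have d1 : (2 * (l * 2 ^ L + H * k) + j) / (2 * 2 ^ L) = l := by
    rw [e1, Nat.mul_add_div (by positivity), Nat.div_eq_of_lt hlt, add_zero]
  have d2 : (2 * (l * 2 ^ L + H * k) + j) % (2 * 2 ^ L) = 2 * H * k + j := by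
    rw [e1, Nat.mul_add_mod, Nat.mod_eq_of_lt hlt]
  have d3 : (2 * H * k + j) / (2 * H) = k := by
    rw [Nat.mul_add_div (by positivity), Nat.div_eq_of_lt hj', add_zero]
  have d4 : (2 * (l * 2 ^ L + H * k) + j) % (2 * H) = j := by
    have : 2 * (l * 2 ^ L + H * k) + j = 2 * H * (2 ^ l * l + k) + j := by rw [hN]; ring
    rw [this, Nat.mul_add_mod, Nat.mod_eq_of_lt hj']
  simp only [treeBits, d1, d2, ← hHd, d3, d4, decide_eq_true_eq, mul_comm k H]

/-! ### Local ranks -/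

/-- The number of elements of `v` whose rank is less than `y`. -/
def cnt (v : Finset ℕ) (ρ : ℕ → ℕ) (y : ℕ) : ℕ := (v.filter (fun i => ρ i < y)).card

theorem cnt_le_card (v : Finset ℕ) (ρ : ℕ → ℕ) (y : ℕ) : cnt v ρ y ≤ v.card :=
  Finset.card_filter_le _ _

/-- Inside a node, comparisons of global ranks can be replaced by comparisons of local ranks. This
lets the node store functions on a range of its own size. -/
theorem cnt_lt_cnt_iff {v : Finset ℕ} {ρ : ℕ → ℕ} {i y : ℕ} (hi : i ∈ v) :
    cnt v ρ (ρ i) < cnt v ρ y ↔ ρ i < y := by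
  constructor
  · intro h
    by_contra hy
    refine absurd h (not_lt.2 (Finset.card_le_card fun j hj => ?_))
    simp only [Finset.mem_filter] at hj ⊢
    exact ⟨hj.1, hj.2.trans_le (not_lt.1 hy)⟩
  · intro h
    refine Finset.card_lt_card (Finset.ssubset_iff_of_subset (fun j hj => ?_) |>.2 ⟨i, ?_, ?_⟩)
    · simp only [Finset.mem_filter] at hj ⊢
      exact ⟨hj.1, hj.2.trans h⟩
    · simp [hi, h]
    · simp

theorem cnt_injOn {v : Finset ℕ} {ρ : ℕ → ℕ} (hρ : Function.Injective ρ) {i j : ℕ} (hi : i ∈ v)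
    (hj : j ∈ v) (h : cnt v ρ (ρ i) = cnt v ρ (ρ j)) : i = j := by
  have h1 := (cnt_lt_cnt_iff (ρ := ρ) (y := ρ j) hi).not
  have h2 := (cnt_lt_cnt_iff (ρ := ρ) (y := ρ i) hj).not
  exact hρ (le_antisymm (not_lt.1 (h2.1 (by omega))) (not_lt.1 (h1.1 (by omega))))

theorem cnt_union {u v : Finset ℕ} (h : Disjoint u v) (ρ : ℕ → ℕ) (y : ℕ) :
    cnt (u ∪ v) ρ y = cnt u ρ y + cnt v ρ y := by
  rw [cnt, Finset.filter_union, Finset.card_union_of_disjoint (Finset.disjoint_filter_filter h)]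
  rfl

/-- The number of elements of `u` among the first `c` elements of `v`. -/
def subCount (v u : Finset ℕ) (ρ : ℕ → ℕ) (c : ℕ) : ℕ :=
  (u.filter (fun i => cnt v ρ (ρ i) < c)).card

/-- Local ranks in `v` are distinct because `ρ` is injective, so at most one element of `u` has
local rank `t`. -/
theorem isUnitStep_subCount {v u : Finset ℕ} (huv : u ⊆ v) {ρ : ℕ → ℕ}
    (hρ : Function.Injective ρ) : IsUnitStep (subCount v u ρ) := by
  refine ⟨by simp [subCount], fun t => ⟨Finset.card_le_card fun i hi => ?_, ?_⟩⟩
  · simp only [Finset.mem_filter] at hi ⊢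
    exact ⟨hi.1, hi.2.trans t.lt_succ_self⟩
  · have : u.filter (fun i => cnt v ρ (ρ i) < t + 1) ⊆ u.filter (fun i => cnt v ρ (ρ i) < t) ∪
        u.filter (fun i => cnt v ρ (ρ i) = t) := by
      intro i hi
      simp only [Finset.mem_filter, Finset.mem_union] at hi ⊢
      rcases Nat.lt_succ_iff_lt_or_eq.1 hi.2 with h | h <;> simp [hi.1, h]
    refine (Finset.card_le_card this).trans ((Finset.card_union_le _ _).trans
      (Nat.add_le_add_left (Finset.card_le_one.2 fun i hi j hj => ?_) _))
    simp only [Finset.mem_filter] at hi hj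
    exact cnt_injOn hρ (huv hi.1) (huv hj.1) (hi.2.trans hj.2.symm)

/-- The local rank of `y` in the parent determines that in the child, so no search is needed below
the root. -/
theorem subCount_cnt {v u : Finset ℕ} (huv : u ⊆ v) (ρ : ℕ → ℕ) (y : ℕ) :
    subCount v u ρ (cnt v ρ y) = cnt u ρ y := by
  unfold subCount
  conv_rhs => unfold cnt
  congr 1
  exact Finset.filter_congr fun i hi => cnt_lt_cnt_iff (huv hi)

/-- No element of `v` has rank less than `c` for `ρ` and at least `d` for `ρ'`
(ranks within `v`). -/
def NoneInCorner (v : Finset ℕ) (ρ ρ' : ℕ → ℕ) (c d : ℕ) : Prop :=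
  ∀ i ∈ v, cnt v ρ (ρ i) < c → cnt v ρ' (ρ' i) < d

open Classical in
/-- The boundary between empty and non-empty corners, as a function along the antidiagonals. -/
noncomputable def stair (v : Finset ℕ) (ρ ρ' : ℕ → ℕ) (t : ℕ) : ℕ :=
  Nat.findGreatest (fun c => NoneInCorner v ρ ρ' c (t - c)) t

theorem NoneInCorner.mono {v : Finset ℕ} {ρ ρ' : ℕ → ℕ} {c c' d d' : ℕ}
    (h : NoneInCorner v ρ ρ' c d) (hc : c' ≤ c) (hd : d ≤ d') : NoneInCorner v ρ ρ' c' d' :=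
  fun i hi hic => (h i hi (hic.trans_le hc)).trans_le hd

theorem noneInCorner_stair (v : Finset ℕ) (ρ ρ' : ℕ → ℕ) (t : ℕ) :
    NoneInCorner v ρ ρ' (stair v ρ ρ' t) (t - stair v ρ ρ' t) := by
  classical
  unfold stair
  exact Nat.findGreatest_spec (P := fun c => NoneInCorner v ρ ρ' c (t - c)) (Nat.zero_le t)
    (fun i _ h => absurd h (Nat.not_lt_zero _))

theorem le_stair {v : Finset ℕ} {ρ ρ' : ℕ → ℕ} {t c : ℕ} (hc : c ≤ t)
    (h : NoneInCorner v ρ ρ' c (t - c)) : c ≤ stair v ρ ρ' t := by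
  classical
  exact Nat.le_findGreatest hc h

theorem stair_le (v : Finset ℕ) (ρ ρ' : ℕ → ℕ) (t : ℕ) : stair v ρ ρ' t ≤ t := by
  classical
  exact Nat.findGreatest_le t

/-- Emptiness of the corner is preserved when `c` decreases and when `d` increases. Along an
antidiagonal `c + d = t` the admissible `c` thus form an initial segment, which one threshold
describes. -/
theorem noneInCorner_iff_le_stair {v : Finset ℕ} {ρ ρ' : ℕ → ℕ} {c d : ℕ} :
    NoneInCorner v ρ ρ' c d ↔ c ≤ stair v ρ ρ' (c + d) := by
  constructor
  · intro h
    exact le_stair (Nat.le_add_right _ _) (by rwa [Nat.add_sub_cancel_left])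
  · intro h
    exact (noneInCorner_stair v ρ ρ' (c + d)).mono h (by omega)

/-- From one antidiagonal to the next, the threshold `c` remains admissible with a larger `d`; back
again, `c - 1` is admissible with the same `d`. -/
theorem isUnitStep_stair (v : Finset ℕ) (ρ ρ' : ℕ → ℕ) : IsUnitStep (stair v ρ ρ') := by
  refine ⟨Nat.le_zero.1 (stair_le _ _ _ _), fun t => ⟨?_, ?_⟩⟩
  · have := stair_le v ρ ρ' t
    exact le_stair (by omega) ((noneInCorner_stair v ρ ρ' t).mono le_rfl (by omega))
  · have := stair_le v ρ ρ' (t + 1)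
    rcases Nat.eq_zero_or_pos (stair v ρ ρ' (t + 1)) with h0 | h0
    · omega
    · have h : stair v ρ ρ' (t + 1) - 1 ≤ stair v ρ ρ' t :=
        le_stair (by omega) ((noneInCorner_stair v ρ ρ' (t + 1)).mono (by omega) (by omega))
      omega

/-- This is the emptiness test of the descent: one staircase value, looked up at the sum of the two
local ranks, is compared with the first of them. -/
theorem stair_lt_cnt_iff {v : Finset ℕ} {ρ ρ' : ℕ → ℕ} {y z : ℕ} :
    stair v ρ ρ' (cnt v ρ y + cnt v ρ' z) < cnt v ρ y ↔ ∃ i ∈ v, ρ i < y ∧ z ≤ ρ' i := by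
  rw [← not_le, ← noneInCorner_iff_le_stair, NoneInCorner]
  push Not
  refine exists_congr fun i => and_congr_right fun hi => ?_
  rw [cnt_lt_cnt_iff hi, ← not_lt, cnt_lt_cnt_iff hi, not_lt]

/-! ### Values of expressions -/

/-- The expression `e` is evaluated to `v` without overflow. -/
def Val {w : ℕ} (M : Memory w) (σ : State) (e : WordExpr) (v : ℕ) : Prop :=
  e.Safe w M.abs σ ∧ e.nval M.abs σ = v

section Val

variable {w : ℕ} {M : Memory w} {L : ℕ} {σ : State} {e f : WordExpr} {u v : ℕ}

theorem Val.reg (i : ℕ) : Val M σ (.reg i) (σ.word i) := ⟨trivial, rfl⟩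

theorem Val.reg_of_eq {i : ℕ} (h : σ.word i = v) : Val M σ (.reg i) v := ⟨trivial, h⟩

theorem Val.const {k : ℕ} (h : k < 2 ^ w) : Val M σ (.const k) k := ⟨h, rfl⟩

theorem Val.read (he : Val M σ e u) : Val M σ (.read e) (M.abs.word u) := by
  obtain ⟨he, rfl⟩ := he
  exact ⟨he, rfl⟩

theorem Val.add (he : Val M σ e u) (hf : Val M σ f v) (h : u + v < 2 ^ w) :
    Val M σ (.add e f) (u + v) := by
  obtain ⟨he, rfl⟩ := he
  obtain ⟨hf, rfl⟩ := hf
  exact ⟨⟨he, hf, h⟩, rfl⟩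

theorem Val.sub (he : Val M σ e u) (hf : Val M σ f v) (h : v ≤ u) :
    Val M σ (.sub e f) (u - v) := by
  obtain ⟨he, rfl⟩ := he
  obtain ⟨hf, rfl⟩ := hf
  exact ⟨⟨he, hf, h⟩, rfl⟩

theorem Val.mul (he : Val M σ e u) (hf : Val M σ f v) (h : u * v < 2 ^ w) :
    Val M σ (.mul e f) (u * v) := by
  obtain ⟨he, rfl⟩ := he
  obtain ⟨hf, rfl⟩ := hf
  exact ⟨⟨he, hf, h⟩, rfl⟩

theorem Val.div (he : Val M σ e u) (hf : Val M σ f v) : Val M σ (.div e f) (u / v) := by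
  obtain ⟨he, rfl⟩ := he
  obtain ⟨hf, rfl⟩ := hf
  exact ⟨⟨he, hf⟩, rfl⟩

theorem Val.mod (he : Val M σ e u) (hf : Val M σ f v) : Val M σ (.mod e f) (u % v) := by
  obtain ⟨he, rfl⟩ := he
  obtain ⟨hf, rfl⟩ := hf
  exact ⟨⟨he, hf⟩, rfl⟩

theorem Val.congr (he : Val M σ e u) (h : u = v) : Val M σ e v := h ▸ he

theorem Spec.setWord_of_val {Q : State → Prop} {i : ℕ} (he : Val M σ e v)
    (h : Q ⟨Function.update σ.word i v, σ.real⟩) : Spec M L (.setWord i e) σ Q :=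
  Spec.setWord he.1 (by rwa [he.2])

theorem Spec.ite_wordLt {Q : State → Prop} {p q : Program} (he : Val M σ e u) (hf : Val M σ f v)
    (hp : u < v → Spec M L p σ Q) (hq : v ≤ u → Spec M L q σ Q) :
    Spec M L (.ite (.wordLt e f) p q) σ Q := by
  obtain ⟨he, rfl⟩ := he
  obtain ⟨hf, rfl⟩ := hf
  exact Spec.ite ⟨he, hf⟩ hp fun h => hq (not_lt.1 h)

end Val

/-! ### The layout of the data structure -/

/-- The functions that are stored with the node `[a, a + 2 ^ (L - l))` of level `l`. -/
noncomputable def nodeFun (L : ℕ) (ρ ρ' : ℕ → ℕ) (j l a : ℕ) : ℕ → ℕ :=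
  if j = 0 then stair (Finset.Ico a (a + 2 ^ (L - l))) ρ ρ'
  else subCount (Finset.Ico a (a + 2 ^ (L - l))) (Finset.Ico a (a + 2 ^ (L - l) / 2))
    (if j = 1 then ρ else ρ')

/-- The memory `M` holds, for each of the twelve triples of functionals, the points of `P` sorted
by each functional, and the bit sequences of the tree with respect to the three orders. -/
structure Layout {w : ℕ} (M : Memory w) (P : Finset Point) (L b : ℕ) where
  /-- The points in the order of the `j`-th functional of the `k`-th triple. -/
  pts : ℕ → ℕ → ℕ → Point
  /-- From the position in the order of the first functional to the position in the order
  of the `j`-th functional. -/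
  rk : ℕ → ℕ → Equiv.Perm ℕ
  card_lt : P.card < 2 ^ L
  block_pos : 0 < b
  -- With `D = 2 ^ L * (L + 1)`, the addresses formed by the program are at most `74 * (8 * D) +
  -- 73`, so the factor 2048 rules out overflow.
  large : 2048 * (2 ^ L * (L + 1)) ≤ 2 ^ w
  -- There are `74 = 2 + 12 * 3 * 2` interleaved arrays of words: the parameters (entries 0, 1, 2 at
  -- the addresses 0, 74, 148), the lookup table, and a sample array and a code array for each of
  -- the 36 bit sequences. The reals form `72 = 12 * 3 * 2` arrays, for the two coordinates of 36
  -- sorted lists.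
  word_card : M.abs.word 0 = P.card
  word_size : M.abs.word 74 = 2 ^ L
  word_block : M.abs.word 148 = b
  real_fst : ∀ k < 12, ∀ j < 3, ∀ i < P.card, M.abs.real (72 * i + (6 * k + 2 * j)) = (pts k j i).1
  real_snd : ∀ k < 12, ∀ j < 3, ∀ i < P.card,
    M.abs.real (72 * i + (6 * k + 2 * j + 1)) = (pts k j i).2
  pts_mem : ∀ k < 12, ∀ j < 3, ∀ i < P.card, pts k j i ∈ P
  pts_surj : ∀ k < 12, ∀ j < 3, ∀ p ∈ P, ∃ i < P.card, pts k j i = p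
  pts_mono : ∀ k < 12, ∀ j < 3, ∀ i i', i ≤ i' → i' < P.card →
    lin (coef k j) (pts k j i) ≤ lin (coef k j) (pts k j i')
  -- The tree has `2 ^ L` leaves but only `P.card` points. The padding positions keep ranks of at
  -- least `P.card`, so they never satisfy the constraint that the second rank is less than `Y ≤
  -- P.card`.
  rk_lt : ∀ k j i, rk k j i < P.card ↔ i < P.card
  pts_rk : ∀ k < 12, ∀ j < 3, ∀ i < P.card, pts k j (rk k j i) = pts k 0 i
  code_le : ∀ k < 12, ∀ j < 3, ∀ q ≤ 2 * (2 ^ L * (L + 1)),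
    M.abs.word (74 * (q / b) + (6 * k + 2 * j + 3)) * b + b ≤ 8 * (2 ^ L * (L + 1))
  rank_eq : ∀ k < 12, ∀ j < 3, ∀ q ≤ 2 * (2 ^ L * (L + 1)),
    M.abs.word (74 * (q / b) + (6 * k + 2 * j + 2)) +
      M.abs.word (74 * (M.abs.word (74 * (q / b) + (6 * k + 2 * j + 3)) * b + q % b) + 1) =
    bitRank (treeBits L (nodeFun L (rk k 1) (rk k 2) j)) q

/-- Entry `e` of the `t`-th array of words; the arrays are interleaved. -/
def arrE (t : ℕ) (e : WordExpr) : WordExpr := .read (.add (.mul (.const 74) e) (.const t))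

def cardE : WordExpr := .read (.const 0)
def sizeE : WordExpr := .read (.const 74)
def blockE : WordExpr := .read (.const 148)

/-- The rank of position `q` in the `j`-th bit sequence of the `k`-th structure. -/
def rankE (k j : ℕ) (q : WordExpr) : WordExpr :=
  .add (arrE (6 * k + 2 * j + 2) (.div q blockE))
    (arrE 1 (.add (.mul (arrE (6 * k + 2 * j + 3) (.div q blockE)) blockE) (.mod q blockE)))

/-- The value at `c` of the function stored with the node at address `s`. -/
def nodeE (k j : ℕ) (s c : WordExpr) : WordExpr :=
  .sub (rankE k j (.add (.mul (.const 2) s) c)) (rankE k j (.mul (.const 2) s))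

/-- A coordinate of the point at position `e` of the `j`-th list of the `k`-th structure. -/
def coordE (t : ℕ) (e : WordExpr) : RealExpr := .read (.add (.mul (.const 72) e) (.const t))

/-- The `j`-th functional of the `k`-th triple at the point at position `e` of its list. -/
def linE (k j : ℕ) (e : WordExpr) : RealExpr :=
  .add (.mul (.const (coef k j).1) (coordE (6 * k + 2 * j) e))
    (.mul (.const (coef k j).2) (coordE (6 * k + 2 * j + 1) e))

theorem isUnitStep_nodeFun (L : ℕ) {ρ ρ' : ℕ → ℕ} (hρ : Function.Injective ρ)
    (hρ' : Function.Injective ρ') (j l a : ℕ) : IsUnitStep (nodeFun L ρ ρ' j l a) := by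
  have hsub : Finset.Ico a (a + 2 ^ (L - l) / 2) ⊆ Finset.Ico a (a + 2 ^ (L - l)) :=
    Finset.Ico_subset_Ico_right (Nat.add_le_add_left (Nat.div_le_self _ _) _)
  unfold nodeFun
  split_ifs
  · exact isUnitStep_stair _ _ _
  · exact isUnitStep_subCount hsub hρ
  · exact isUnitStep_subCount hsub hρ'

/-- Addresses of nodes are bounded. -/
theorem node_address_le {L l a : ℕ} (hl : l ≤ L) (ha : a + 2 ^ (L - l) ≤ 2 ^ L) :
    l * 2 ^ L + a + 2 ^ (L - l) ≤ 2 ^ L * (L + 1) := by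
  have : l * 2 ^ L ≤ L * 2 ^ L := Nat.mul_le_mul_right _ hl
  have e : 2 ^ L * (L + 1) = L * 2 ^ L + 2 ^ L := by ring
  omega

namespace Layout

variable {w : ℕ} {M : Memory w} {P : Finset Point} {L b : ℕ}

theorem size_le (_Λ : Layout M P L b) : 2 ^ L ≤ 2 ^ L * (L + 1) ∧ 1 ≤ 2 ^ L :=
  ⟨Nat.le_mul_of_pos_right _ L.succ_pos, Nat.one_le_two_pow⟩

theorem val_card (Λ : Layout M P L b) {σ : State} : Val M σ cardE P.card :=
  (Val.read (Val.const (Nat.two_pow_pos w))).congr Λ.word_card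

theorem val_size (Λ : Layout M P L b) {σ : State} : Val M σ sizeE (2 ^ L) := by
  have := Λ.large
  have := Λ.size_le
  exact (Val.read (Val.const (by omega))).congr Λ.word_size

theorem val_block (Λ : Layout M P L b) {σ : State} : Val M σ blockE b := by
  have := Λ.large
  have := Λ.size_le
  exact (Val.read (Val.const (by omega))).congr Λ.word_block

theorem val_arr (Λ : Layout M P L b) {σ : State} {e : WordExpr} {t u : ℕ} (he : Val M σ e u)
    (ht : t < 74) (hu : u ≤ 8 * (2 ^ L * (L + 1))) :
    Val M σ (arrE t e) (M.abs.word (74 * u + t)) := by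
  have := Λ.large
  have := Λ.size_le
  exact Val.read (Val.add (Val.mul (Val.const (by omega)) he (by omega)) (Val.const (by omega))
    (by omega))

theorem val_rank (Λ : Layout M P L b) {σ : State} {q : WordExpr} {k j u : ℕ} (hk : k < 12)
    (hj : j < 3) (hq : Val M σ q u) (hu : u ≤ 2 * (2 ^ L * (L + 1))) :
    Val M σ (rankE k j q) (bitRank (treeBits L (nodeFun L (Λ.rk k 1) (Λ.rk k 2) j)) u) := by
  have h1 := Λ.large
  have h2 := Λ.size_le
  have h3 := Λ.code_le k hk j hj u hu
  have h4 := Nat.mod_lt u Λ.block_pos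
  have h5 := Nat.div_le_self u b
  have h6 := bitRank_le (treeBits L (nodeFun L (Λ.rk k 1) (Λ.rk k 2) j)) u
  have h7 := Λ.rank_eq k hk j hj u hu
  have hd := hq.div Λ.val_block
  have hc := Λ.val_arr (t := 6 * k + 2 * j + 3) hd (by omega) (by omega)
  refine Val.congr (Val.add (Λ.val_arr hd (by omega) (by omega)) (Λ.val_arr (Val.add
    (Val.mul hc Λ.val_block (by omega)) (hq.mod Λ.val_block) (by omega)) (by omega) (by omega)) ?_)
    h7
  rw [h7]
  omega

/-- The bits of a node start at twice its address; subtracting the rank there leaves the increments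
of the node's own function. -/
theorem val_node (Λ : Layout M P L b) {σ : State} {s c : WordExpr} {k j l a v : ℕ} (hk : k < 12)
    (hj : j < 3) (hl : l ≤ L) (hdvd : 2 ^ (L - l) ∣ a) (ha : a + 2 ^ (L - l) ≤ 2 ^ L)
    (hs : Val M σ s (l * 2 ^ L + a)) (hc : Val M σ c v) (hv : v ≤ 2 * 2 ^ (L - l)) :
    Val M σ (nodeE k j s c) (nodeFun L (Λ.rk k 1) (Λ.rk k 2) j l a v) := by
  have h1 := Λ.large
  have h2 := Λ.size_le
  have h3 := node_address_le hl ha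
  have hH : 0 < 2 ^ (L - l) := by positivity
  have h4 := bitRank_treeBits hl (isUnitStep_nodeFun L (Λ.rk k 1).injective (Λ.rk k 2).injective
    j l a) hdvd (by omega) hv
  have hs2 := Val.mul (Val.const (k := 2) (by omega)) hs (by omega)
  refine Val.congr (Val.sub (Λ.val_rank hk hj (Val.add hs2 hc (by omega)) (by omega))
    (Λ.val_rank hk hj hs2 (by omega)) (bitRank_mono _ (by omega))) ?_
  rw [h4]
  omega

/-- From a node to its left child, for the order `j`. -/
theorem val_leftCount (Λ : Layout M P L b) {σ : State} {s c : WordExpr} {k j l a H y : ℕ}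
    (hk : k < 12) (hj : j < 2) (hl : l ≤ L) (hH : 2 ^ (L - l) = 2 * H) (hdvd : 2 * H ∣ a)
    (ha : a + 2 * H ≤ 2 ^ L) (hs : Val M σ s (l * 2 ^ L + a))
    (hc : Val M σ c (cnt (Finset.Ico a (a + 2 * H)) (Λ.rk k (j + 1)) y)) :
    Val M σ (nodeE k (j + 1) s c) (cnt (Finset.Ico a (a + H)) (Λ.rk k (j + 1)) y) := by
  have hcard := cnt_le_card (Finset.Ico a (a + 2 * H)) (Λ.rk k (j + 1)) y
  rw [Nat.card_Ico] at hcard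
  refine (Λ.val_node hk (by omega) hl (hH ▸ hdvd) (hH ▸ ha) hs hc (by omega)).congr ?_
  have hsub : Finset.Ico a (a + H) ⊆ Finset.Ico a (a + 2 * H) :=
    Finset.Ico_subset_Ico_right (by omega)
  rw [nodeFun, if_neg (Nat.succ_ne_zero j), hH, Nat.mul_div_cancel_left H two_pos]
  have : (if j + 1 = 1 then ⇑(Λ.rk k 1) else ⇑(Λ.rk k 2)) = ⇑(Λ.rk k (j + 1)) := by
    interval_cases j <;> rfl
  rw [this, subCount_cnt hsub]

/-- The test whether a node contains a point in the given corner. -/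
theorem val_stair (Λ : Layout M P L b) {σ : State} {s c d : WordExpr} {k l a H y z : ℕ}
    (hk : k < 12) (hl : l ≤ L) (hH : 2 ^ (L - l) = H) (hdvd : H ∣ a)
    (ha : a + H ≤ 2 ^ L) (hs : Val M σ s (l * 2 ^ L + a))
    (hc : Val M σ c (cnt (Finset.Ico a (a + H)) (Λ.rk k 1) y))
    (hd : Val M σ d (cnt (Finset.Ico a (a + H)) (Λ.rk k 2) z)) :
    ∃ u, Val M σ (nodeE k 0 s (.add c d)) u ∧
      (u < cnt (Finset.Ico a (a + H)) (Λ.rk k 1) y ↔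
        ∃ i, a ≤ i ∧ i < a + H ∧ Λ.rk k 1 i < y ∧ z ≤ Λ.rk k 2 i) := by
  have h1 := Λ.large
  have h2 := Λ.size_le
  have hcard := cnt_le_card (Finset.Ico a (a + H)) (Λ.rk k 1) y
  have hcard' := cnt_le_card (Finset.Ico a (a + H)) (Λ.rk k 2) z
  rw [Nat.card_Ico] at hcard hcard'
  refine ⟨_, Λ.val_node hk (by omega) hl (hH ▸ hdvd) (hH ▸ ha) hs (hc.add hd (by omega))
    (by omega), ?_⟩
  rw [nodeFun, if_pos rfl, hH, stair_lt_cnt_iff]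
  simp only [Finset.mem_Ico, and_assoc]

theorem rval_linE (Λ : Layout M P L b) {σ : State} {e : WordExpr} {k j i : ℕ} (hk : k < 12)
    (hj : j < 3) (he : Val M σ e i) (hi : i < P.card) :
    (linE k j e).rval M.abs σ = lin (coef k j) (Λ.pts k j i) := by
  obtain ⟨-, rfl⟩ := he
  rw [lin, ← Λ.real_fst k hk j hj _ hi, ← Λ.real_snd k hk j hj _ hi]
  rfl

theorem safe_linE (Λ : Layout M P L b) {σ : State} {e : WordExpr} {k j i : ℕ} (hk : k < 12)
    (hj : j < 3) (he : Val M σ e i) (hi : i ≤ 2 ^ L) : (linE k j e).Safe w M.abs σ := by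
  have h1 := Λ.large
  have h2 := Λ.size_le
  have h : ∀ t < 72, (coordE t e).Safe w M.abs σ := fun t ht =>
    (Val.add (Val.mul (Val.const (k := 72) (by omega)) he (by omega)) (Val.const (by omega))
      (by omega)).1
  exact ⟨⟨trivial, h _ (by omega)⟩, trivial, h _ (by omega)⟩

end Layout

/-! ### Binary search -/

/-- Binary search for the largest number in `[0, 2 ^ L)`, in register `0`, such that the test `c`
succeeds for a prefix; the test is about the sum of the registers `0` and `1`. -/
def bsearch (c : Cond) : Program :=
  .seq (.setWord 0 (.const 0)) <| .seq (.setWord 1 sizeE) <|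
  .loop (.wordLt (.const 1) (.reg 1)) <|
    .seq (.setWord 1 (.div (.reg 1) (.const 2))) <|
    .ite c (.setWord 0 (.add (.reg 0) (.reg 1))) .skip

theorem spec_bsearch {w : ℕ} {M : Memory w} {P : Finset Point} {L b : ℕ} (Λ : Layout M P L b)
    {c : Cond} {σ : State} {X : ℕ} (hX : X < 2 ^ L) {Q : State → Prop}
    (hc : ∀ σ' : State, σ'.real = σ.real → 0 < σ'.word 1 → σ'.word 0 + σ'.word 1 ≤ 2 ^ L →
      c.Safe w M.abs σ' ∧ (c.Sat M.abs σ' ↔ σ'.word 0 + σ'.word 1 ≤ X))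
    (hQ : ∀ W : ℕ → ℕ, W 0 = X → (∀ i, 2 ≤ i → W i = σ.word i) → Q ⟨W, σ.real⟩) :
    Spec M L (bsearch c) σ Q := by
  have h1 := Λ.large
  have h2 := Λ.size_le
  refine Spec.seq (Spec.setWord_of_val (Val.const (by omega)) (Spec.seq
    (Spec.setWord_of_val Λ.val_size ?_)))
  -- The threshold `X` stays in the interval of length `2 ^ i` that starts at register 0. This
  -- interval stays within `[0, 2 ^ L]`, which also excludes overflow.
  refine Spec.loop (fun i σ' => σ'.real = σ.real ∧ (∀ i, 2 ≤ i → σ'.word i = σ.word i) ∧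
    σ'.word 1 = 2 ^ i ∧ σ'.word 0 ≤ X ∧ X < σ'.word 0 + 2 ^ i ∧ σ'.word 0 + 2 ^ i ≤ 2 ^ L)
    L le_rfl ?_ ?_ ?_ ?_
  · refine ⟨rfl, fun i hi => ?_, ?_, ?_, ?_, ?_⟩
    · simp [show i ≠ 0 by omega, show i ≠ 1 by omega]
    all_goals simp [hX]
  · rintro i τ ⟨-, -, e1, -⟩
    refine ⟨⟨(Val.const (M := M) (σ := τ) (k := 1) (by omega)).1, trivial⟩, ?_⟩
    simp only [Cond.Sat, WordExpr.nval, e1]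
    exact Nat.one_lt_two_pow_iff.trans Nat.pos_iff_ne_zero.symm
  · rintro i ⟨W, R⟩ hi ⟨eR, eW, e1, h0, h0', h0''⟩
    dsimp only at eR eW e1 h0 h0' h0''
    rw [pow_succ] at e1 h0' h0''
    have hpos : 0 < 2 ^ i := by positivity
    refine Spec.seq (Spec.setWord_of_val (((Val.reg_of_eq e1).div (Val.const (by omega))).congr
      (Nat.mul_div_cancel _ two_pos)) ?_)
    obtain ⟨hs, hsat⟩ := hc ⟨Function.update W 1 (2 ^ i), R⟩ eR (by simp)
      (by simp; omega)
    simp only [Function.update_apply, zero_ne_one, if_true, if_false] at hsat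
    refine Spec.ite hs (fun h => ?_) (fun h => ?_)
    · rw [hsat] at h
      refine Spec.setWord_of_val ((Val.reg_of_eq (v := W 0) (by simp)).add
        (Val.reg_of_eq (v := 2 ^ i) (by simp)) (by omega)) ?_
      refine ⟨eR, fun i hi => ?_, ?_, ?_, ?_, ?_⟩
      · simp [show i ≠ 0 by omega, show i ≠ 1 by omega, eW i hi]
      all_goals simp; try omega
    · rw [hsat] at h
      refine Spec.skip ⟨eR, fun i hi => ?_, ?_, ?_, ?_, ?_⟩
      · simp [show i ≠ 1 by omega, eW i hi]
      all_goals simp; try omega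
  · rintro ⟨W, R⟩ ⟨eR, eW, e1, h0, h0', -⟩
    dsimp only at eR eW e1 h0 h0'
    subst eR
    exact hQ W (by omega) eW

/-! ### The descent in the tree -/

/-- `y` and `z` are the counts of the node `[a, a + 2 ^ i)` for a query with ranks `Y` and `Z`. -/
structure NodeInv (L : ℕ) (ρ ρ' : ℕ → ℕ) (Y Z i a y z : ℕ) : Prop where
  dvd : 2 ^ i ∣ a
  le : a + 2 ^ i ≤ 2 ^ L
  fst : y = cnt (Finset.Ico a (a + 2 ^ i)) ρ Y
  snd : z = cnt (Finset.Ico a (a + 2 ^ i)) ρ' Z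

theorem cnt_left_add_right (a H : ℕ) (ρ : ℕ → ℕ) (y : ℕ) :
    cnt (Finset.Ico a (a + 2 * H)) ρ y =
      cnt (Finset.Ico a (a + H)) ρ y + cnt (Finset.Ico (a + H) (a + H + H)) ρ y := by
  rw [← cnt_union (Finset.Ico_disjoint_Ico_consecutive _ _ _),
    Finset.Ico_union_Ico_eq_Ico (by omega) (by omega)]
  congr 2
  omega

theorem NodeInv.left {L : ℕ} {ρ ρ' : ℕ → ℕ} {Y Z i a y z : ℕ}
    (h : NodeInv L ρ ρ' Y Z (i + 1) a y z) :
    NodeInv L ρ ρ' Y Z i a (cnt (Finset.Ico a (a + 2 ^ i)) ρ Y)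
      (cnt (Finset.Ico a (a + 2 ^ i)) ρ' Z) := by
  have := h.le
  rw [pow_succ] at this
  exact ⟨(Nat.pow_dvd_pow 2 i.le_succ).trans h.dvd, by omega, rfl, rfl⟩

theorem NodeInv.right {L : ℕ} {ρ ρ' : ℕ → ℕ} {Y Z i a y z : ℕ}
    (h : NodeInv L ρ ρ' Y Z (i + 1) a y z) :
    NodeInv L ρ ρ' Y Z i (a + 2 ^ i) (y - cnt (Finset.Ico a (a + 2 ^ i)) ρ Y)
      (z - cnt (Finset.Ico a (a + 2 ^ i)) ρ' Z) := by
  have h1 := h.le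
  have h2 := h.fst
  have h3 := h.snd
  rw [pow_succ, mul_comm] at h1 h2 h3
  rw [cnt_left_add_right] at h2 h3
  exact ⟨((Nat.pow_dvd_pow 2 i.le_succ).trans h.dvd).add (dvd_refl _), by omega, by omega, by omega⟩

/-- The entry satisfies the two rank constraints. -/
def Valid (ρ ρ' : ℕ → ℕ) (Y Z e : ℕ) : Prop := ρ e < Y ∧ Z ≤ ρ' e

/-- Replaces the candidate node, in the registers `9, 10, 11`, by its right child if this contains
a valid entry, and by its left child otherwise. Register `1` holds the size of the children,
register `5` the address of the level. -/
def stepCand (k : ℕ) : Program :=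
  .seq (.setWord 13 (nodeE k 1 (.add (.reg 5) (.reg 9)) (.reg 10))) <|
  .seq (.setWord 14 (nodeE k 2 (.add (.reg 5) (.reg 9)) (.reg 11))) <|
  -- The children lie one level further down, whence the summand `sizeE`. The local ranks in the
  -- right child are those of the parent minus those of the left child.
  .ite (.wordLt (nodeE k 0 (.add (.add (.reg 5) sizeE) (.add (.reg 9) (.reg 1)))
      (.add (.sub (.reg 10) (.reg 13)) (.sub (.reg 11) (.reg 14)))) (.sub (.reg 10) (.reg 13)))
    (.seq (.setWord 9 (.add (.reg 9) (.reg 1))) <|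
      .seq (.setWord 10 (.sub (.reg 10) (.reg 13))) (.setWord 11 (.sub (.reg 11) (.reg 14))))
    (.seq (.setWord 10 (.reg 13)) (.setWord 11 (.reg 14)))

/-- Replaces the node on the path, in the registers `6, 7, 8`, by its child that contains the entry
in register `2`. If this is the right child and the left child contains a valid entry, then the left
child becomes the candidate node. -/
def stepPath (k : ℕ) : Program :=
  .seq (.setWord 13 (nodeE k 1 (.add (.reg 5) (.reg 6)) (.reg 7))) <|
  .seq (.setWord 14 (nodeE k 2 (.add (.reg 5) (.reg 6)) (.reg 8))) <|
  .ite (.wordLt (.reg 2) (.add (.reg 6) (.reg 1)))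
    (.seq (.setWord 7 (.reg 13)) (.setWord 8 (.reg 14)))
    (.seq
      (.ite (.wordLt (nodeE k 0 (.add (.add (.reg 5) sizeE) (.reg 6)) (.add (.reg 13) (.reg 14)))
          (.reg 13))
        (.seq (.setWord 9 (.reg 6)) <| .seq (.setWord 10 (.reg 13)) <|
          .seq (.setWord 11 (.reg 14)) (.setWord 12 (.const 1)))
        .skip) <|
      .seq (.setWord 6 (.add (.reg 6) (.reg 1))) <|
      .seq (.setWord 7 (.sub (.reg 7) (.reg 13))) (.setWord 8 (.sub (.reg 8) (.reg 14))))

section Steps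

variable {w : ℕ} {M : Memory w} {P : Finset Point} {L b : ℕ}

theorem spec_stepCand (Λ : Layout M P L b) {k Y Z i : ℕ} (hk : k < 12) (hi : i < L) {σ : State}
    (h1 : σ.word 1 = 2 ^ i) (h5 : σ.word 5 = (L - (i + 1)) * 2 ^ L)
    (hC : NodeInv L (Λ.rk k 1) (Λ.rk k 2) Y Z (i + 1) (σ.word 9) (σ.word 10) (σ.word 11))
    {Q : State → Prop}
    (hQ : ∀ W : ℕ → ℕ, (∀ r, r ≤ 8 ∨ r = 12 → W r = σ.word r) →
      NodeInv L (Λ.rk k 1) (Λ.rk k 2) Y Z i (W 9) (W 10) (W 11) →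
      ((W 9 = σ.word 9 + 2 ^ i ∧ ∃ e, σ.word 9 + 2 ^ i ≤ e ∧ e < σ.word 9 + 2 ^ i + 2 ^ i ∧
          Valid (Λ.rk k 1) (Λ.rk k 2) Y Z e) ∨
        (W 9 = σ.word 9 ∧ ∀ e, σ.word 9 + 2 ^ i ≤ e → e < σ.word 9 + 2 ^ i + 2 ^ i →
          ¬ Valid (Λ.rk k 1) (Λ.rk k 2) Y Z e)) → Q ⟨W, σ.real⟩) :
    Spec M L (stepCand k) σ Q := by
  obtain ⟨W, R⟩ := σ
  dsimp only at *
  have g1 := Λ.large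
  have g2 := Λ.size_le
  have hl := hC.left
  have hr := hC.right
  have hle := hC.le
  have hfst := hC.fst
  have hsnd := hC.snd
  have hdvd := hC.dvd
  have hadd := node_address_le (L := L) (l := L - (i + 1)) (a := W 9) (by omega)
    (by rwa [show L - (L - (i + 1)) = i + 1 by omega])
  have hmul : (L - (i + 1)) * 2 ^ L + 2 ^ L = (L - i) * 2 ^ L := by
    rw [← Nat.succ_mul]; congr 1; omega
  have hmul' : (L - i) * 2 ^ L ≤ L * 2 ^ L := Nat.mul_le_mul_right _ (by omega)
  have e : 2 ^ L * (L + 1) = L * 2 ^ L + 2 ^ L := by ring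
  have hpow : 2 ^ (L - (L - (i + 1))) = 2 * 2 ^ i := by
    rw [show L - (L - (i + 1)) = i + 1 by omega, pow_succ, mul_comm]
  rw [pow_succ, mul_comm] at hle hfst hsnd hdvd
  refine Spec.seq (Spec.setWord_of_val (Λ.val_leftCount (j := 0) hk (by omega) (by omega) hpow hdvd
    hle ((Val.reg_of_eq h5).add (Val.reg_of_eq (v := W 9) rfl) (by omega)) (Val.reg_of_eq hfst)) ?_)
  refine Spec.seq (Spec.setWord_of_val (Λ.val_leftCount (j := 1) hk (by omega) (by omega) hpow hdvd
    hle ((Val.reg_of_eq (v := (L - (i + 1)) * 2 ^ L) (by simpa using h5)).add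
      (Val.reg_of_eq (v := W 9) (by simp)) (by omega)) (Val.reg_of_eq (by simpa using hsnd))) ?_)
  simp only [zero_add, Nat.reduceAdd]
  set cy := cnt (Finset.Ico (W 9) (W 9 + 2 ^ i)) (Λ.rk k 1) Y with hcy
  set cz := cnt (Finset.Ico (W 9) (W 9 + 2 ^ i)) (Λ.rk k 2) Z with hcz
  set τ : State := ⟨Function.update (Function.update W 13 cy) 14 cz, R⟩ with hτ
  have v1 : Val M τ (.reg 1) (2 ^ i) := Val.reg_of_eq (by simpa [hτ] using h1)
  have v5 : Val M τ (.reg 5) ((L - (i + 1)) * 2 ^ L) := Val.reg_of_eq (by simpa [hτ] using h5)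
  have v9 : Val M τ (.reg 9) (W 9) := Val.reg_of_eq (by simp [hτ])
  have v10 : Val M τ (.reg 10) (W 10) := Val.reg_of_eq (by simp [hτ])
  have v11 : Val M τ (.reg 11) (W 11) := Val.reg_of_eq (by simp [hτ])
  have v13 : Val M τ (.reg 13) cy := Val.reg_of_eq (by simp [hτ])
  have v14 : Val M τ (.reg 14) cz := Val.reg_of_eq (by simp [hτ])
  have ly : cy ≤ W 10 := by rw [hfst, cnt_left_add_right]; omega
  have lz : cz ≤ W 11 := by rw [hsnd, cnt_left_add_right]; omega
  obtain ⟨u, hu, hiff⟩ := Λ.val_stair (l := L - i) hk (by omega)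
    (by rw [show L - (L - i) = i by omega]) hr.dvd hr.le
    (((v5.add Λ.val_size (by omega)).add (v9.add v1 (by omega)) (by omega)).congr (by rw [hmul]))
    ((v10.sub v13 ly).congr hr.fst) ((v11.sub v14 lz).congr hr.snd)
  rw [← hr.fst] at hiff
  refine Spec.ite_wordLt hu (v10.sub v13 ly) (fun h => ?_) (fun h => ?_)
  · obtain ⟨x, hx1, hx2, hx3⟩ := hiff.1 h
    refine Spec.seq (Spec.setWord_of_val (v9.add v1 (by omega)) (Spec.seq (Spec.setWord_of_val
      ((Val.reg_of_eq (v := W 10) (by simp [hτ])).sub (Val.reg_of_eq (v := cy) (by simp [hτ])) ly)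
      (Spec.setWord_of_val ((Val.reg_of_eq (v := W 11) (by simp [hτ])).sub
        (Val.reg_of_eq (v := cz) (by simp [hτ])) lz) (hQ _ (fun r hr => ?_) ?_ ?_)))))
    · rcases hr with hr | rfl
      · simp [hτ, show r ≠ 9 by omega, show r ≠ 10 by omega, show r ≠ 11 by omega,
          show r ≠ 13 by omega, show r ≠ 14 by omega]
      · simp [hτ]
    · simpa [hτ] using hr
    · exact Or.inl ⟨by simp [hτ], x, hx1, hx2, hx3⟩
  · refine Spec.seq (Spec.setWord_of_val v13 (Spec.setWord_of_val
      (Val.reg_of_eq (v := cz) (by simp [hτ])) (hQ _ (fun r hr => ?_) ?_ ?_)))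
    · rcases hr with hr | rfl
      · simp [hτ, show r ≠ 10 by omega, show r ≠ 11 by omega,
          show r ≠ 13 by omega, show r ≠ 14 by omega]
      · simp [hτ]
    · simpa [hτ] using hl
    · exact Or.inr ⟨by simp [hτ], fun x hx1 hx2 hx3 =>
        absurd (hiff.2 ⟨x, hx1, hx2, hx3⟩) (not_lt.2 h)⟩

theorem spec_stepPath (Λ : Layout M P L b) {k Y Z i : ℕ} (hk : k < 12) (hi : i < L) {σ : State}
    (h1 : σ.word 1 = 2 ^ i) (h5 : σ.word 5 = (L - (i + 1)) * 2 ^ L)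
    (hP : NodeInv L (Λ.rk k 1) (Λ.rk k 2) Y Z (i + 1) (σ.word 6) (σ.word 7) (σ.word 8))
    {Q : State → Prop}
    (hleft : ∀ W : ℕ → ℕ, σ.word 2 < σ.word 6 + 2 ^ i →
      (∀ r, r ≤ 6 ∨ (9 ≤ r ∧ r ≤ 12) → W r = σ.word r) →
      NodeInv L (Λ.rk k 1) (Λ.rk k 2) Y Z i (W 6) (W 7) (W 8) → Q ⟨W, σ.real⟩)
    (hright : ∀ W : ℕ → ℕ, σ.word 6 + 2 ^ i ≤ σ.word 2 →
      (∀ r, r ≤ 5 ∨ (9 ≤ r ∧ r ≤ 12) → W r = σ.word r) → W 6 = σ.word 6 + 2 ^ i →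
      NodeInv L (Λ.rk k 1) (Λ.rk k 2) Y Z i (W 6) (W 7) (W 8) →
      (∀ e, σ.word 6 ≤ e → e < σ.word 6 + 2 ^ i → ¬ Valid (Λ.rk k 1) (Λ.rk k 2) Y Z e) →
      Q ⟨W, σ.real⟩)
    (hcand : ∀ W : ℕ → ℕ, σ.word 6 + 2 ^ i ≤ σ.word 2 →
      (∀ r, r ≤ 5 → W r = σ.word r) → W 6 = σ.word 6 + 2 ^ i → W 9 = σ.word 6 → W 12 = 1 →
      NodeInv L (Λ.rk k 1) (Λ.rk k 2) Y Z i (W 6) (W 7) (W 8) →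
      NodeInv L (Λ.rk k 1) (Λ.rk k 2) Y Z i (W 9) (W 10) (W 11) →
      (∃ e, σ.word 6 ≤ e ∧ e < σ.word 6 + 2 ^ i ∧ Valid (Λ.rk k 1) (Λ.rk k 2) Y Z e) →
      Q ⟨W, σ.real⟩) :
    Spec M L (stepPath k) σ Q := by
  obtain ⟨W, R⟩ := σ
  dsimp only at *
  have g1 := Λ.large
  have g2 := Λ.size_le
  have hl := hP.left
  have hr := hP.right
  have hle := hP.le
  have hfst := hP.fst
  have hsnd := hP.snd
  have hdvd := hP.dvd
  have hadd := node_address_le (L := L) (l := L - (i + 1)) (a := W 6) (by omega)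
    (by rwa [show L - (L - (i + 1)) = i + 1 by omega])
  have hmul : (L - (i + 1)) * 2 ^ L + 2 ^ L = (L - i) * 2 ^ L := by
    rw [← Nat.succ_mul]; congr 1; omega
  have hmul' : (L - i) * 2 ^ L ≤ L * 2 ^ L := Nat.mul_le_mul_right _ (by omega)
  have e : 2 ^ L * (L + 1) = L * 2 ^ L + 2 ^ L := by ring
  have hpow : 2 ^ (L - (L - (i + 1))) = 2 * 2 ^ i := by
    rw [show L - (L - (i + 1)) = i + 1 by omega, pow_succ, mul_comm]
  rw [pow_succ, mul_comm] at hle hfst hsnd hdvd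
  refine Spec.seq (Spec.setWord_of_val (Λ.val_leftCount (j := 0) hk (by omega) (by omega) hpow hdvd
    hle ((Val.reg_of_eq h5).add (Val.reg_of_eq (v := W 6) rfl) (by omega))
      (Val.reg_of_eq hfst)) ?_)
  refine Spec.seq (Spec.setWord_of_val (Λ.val_leftCount (j := 1) hk (by omega) (by omega) hpow hdvd
    hle ((Val.reg_of_eq (v := (L - (i + 1)) * 2 ^ L) (by simpa using h5)).add
      (Val.reg_of_eq (v := W 6) (by simp)) (by omega)) (Val.reg_of_eq (by simpa using hsnd))) ?_)
  simp only [zero_add, Nat.reduceAdd]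
  set cy := cnt (Finset.Ico (W 6) (W 6 + 2 ^ i)) (Λ.rk k 1) Y with hcy
  set cz := cnt (Finset.Ico (W 6) (W 6 + 2 ^ i)) (Λ.rk k 2) Z with hcz
  set τ : State := ⟨Function.update (Function.update W 13 cy) 14 cz, R⟩ with hτ
  have v1 : Val M τ (.reg 1) (2 ^ i) := Val.reg_of_eq (by simpa [hτ] using h1)
  have v5 : Val M τ (.reg 5) ((L - (i + 1)) * 2 ^ L) := Val.reg_of_eq (by simpa [hτ] using h5)
  have v6 : Val M τ (.reg 6) (W 6) := Val.reg_of_eq (by simp [hτ])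
  have v13 : Val M τ (.reg 13) cy := Val.reg_of_eq (by simp [hτ])
  have v14 : Val M τ (.reg 14) cz := Val.reg_of_eq (by simp [hτ])
  have ly : cy ≤ W 7 := by rw [hfst, cnt_left_add_right]; omega
  have lz : cz ≤ W 8 := by rw [hsnd, cnt_left_add_right]; omega
  refine Spec.ite_wordLt (Val.reg_of_eq (v := W 2) (by simp [hτ])) (v6.add v1 (by omega))
    (fun h => ?_) (fun h => ?_)
  · refine Spec.seq (Spec.setWord_of_val v13 (Spec.setWord_of_val
      (Val.reg_of_eq (v := cz) (by simp [hτ])) (hleft _ h (fun r hr => ?_) ?_)))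
    · simp [hτ, show r ≠ 7 by omega, show r ≠ 8 by omega,
        show r ≠ 13 by omega, show r ≠ 14 by omega]
    · simpa [hτ] using hl
  · obtain ⟨u, hu, hiff⟩ := Λ.val_stair (l := L - i) hk (by omega)
      (by rw [show L - (L - i) = i by omega]) hl.dvd hl.le
      (((v5.add Λ.val_size (by omega)).add v6 (by omega)).congr (by rw [hmul])) v13 v14
    refine Spec.seq (Spec.ite_wordLt hu v13 (fun h' => ?_) (fun h' => ?_))
    · refine Spec.seq (Spec.setWord_of_val v6 (Spec.seq (Spec.setWord_of_val
        (Val.reg_of_eq (v := cy) (by simp [hτ])) (Spec.seq (Spec.setWord_of_val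
        (Val.reg_of_eq (v := cz) (by simp [hτ])) (Spec.setWord_of_val (Val.const (by omega)) ?_))))))
      refine Spec.seq (Spec.setWord_of_val ((Val.reg_of_eq (v := W 6) (by simp [hτ])).add
        (Val.reg_of_eq (v := 2 ^ i) (by simpa [hτ] using h1)) (by omega)) (Spec.seq
        (Spec.setWord_of_val ((Val.reg_of_eq (v := W 7) (by simp [hτ])).sub
          (Val.reg_of_eq (v := cy) (by simp [hτ])) ly) (Spec.setWord_of_val
          ((Val.reg_of_eq (v := W 8) (by simp [hτ])).sub
          (Val.reg_of_eq (v := cz) (by simp [hτ])) lz)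
          (hcand _ h (fun r hr => ?_) (by simp [hτ]) (by simp [hτ]) (by simp [hτ]) ?_ ?_
            (hiff.1 h'))))))
      · simp [hτ, show r ≠ 6 by omega, show r ≠ 7 by omega, show r ≠ 8 by omega,
          show r ≠ 9 by omega, show r ≠ 10 by omega, show r ≠ 11 by omega, show r ≠ 12 by omega,
          show r ≠ 13 by omega, show r ≠ 14 by omega]
      · simpa [hτ] using hr
      · simpa [hτ] using hl
    · refine Spec.skip ?_
      refine Spec.seq (Spec.setWord_of_val (v6.add v1 (by omega)) (Spec.seq
        (Spec.setWord_of_val ((Val.reg_of_eq (v := W 7) (by simp [hτ])).sub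
          (Val.reg_of_eq (v := cy) (by simp [hτ])) ly) (Spec.setWord_of_val
          ((Val.reg_of_eq (v := W 8) (by simp [hτ])).sub
          (Val.reg_of_eq (v := cz) (by simp [hτ])) lz)
          (hright _ h (fun r hr => ?_) (by simp [hτ]) ?_ (fun x hx1 hx2 hx3 =>
            absurd (hiff.2 ⟨x, hx1, hx2, hx3⟩) (not_lt.2 h')))))))
      · simp [hτ, show r ≠ 6 by omega, show r ≠ 7 by omega, show r ≠ 8 by omega,
          show r ≠ 13 by omega, show r ≠ 14 by omega]
      · simpa [hτ] using hr

end Steps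

/-- The descent. Register `2` holds the rank `X` and the registers `3` and `4` the ranks `Y` and `Z`.
At the end register `9` holds the last valid entry before `X`, if register `12` is not `0`. -/
def walk (k : ℕ) : Program :=
  .seq (.setWord 1 sizeE) <| .seq (.setWord 5 (.const 0)) <|
  .seq (.setWord 6 (.const 0)) <| .seq (.setWord 7 (.reg 3)) <| .seq (.setWord 8 (.reg 4)) <|
  -- As long as register 12 is zero the candidate means nothing, but it starts at the root and
  -- descends like a genuine node, so that all addresses remain legal.
  .seq (.setWord 9 (.const 0)) <| .seq (.setWord 10 (.reg 3)) <| .seq (.setWord 11 (.reg 4)) <|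
  .seq (.setWord 12 (.const 0)) <|
  .loop (.wordLt (.const 1) (.reg 1)) <|
    .seq (.setWord 1 (.div (.reg 1) (.const 2))) <|
    -- The last valid entry before `X` lies in the last left sibling along the path to leaf `X` that
    -- contains a valid entry. The search inside this sibling runs along with the path, which avoids
    -- a second descent. The candidate moves before the path does, so that both are on the same
    -- level even if the path has just supplied a new candidate. A later candidate lies further
    -- right and rightly replaces an earlier one.
    .seq (stepCand k) <| .seq (stepPath k) <|
    .setWord 5 (.add (.reg 5) sizeE)

/-- The loop invariant of `walk` with `i` remaining rounds. -/
structure WalkInv (L : ℕ) (ρ ρ' : ℕ → ℕ) (X Y Z i : ℕ) (W : ℕ → ℕ) : Prop where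
  size : W 1 = 2 ^ i
  target : W 2 = X
  level : W 5 = (L - i) * 2 ^ L
  path : NodeInv L ρ ρ' Y Z i (W 6) (W 7) (W 8)
  cand : NodeInv L ρ ρ' Y Z i (W 9) (W 10) (W 11)
  target_ge : W 6 ≤ X
  target_lt : X < W 6 + 2 ^ i
  found : W 12 ≠ 0 → W 9 + 2 ^ i ≤ W 6 ∧ ∃ e, W 9 ≤ e ∧ e < W 9 + 2 ^ i ∧ Valid ρ ρ' Y Z e
  -- No valid entry lies between the candidate block and the path node.
  best : ∀ e, Valid ρ ρ' Y Z e → e < W 6 → W 12 ≠ 0 ∧ e < W 9 + 2 ^ i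

/-- At the root a rank is its own local rank: `ρ` permutes the positions below `n`, and the padding
has ranks of at least `n ≥ Y`. The results of the binary searches can therefore start the descent
directly. -/
theorem cnt_root {n L Y : ℕ} (hn : n < 2 ^ L) (hY : Y ≤ n) {ρ : Equiv.Perm ℕ}
    (hρ : ∀ i, ρ i < n ↔ i < n) : cnt (Finset.Ico 0 (0 + 2 ^ L)) ρ Y = Y := by
  have : (Finset.Ico 0 (0 + 2 ^ L)).filter (fun i => ρ i < Y) =
      (Finset.range Y).map ρ.symm.toEmbedding := by
    ext i
    simp only [Finset.mem_filter, Finset.mem_Ico, Finset.mem_map_equiv, Equiv.symm_symm,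
      Finset.mem_range, and_iff_right_iff_imp]
    intro h
    have := (hρ i).1 (by omega)
    omega
  rw [cnt, this, Finset.card_map, Finset.card_range]

theorem spec_walk {w : ℕ} {M : Memory w} {P : Finset Point} {L b : ℕ} (Λ : Layout M P L b)
    {k X Y Z : ℕ} (hk : k < 12) (hX : X ≤ P.card) (hY : Y ≤ P.card) (hZ : Z ≤ P.card) {σ : State}
    (h2 : σ.word 2 = X) (h3 : σ.word 3 = Y) (h4 : σ.word 4 = Z) {Q : State → Prop}
    (hQ : ∀ W : ℕ → ℕ, (W 12 ≠ 0 → W 9 < X ∧ Valid (Λ.rk k 1) (Λ.rk k 2) Y Z (W 9)) →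
      (∀ e < X, Valid (Λ.rk k 1) (Λ.rk k 2) Y Z e → W 12 ≠ 0 ∧ e ≤ W 9) → Q ⟨W, σ.real⟩) :
    Spec M L (walk k) σ Q := by
  have g1 := Λ.large
  have g2 := Λ.size_le
  have hn := Λ.card_lt
  refine Spec.seq (Spec.setWord_of_val Λ.val_size ?_)
  refine Spec.seq (Spec.setWord_of_val (Val.const (by omega)) ?_)
  refine Spec.seq (Spec.setWord_of_val (Val.const (by omega)) ?_)
  refine Spec.seq (Spec.setWord_of_val (Val.reg_of_eq (v := Y) (by simpa using h3)) ?_)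
  refine Spec.seq (Spec.setWord_of_val (Val.reg_of_eq (v := Z) (by simpa using h4)) ?_)
  refine Spec.seq (Spec.setWord_of_val (Val.const (by omega)) ?_)
  refine Spec.seq (Spec.setWord_of_val (Val.reg_of_eq (v := Y) (by simpa using h3)) ?_)
  refine Spec.seq (Spec.setWord_of_val (Val.reg_of_eq (v := Z) (by simpa using h4)) ?_)
  refine Spec.seq (Spec.setWord_of_val (Val.const (by omega)) ?_)
  have hroot : NodeInv L (Λ.rk k 1) (Λ.rk k 2) Y Z L 0 Y Z :=
    ⟨dvd_zero _, by omega, (cnt_root hn hY (Λ.rk_lt k 1)).symm,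
      (cnt_root hn hZ (Λ.rk_lt k 2)).symm⟩
  refine Spec.loop (fun i σ' => σ'.real = σ.real ∧
    WalkInv L (Λ.rk k 1) (Λ.rk k 2) X Y Z i σ'.word) L le_rfl ?_ ?_ ?_ ?_
  · refine ⟨rfl, ?_, ?_, ?_, ?_, ?_, ?_, ?_, ?_, ?_⟩
    · simp
    · simpa using h2
    · simp
    · simpa using hroot
    · simpa using hroot
    · simp
    · simp only [ne_eq, Nat.reduceEqDiff, not_false_eq_true, Function.update_of_ne,
        Function.update_self]
      omega
    · simp
    · simp
  · rintro i τ ⟨-, hI⟩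
    refine ⟨⟨(Val.const (M := M) (σ := τ) (k := 1) (by omega)).1, trivial⟩, ?_⟩
    simp only [Cond.Sat, WordExpr.nval, hI.size]
    exact Nat.one_lt_two_pow_iff.trans Nat.pos_iff_ne_zero.symm
  · rintro i ⟨W, R⟩ hi ⟨eR, hI⟩
    dsimp only at eR hI
    subst eR
    have hp2 : 2 ^ (i + 1) = 2 ^ i * 2 := pow_succ 2 i
    have hpos : 0 < 2 ^ i := by positivity
    have hmul : (L - (i + 1)) * 2 ^ L + 2 ^ L = (L - i) * 2 ^ L := by
      rw [← Nat.succ_mul]; congr 1; omega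
    have hmul' : (L - i) * 2 ^ L ≤ L * 2 ^ L := Nat.mul_le_mul_right _ (by omega)
    have e : 2 ^ L * (L + 1) = L * 2 ^ L + 2 ^ L := by ring
    refine Spec.seq (Spec.setWord_of_val (((Val.reg_of_eq (hI.size.trans hp2)).div
      (Val.const (by omega))).congr (Nat.mul_div_cancel _ two_pos)) ?_)
    obtain ⟨-, i2, i5, iP, iC, ige, ilt, ifd, ibest⟩ := hI
    refine Spec.seq (spec_stepCand Λ hk hi (by simp) (by simpa using i5) (by simpa using iC) ?_)
    intro W' hfr hC' hcase
    have f : ∀ r, (r ≤ 8 ∨ r = 12) → r ≠ 1 → W' r = W r := fun r hr hne => by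
      simpa [hne] using hfr r hr
    have f1 : W' 1 = 2 ^ i := by simpa using hfr 1 (by omega)
    have f2 := f 2 (by omega) (by omega)
    have f5 := f 5 (by omega) (by omega)
    have f6 := f 6 (by omega) (by omega)
    have f7 := f 7 (by omega) (by omega)
    have f8 := f 8 (by omega) (by omega)
    have f12 := f 12 (by omega) (by omega)
    simp only [ne_eq, OfNat.ofNat_ne_one, not_false_eq_true, Function.update_of_ne] at hcase
    -- The chosen child does not extend beyond the right end of its parent, inherits a valid entry,
    -- and leaves no valid entry of the parent to its right.
    have c1 : W' 9 + 2 ^ i ≤ W 9 + 2 ^ (i + 1) := by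
      rcases hcase with ⟨h, -⟩ | ⟨h, -⟩ <;> omega
    have c2 : W 12 ≠ 0 → ∃ e, W' 9 ≤ e ∧ e < W' 9 + 2 ^ i ∧
        Valid (Λ.rk k 1) (Λ.rk k 2) Y Z e := by
      intro hW
      obtain ⟨-, x, hx1, hx2, hx3⟩ := ifd hW
      rcases hcase with ⟨h, y, hy⟩ | ⟨h, hno⟩
      · exact ⟨y, by rw [h]; exact hy⟩
      · refine ⟨x, by omega, ?_, hx3⟩
        by_contra hlt
        exact hno x (by omega) (by omega) hx3
    have c3 : ∀ e, Valid (Λ.rk k 1) (Λ.rk k 2) Y Z e → e < W 9 + 2 ^ (i + 1) → e < W' 9 + 2 ^ i := by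
      intro x hx hlt
      rcases hcase with ⟨h, -⟩ | ⟨h, hno⟩
      · omega
      · by_contra hge
        exact hno x (by omega) (by omega) hx
    refine Spec.seq (spec_stepPath Λ hk hi f1 (f5.trans i5)
      (by dsimp only; rw [f6, f7, f8]; exact iP) ?_ ?_ ?_)
    · intro W'' hlt g hP''
      dsimp only at hlt g
      refine Spec.setWord_of_val ((Val.reg_of_eq (v := (L - (i + 1)) * 2 ^ L)
        ((g 5 (by omega)).trans (f5.trans i5))).add Λ.val_size (by omega)) ⟨rfl, ?_⟩
      have g6 := g 6 (by omega)
      have g9 := g 9 (by omega)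
      have g10 := g 10 (by omega)
      have g11 := g 11 (by omega)
      have g12 := g 12 (by omega)
      refine ⟨?_, ?_, ?_, ?_, ?_, ?_, ?_, ?_, ?_⟩ <;>
        simp only [ne_eq, Nat.reduceEqDiff, OfNat.one_ne_ofNat,
          not_false_eq_true, Function.update_of_ne, Function.update_self]
      · rw [g 1 (by omega), f1]
      · rw [g 2 (by omega), f2, i2]
      · exact hmul
      · exact hP''
      · rw [g9, g10, g11]; exact hC'
      · omega
      · omega
      · intro h
        have h' : W 12 ≠ 0 := by omega
        rw [g9]
        exact ⟨by have := (ifd h').1; omega, c2 h'⟩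
      · intro x hx hlt
        obtain ⟨b1, b2⟩ := ibest x hx (by omega)
        have := c3 x hx b2
        omega
    · intro W'' hge g h6 hP'' hno
      dsimp only at hge g h6 hno
      refine Spec.setWord_of_val ((Val.reg_of_eq (v := (L - (i + 1)) * 2 ^ L)
        ((g 5 (by omega)).trans (f5.trans i5))).add Λ.val_size (by omega)) ⟨rfl, ?_⟩
      have g9 := g 9 (by omega)
      have g10 := g 10 (by omega)
      have g11 := g 11 (by omega)
      have g12 := g 12 (by omega)
      refine ⟨?_, ?_, ?_, ?_, ?_, ?_, ?_, ?_, ?_⟩ <;>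
        simp only [ne_eq, Nat.reduceEqDiff, OfNat.one_ne_ofNat,
          not_false_eq_true, Function.update_of_ne, Function.update_self]
      · rw [g 1 (by omega), f1]
      · rw [g 2 (by omega), f2, i2]
      · exact hmul
      · exact hP''
      · rw [g9, g10, g11]; exact hC'
      · omega
      · omega
      · intro h
        have h' : W 12 ≠ 0 := by omega
        rw [g9]
        exact ⟨by have := (ifd h').1; omega, c2 h'⟩
      · intro x hx hlt
        have hx6 : x < W 6 := by
          by_contra hge'
          exact hno x (by omega) (by omega) hx
        obtain ⟨b1, b2⟩ := ibest x hx hx6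
        have := c3 x hx b2
        omega
    · intro W'' hge g h6 h9 h12 hP'' hC'' hex
      dsimp only at hge g h6 h9 hex
      refine Spec.setWord_of_val ((Val.reg_of_eq (v := (L - (i + 1)) * 2 ^ L)
        ((g 5 (by omega)).trans (f5.trans i5))).add Λ.val_size (by omega)) ⟨rfl, ?_⟩
      refine ⟨?_, ?_, ?_, ?_, ?_, ?_, ?_, ?_, ?_⟩ <;>
        simp only [ne_eq, Nat.reduceEqDiff, OfNat.one_ne_ofNat,
          not_false_eq_true, Function.update_of_ne, Function.update_self]
      · rw [g 1 (by omega), f1]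
      · rw [g 2 (by omega), f2, i2]
      · exact hmul
      · exact hP''
      · exact hC''
      · omega
      · omega
      · intro _
        rw [h9]
        exact ⟨by omega, hex⟩
      -- The new candidate block ends where the new path node begins, so `hlt` is the required
      -- bound.
      · intro x hx hlt
        omega
  · rintro ⟨W, R⟩ ⟨eR, hI⟩
    dsimp only at eR hI
    subst eR
    obtain ⟨-, -, -, -, -, ige, ilt, ifd, ibest⟩ := hI
    simp only [pow_zero] at ilt ifd ibest
    refine hQ W (fun h => ?_) (fun x hx hv => ?_)
    · obtain ⟨l1, x, l2, l3, l4⟩ := ifd h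
      obtain rfl : x = W 9 := by omega
      exact ⟨by omega, l4⟩
    · obtain ⟨l1, l2⟩ := ibest x hv (by omega)
      exact ⟨l1, by omega⟩

/-! ### Dominance queries -/

/-- The position of the last entry of the prefix tested in binary search. -/
def lastE : WordExpr := .sub (.add (.reg 0) (.reg 1)) (.const 1)

/-- The search range `[0, 2 ^ L)` exceeds the length of the lists. Prefixes that are too long are
rejected here, whatever the comparison of reals yields. -/
def prefixC : Cond := .not (.wordLt cardE (.add (.reg 0) (.reg 1)))

/-- The prefix has values at most the content of the real register `g`. -/
def leC (k j g : ℕ) : Cond := .and prefixC (.not (.realLt (.reg g) (linE k j lastE)))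

/-- The prefix has values less than the content of the real register `g`. -/
def ltC (k j g : ℕ) : Cond := .and prefixC (.realLt (linE k j lastE) (.reg g))

/-- A dominance query for the `k`-th triple of functionals. The bounds are in the real registers
`10, 11, 12`, and the result is written to the real register `o`. -/
def search (k o : ℕ) : Program :=
  .seq (bsearch (leC k 0 10)) <| .seq (.setWord 2 (.reg 0)) <|
  .seq (bsearch (leC k 1 11)) <| .seq (.setWord 3 (.reg 0)) <|
  -- The third constraint is a lower bound, so `Z` counts the entries strictly below it and the
  -- valid ranks are those of at least `Z`.
  .seq (bsearch (ltC k 2 12)) <| .seq (.setWord 4 (.reg 0)) <|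
  .seq (walk k) <|
  .ite (.wordLt (.const 0) (.reg 12)) (.setReal o (linE k 0 (.reg 9))) .skip

theorem exists_threshold {p : ℕ → Prop} (n : ℕ) (h : ∀ i j, i ≤ j → j < n → p j → p i) :
    ∃ X ≤ n, ∀ i < n, (p i ↔ i < X) := by
  induction n with
  | zero => exact ⟨0, le_rfl, fun i hi => absurd hi (Nat.not_lt_zero i)⟩
  | succ n ih =>
    obtain ⟨X, hX, hp⟩ := ih fun i j hij hj => h i j hij (hj.trans n.lt_succ_self)
    by_cases hn : p n
    · exact ⟨n + 1, le_rfl, fun i hi =>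
        ⟨fun _ => hi, fun _ => h i n (Nat.lt_succ_iff.1 hi) n.lt_succ_self hn⟩⟩
    · refine ⟨X, hX.trans n.le_succ, fun i hi => ?_⟩
      rcases Nat.lt_succ_iff_lt_or_eq.1 hi with hi | rfl
      · exact hp i hi
      · exact iff_of_false hn (not_lt.2 hX)

section Search

variable {w : ℕ} {M : Memory w} {P : Finset Point} {L b : ℕ}

theorem Layout.val_last (Λ : Layout M P L b) {σ : State} (h1 : 0 < σ.word 1)
    (h : σ.word 0 + σ.word 1 ≤ 2 ^ L) : Val M σ lastE (σ.word 0 + σ.word 1 - 1) := by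
  have g1 := Λ.large
  have g2 := Λ.size_le
  exact ((Val.reg 0).add (Val.reg 1) (by omega)).sub (Val.const (by omega)) (by omega)

theorem Layout.prefixC_sat (Λ : Layout M P L b) {σ : State}
    (h : σ.word 0 + σ.word 1 ≤ 2 ^ L) : prefixC.Safe w M.abs σ ∧
      (prefixC.Sat M.abs σ ↔ σ.word 0 + σ.word 1 ≤ P.card) := by
  have g1 := Λ.large
  have g2 := Λ.size_le
  have v := Λ.val_card (σ := σ)
  have v' := (Val.reg (M := M) (σ := σ) 0).add (Val.reg 1) (by omega)
  refine ⟨⟨v.1, v'.1⟩, ?_⟩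
  simp only [prefixC, Cond.Sat, v.2, v'.2, not_lt]

theorem Layout.leC_sat (Λ : Layout M P L b) {k j g X : ℕ} (hk : k < 12) (hj : j < 3) {σ : State}
    (hX : X ≤ P.card)
    (h : ∀ i < P.card, (lin (coef k j) (Λ.pts k j i) ≤ σ.real g ↔ i < X))
    (h1 : 0 < σ.word 1) (h2 : σ.word 0 + σ.word 1 ≤ 2 ^ L) :
    (leC k j g).Safe w M.abs σ ∧ ((leC k j g).Sat M.abs σ ↔ σ.word 0 + σ.word 1 ≤ X) := by
  obtain ⟨s1, e1⟩ := Λ.prefixC_sat h2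
  have v := Λ.val_last h1 h2
  refine ⟨⟨s1, trivial, Λ.safe_linE hk hj v (by omega)⟩, ?_⟩
  rw [leC, Cond.Sat, e1]
  constructor
  · rintro ⟨hle, hlt⟩
    have := Λ.rval_linE hk hj v (by omega)
    rw [Cond.Sat, Cond.Sat, this, not_lt, RealExpr.rval, h _ (by omega)] at hlt
    omega
  · intro hle
    refine ⟨hle.trans hX, ?_⟩
    have := Λ.rval_linE hk hj v (by omega)
    rw [Cond.Sat, Cond.Sat, this, not_lt, RealExpr.rval, h _ (by omega)]
    omega

theorem Layout.ltC_sat (Λ : Layout M P L b) {k j g X : ℕ} (hk : k < 12) (hj : j < 3) {σ : State}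
    (hX : X ≤ P.card)
    (h : ∀ i < P.card, (lin (coef k j) (Λ.pts k j i) < σ.real g ↔ i < X))
    (h1 : 0 < σ.word 1) (h2 : σ.word 0 + σ.word 1 ≤ 2 ^ L) :
    (ltC k j g).Safe w M.abs σ ∧ ((ltC k j g).Sat M.abs σ ↔ σ.word 0 + σ.word 1 ≤ X) := by
  obtain ⟨s1, e1⟩ := Λ.prefixC_sat h2
  have v := Λ.val_last h1 h2
  refine ⟨⟨s1, Λ.safe_linE hk hj v (by omega), trivial⟩, ?_⟩
  rw [ltC, Cond.Sat, e1]
  constructor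
  · rintro ⟨hle, hlt⟩
    have := Λ.rval_linE hk hj v (by omega)
    rw [Cond.Sat, this, RealExpr.rval, h _ (by omega)] at hlt
    omega
  · intro hle
    refine ⟨hle.trans hX, ?_⟩
    have := Λ.rval_linE hk hj v (by omega)
    rw [Cond.Sat, this, RealExpr.rval, h _ (by omega)]
    omega

/-- A position `i` in the first order satisfies the constraints iff `i < X`, its second rank is less
than `Y` and its third rank is at least `Z`. The first order is monotone in the functional to be
maximized, so the last such position attains the maximum. Ties are harmless, as the thresholds
separate values and not individual points. -/
theorem spec_search (Λ : Layout M P L b) {k o : ℕ} (hk : k < 12) {σ : State} {Q : State → Prop}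
    (hQ : ∀ (W : ℕ → ℕ) (v : ℝ),
      IsDomMax P (coef k) (σ.real 10) (σ.real 11) (σ.real 12) (σ.real o) v →
      Q ⟨W, Function.update σ.real o v⟩) :
    Spec M L (search k o) σ Q := by
  have g1 := Λ.large
  have g2 := Λ.size_le
  have hn := Λ.card_lt
  obtain ⟨X, hX, hX'⟩ := exists_threshold (p := fun i => lin (coef k 0) (Λ.pts k 0 i) ≤ σ.real 10)
    P.card fun i j hij hj h => (Λ.pts_mono k hk 0 (by omega) i j hij hj).trans h
  obtain ⟨Y, hY, hY'⟩ := exists_threshold (p := fun i => lin (coef k 1) (Λ.pts k 1 i) ≤ σ.real 11)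
    P.card fun i j hij hj h => (Λ.pts_mono k hk 1 (by omega) i j hij hj).trans h
  obtain ⟨Z, hZ, hZ'⟩ := exists_threshold (p := fun i => lin (coef k 2) (Λ.pts k 2 i) < σ.real 12)
    P.card fun i j hij hj h => (Λ.pts_mono k hk 2 (by omega) i j hij hj).trans_lt h
  refine Spec.seq (spec_bsearch Λ (X := X) (by omega)
    (fun σ' e h1 h2 => Λ.leC_sat hk (by omega) hX (by rw [e]; exact hX') h1 h2) ?_)
  intro W₁ hW₁ _
  refine Spec.seq (Spec.setWord_of_val (Val.reg_of_eq hW₁) ?_)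
  refine Spec.seq (spec_bsearch Λ (X := Y) (by omega)
    (fun σ' e h1 h2 => Λ.leC_sat hk (by omega) hY (by rw [e]; exact hY') h1 h2) ?_)
  intro W₂ hW₂ f₂
  refine Spec.seq (Spec.setWord_of_val (Val.reg_of_eq hW₂) ?_)
  refine Spec.seq (spec_bsearch Λ (X := Z) (by omega)
    (fun σ' e h1 h2 => Λ.ltC_sat hk (by omega) hZ (by rw [e]; exact hZ') h1 h2) ?_)
  intro W₃ hW₃ f₃
  refine Spec.seq (Spec.setWord_of_val (Val.reg_of_eq hW₃) ?_)
  have e2 : W₃ 2 = X := by rw [f₃ 2 le_rfl]; simpa using f₂ 2 le_rfl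
  have e3 : W₃ 3 = Y := by rw [f₃ 3 (by omega)]; simp
  refine Spec.seq (spec_walk Λ hk hX hY hZ (by simpa using e2) (by simpa using e3) (by simp) ?_)
  intro W hfound hbest
  have hdom : ∀ i < P.card, (Dominated (coef k) (σ.real 10) (σ.real 11) (σ.real 12) (Λ.pts k 0 i) ↔
      i < X ∧ Valid (Λ.rk k 1) (Λ.rk k 2) Y Z i) := by
    intro i hi
    have h1 := hY' _ ((Λ.rk_lt k 1 i).2 hi)
    have h2 := hZ' _ ((Λ.rk_lt k 2 i).2 hi)
    rw [Λ.pts_rk k hk 1 (by omega) i hi] at h1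
    rw [Λ.pts_rk k hk 2 (by omega) i hi] at h2
    rw [Dominated, Valid, hX' i hi, h1, ← not_lt, h2, not_lt]
  refine Spec.ite_wordLt (Val.const (by omega)) (Val.reg_of_eq (v := W 12) rfl)
    (fun h => ?_) (fun h => ?_)
  · obtain ⟨hlt, hval⟩ := hfound (by omega)
    have v9 : Val M ⟨W, σ.real⟩ (.reg 9) (W 9) := Val.reg_of_eq rfl
    refine Spec.setReal (Λ.safe_linE hk (by omega) v9 (by omega)) ?_
    rw [Λ.rval_linE hk (by omega) v9 (by omega)]
    refine hQ W _ ⟨fun p hp hd => ?_, Or.inr ⟨_, Λ.pts_mem k hk 0 (by omega) (W 9) (by omega),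
      (hdom _ (by omega)).2 ⟨hlt, hval⟩, rfl⟩⟩
    obtain ⟨i, hi, rfl⟩ := Λ.pts_surj k hk 0 (by omega) p hp
    obtain ⟨hiX, hiv⟩ := (hdom i hi).1 hd
    exact Λ.pts_mono k hk 0 (by omega) _ _ (hbest i hiX hiv).2 (by omega)
  · have hno : ∀ p ∈ P, ¬ Dominated (coef k) (σ.real 10) (σ.real 11) (σ.real 12) p := by
      intro p hp hd
      obtain ⟨i, hi, rfl⟩ := Λ.pts_surj k hk 0 (by omega) p hp
      obtain ⟨hiX, hiv⟩ := (hdom i hi).1 hd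
      have := (hbest i hiX hiv).1
      omega
    have := hQ W (σ.real o) ⟨fun p hp hd => absurd hd (hno p hp), Or.inl ⟨rfl, hno⟩⟩
    rw [Function.update_eq_self] at this
    exact Spec.skip this

end Search

/-! ### The query program -/

/-- The expression does not read the memory. -/
def RealExpr.NoRead : RealExpr → Bool
  | .reg _ => true
  | .const _ => true
  | .read _ => false
  | .add e f => e.NoRead && f.NoRead
  | .sub e f => e.NoRead && f.NoRead
  | .mul e f => e.NoRead && f.NoRead
  | .div e f => e.NoRead && f.NoRead

theorem RealExpr.safe_of_noRead {e : RealExpr} (h : e.NoRead) (w : ℕ) (m σ : State) :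
    e.Safe w m σ := by
  induction e with
  | reg i => trivial
  | const k => trivial
  | read e => simp [RealExpr.NoRead] at h
  | add e f ihe ihf =>
    simp only [RealExpr.NoRead, Bool.and_eq_true] at h; exact ⟨ihe h.1, ihf h.2⟩
  | sub e f ihe ihf =>
    simp only [RealExpr.NoRead, Bool.and_eq_true] at h; exact ⟨ihe h.1, ihf h.2⟩
  | mul e f ihe ihf =>
    simp only [RealExpr.NoRead, Bool.and_eq_true] at h; exact ⟨ihe h.1, ihf h.2⟩
  | div e f ihe ihf =>
    simp only [RealExpr.NoRead, Bool.and_eq_true] at h; exact ⟨ihe h.1, ihf h.2⟩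

/-- A dominance query with bounds `α, β, γ` and default value `d`, with the result in the real
register `o`. -/
def call (k : ℕ) (α β γ d : RealExpr) (o : ℕ) : Program :=
  .seq (.setReal 10 α) <| .seq (.setReal 11 β) <| .seq (.setReal 12 γ) <| .seq (.setReal o d) <|
  search k o

/-- Replaces the content of the real register `i` by its maximum with `e`. -/
def maxTo (i : ℕ) (e : RealExpr) : Program :=
  .ite (.realLt (.reg i) e) (.setReal i e) .skip

section Call

variable {w : ℕ} {M : Memory w} {P : Finset Point} {L b : ℕ}

theorem Spec.setReal_of_noRead {σ : State} {Q : State → Prop} {i : ℕ} {e : RealExpr} {v : ℝ}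
    (he : e.NoRead) (hv : e.rval M.abs σ = v) (h : Q ⟨σ.word, Function.update σ.real i v⟩) :
    Spec M L (.setReal i e) σ Q :=
  Spec.setReal (RealExpr.safe_of_noRead he _ _ _) (hv ▸ h)

theorem spec_maxTo {W : ℕ → ℕ} {R : ℕ → ℝ} {Q : State → Prop} {i : ℕ} {e : RealExpr} {u v : ℝ}
    (he : e.NoRead) (hv : e.rval M.abs ⟨W, Function.update R i u⟩ = v)
    (h : Q ⟨W, Function.update R i (max u v)⟩) :
    Spec M L (maxTo i e) ⟨W, Function.update R i u⟩ Q := by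
  refine Spec.ite ⟨trivial, RealExpr.safe_of_noRead he _ _ _⟩ (fun hlt => ?_) (fun hlt => ?_)
  · simp only [Cond.Sat, hv, RealExpr.rval, Function.update_self] at hlt
    refine Spec.setReal_of_noRead he hv ?_
    rwa [Function.update_idem, ← max_eq_right hlt.le]
  · simp only [Cond.Sat, hv, RealExpr.rval, Function.update_self, not_lt] at hlt
    rw [max_eq_left hlt] at h
    exact Spec.skip h

theorem spec_call (Λ : Layout M P L b) {k o : ℕ} (hk : k < 12) (ho : 13 ≤ o ∨ o < 10)
    {α β γ d : RealExpr} (hα : α.NoRead) (hβ : β.NoRead) (hγ : γ.NoRead) (hd : d.NoRead)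
    {σ : State} {x y z u : ℝ} {Q : State → Prop}
    (ex : α.rval M.abs σ = x)
    (ey : β.rval M.abs ⟨σ.word, Function.update σ.real 10 x⟩ = y)
    (ez : γ.rval M.abs ⟨σ.word, Function.update (Function.update σ.real 10 x) 11 y⟩ = z)
    (eu : d.rval M.abs ⟨σ.word, Function.update (Function.update (Function.update σ.real 10 x)
      11 y) 12 z⟩ = u)
    (hQ : ∀ (W : ℕ → ℕ) (v : ℝ), IsDomMax P (coef k) x y z u v →
      Q ⟨W, Function.update (Function.update (Function.update (Function.update σ.real 10 x)
      11 y) 12 z) o v⟩) :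
    Spec M L (call k α β γ d o) σ Q := by
  refine Spec.seq (Spec.setReal_of_noRead hα ex (Spec.seq (Spec.setReal_of_noRead hβ ey
    (Spec.seq (Spec.setReal_of_noRead hγ ez (Spec.seq (Spec.setReal_of_noRead hd eu
      (spec_search Λ hk ?_))))))))
  intro W v hv
  have h10 : (10 : ℕ) ≠ o := by omega
  have h11 : (11 : ℕ) ≠ o := by omega
  have h12 : (12 : ℕ) ≠ o := by omega
  simp only [ne_eq, h10, h11, h12, not_false_eq_true, Function.update_of_ne, Function.update_self,
    Nat.reduceEqDiff, Function.update_idem] at hv ⊢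
  exact hQ W v hv

end Call

def negE (e : RealExpr) : RealExpr := .sub (.const 0) e

/-- Writes the bounding box of the points in the range to the real registers `6, 8, 5, 7`,
given the rightmost coordinate in register `5`. -/
def boxProgram : Program :=
  .seq (call 1 (negE (.reg 0)) (.reg 3) (.reg 1) (.const 0) 6) <|
  .seq (.setReal 6 (negE (.reg 6))) <|
  .seq (call 2 (.reg 3) (.reg 2) (.reg 0) (.const 0) 7) <|
  .seq (call 3 (negE (.reg 1)) (.reg 2) (.reg 0) (.const 0) 8)
    (.setReal 8 (negE (.reg 8)))

/-- The coordinates next to the middle of the bounding box. -/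
def middleProgram : Program :=
  -- The defaults here and in the diagonal queries are the sides of the box, so that a query without
  -- feasible points contributes zero to the edge length.
  .seq (call 0 (.div (.add (.reg 6) (.reg 5)) (.const 2)) (.reg 3) (.reg 1) (.reg 6) 13) <|
  .seq (call 1 (negE (.div (.add (.reg 6) (.reg 5)) (.const 2))) (.reg 3) (.reg 1)
    (negE (.reg 5)) 14) <|
  .seq (call 2 (.div (.add (.reg 8) (.reg 7)) (.const 2)) (.reg 2) (.reg 0) (.reg 8) 15)
    (call 3 (negE (.div (.add (.reg 8) (.reg 7)) (.const 2))) (.reg 2) (.reg 0)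
    (negE (.reg 7)) 16)

/-- The queries along the diagonals for squares in the corners. -/
def cornerProgram : Program :=
  .seq (call 4 (.reg 5) (.add (.reg 6) (.reg 7)) (.reg 8) (.reg 6) 17) <|
  .seq (call 5 (negE (.reg 8)) (.reg 5) (.add (.reg 6) (.reg 7)) (negE (.reg 7)) 18) <|
  .seq (call 6 (.reg 7) (.add (.reg 8) (.reg 5)) (.reg 6) (.reg 8) 19)
    (call 7 (negE (.reg 6)) (.reg 7) (.add (.reg 8) (.reg 5)) (negE (.reg 5)) 20)

/-- The queries along the diagonals for squares in the anticorners. -/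
def anticornerProgram : Program :=
  .seq (call 8 (.reg 5) (.sub (.reg 6) (.reg 8)) (negE (.reg 7)) (.reg 6) 21) <|
  .seq (call 9 (.reg 7) (.reg 5) (.sub (.reg 6) (.reg 8)) (.reg 8) 22) <|
  .seq (call 10 (negE (.reg 6)) (.sub (.reg 7) (.reg 5)) (.reg 8) (negE (.reg 5)) 23)
    (call 11 (negE (.reg 8)) (.sub (.reg 5) (.reg 7)) (.reg 6) (negE (.reg 7)) 24)

/-- The smallest edge lengths for the corners and the anticorners, in the real registers
`26` and `27`. -/
def sideProgram : Program :=
  .seq (.setReal 25 (.sub (.reg 13) (.reg 6))) <|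
  .seq (maxTo 25 (.add (.reg 5) (.reg 14))) <|
  .seq (maxTo 25 (.sub (.reg 15) (.reg 8))) <|
  .seq (maxTo 25 (.add (.reg 7) (.reg 16))) <|
  .seq (.setReal 26 (.reg 25)) <|
  .seq (maxTo 26 (.sub (.reg 17) (.reg 6))) <|
  .seq (maxTo 26 (.add (.reg 7) (.reg 18))) <|
  .seq (maxTo 26 (.sub (.reg 19) (.reg 8))) <|
  .seq (maxTo 26 (.add (.reg 5) (.reg 20))) <|
  .seq (.setReal 27 (.reg 25)) <|
  .seq (maxTo 27 (.sub (.reg 21) (.reg 6))) <|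
  .seq (maxTo 27 (.sub (.reg 22) (.reg 8))) <|
  .seq (maxTo 27 (.add (.reg 5) (.reg 23)))
    (maxTo 27 (.add (.reg 7) (.reg 24)))

/-- Reports the better of the two solutions. -/
def outputProgram : Program :=
  .ite (.realLt (.reg 27) (.reg 26))
    -- Half the edge length comes first because the centres are computed from it. The query corners
    -- in the registers 0 to 3 may be overwritten, as the box is kept in the registers 5 to 8.
    (.seq (.setReal 4 (.div (.reg 27) (.const 2))) <|
      .seq (.setReal 0 (.add (.reg 6) (.reg 4))) <| .seq (.setReal 1 (.sub (.reg 7) (.reg 4))) <|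
      .seq (.setReal 2 (.sub (.reg 5) (.reg 4))) (.setReal 3 (.add (.reg 8) (.reg 4))))
    (.seq (.setReal 4 (.div (.reg 26) (.const 2))) <|
      .seq (.setReal 0 (.add (.reg 6) (.reg 4))) <| .seq (.setReal 1 (.add (.reg 8) (.reg 4))) <|
      .seq (.setReal 2 (.sub (.reg 5) (.reg 4))) (.setReal 3 (.sub (.reg 7) (.reg 4))))

/-- The query program for the rectilinear two-center problem. -/
def queryProgram : Program :=
  .seq (call 0 (.reg 2) (.reg 3) (.reg 1) (.sub (.reg 0) (.const 1)) 5) <|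
  .ite (.realLt (.reg 5) (.reg 0)) (.setReal 4 (.const 0)) <|
  .seq boxProgram <| .seq middleProgram <| .seq cornerProgram <| .seq anticornerProgram <|
  .seq sideProgram outputProgram

section Query

variable {w : ℕ} {M : Memory w} {P : Finset Point} {L b : ℕ}

theorem spec_boxProgram (Λ : Layout M P L b) {p q : Point} {x₁ : ℝ} {σ : State} {Q : State → Prop}
    (r0 : σ.real 0 = p.1) (r1 : σ.real 1 = p.2) (r2 : σ.real 2 = q.1) (r3 : σ.real 3 = q.2)
    (hx₁ : IsDomMax P (coef 0) q.1 q.2 p.2 (p.1 - 1) x₁) (hne : p.1 ≤ x₁)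
    (hQ : ∀ τ : State, ∀ x₀ y₀ y₁, (∀ i ≤ 5, τ.real i = σ.real i) →
      τ.real 6 = x₀ → τ.real 7 = y₁ → τ.real 8 = y₀ →
      IsBoundingBox (inRange P p q) x₀ y₀ x₁ y₁ → Q τ) :
    Spec M L boxProgram σ Q := by
  refine Spec.seq (spec_call Λ (x := -p.1) (y := q.2) (z := p.2) (u := 0) (by omega) (by omega)
    rfl rfl rfl rfl ?_ ?_ ?_ ?_ ?_)
  iterate 4 simp [RealExpr.rval, negE, r0, r1, r3]
  intro W₁ v₁ h₁
  refine Spec.seq (Spec.setReal_of_noRead (v := -v₁) rfl (by simp [RealExpr.rval, negE]) ?_)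
  refine Spec.seq (spec_call Λ (x := q.2) (y := q.1) (z := p.1) (u := 0) (by omega) (by omega)
    rfl rfl rfl rfl ?_ ?_ ?_ ?_ ?_)
  iterate 4 simp [RealExpr.rval, r0, r2, r3]
  intro W₂ v₂ h₂
  refine Spec.seq (spec_call Λ (x := -p.2) (y := q.1) (z := p.1) (u := 0) (by omega) (by omega)
    rfl rfl rfl rfl ?_ ?_ ?_ ?_ ?_)
  iterate 4 simp [RealExpr.rval, negE, r0, r1, r2]
  intro W₃ v₃ h₃
  refine Spec.setReal_of_noRead (v := -v₃) rfl (by simp [RealExpr.rval, negE]) ?_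
  refine hQ _ (-v₁) (-v₃) v₂ (fun i hi => ?_) (by simp) (by simp) (by simp)
    (isBoundingBox_of_isDomMax hx₁ (by simpa using h₁) h₂ (by simpa using h₃) hne)
  simp [show i ≠ 6 by omega, show i ≠ 7 by omega, show i ≠ 8 by omega, show i ≠ 10 by omega,
    show i ≠ 11 by omega, show i ≠ 12 by omega]

theorem spec_middleProgram (Λ : Layout M P L b) {p q : Point} {x₀ y₀ x₁ y₁ : ℝ} {σ : State}
    {Q : State → Prop}
    (r0 : σ.real 0 = p.1) (r1 : σ.real 1 = p.2) (r2 : σ.real 2 = q.1) (r3 : σ.real 3 = q.2)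
    (r5 : σ.real 5 = x₁) (r6 : σ.real 6 = x₀) (r7 : σ.real 7 = y₁) (r8 : σ.real 8 = y₀)
    (hB : IsBoundingBox (inRange P p q) x₀ y₀ x₁ y₁)
    (hQ : ∀ τ : State, (∀ i < 10, τ.real i = σ.real i) →
      IsMaxMin (inRange P p q) (fun p => p.1 - x₀) (fun p => x₁ - p.1)
        (max (τ.real 13 - x₀) (x₁ + τ.real 14)) →
      IsMaxMin (inRange P p q) (fun p => p.2 - y₀) (fun p => y₁ - p.2)
        (max (τ.real 15 - y₀) (y₁ + τ.real 16)) → Q τ) :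
    Spec M L middleProgram σ Q := by
  refine Spec.seq (spec_call Λ (x := (x₀ + x₁) / 2) (y := q.2) (z := p.2) (u := x₀) (by omega)
    (by omega) rfl rfl rfl rfl ?_ ?_ ?_ ?_ ?_)
  iterate 4 simp [RealExpr.rval, r1, r3, r5, r6]
  intro W₁ v₁ h₁
  refine Spec.seq (spec_call Λ (x := -((x₀ + x₁) / 2)) (y := q.2) (z := p.2) (u := -x₁) (by omega)
    (by omega) rfl rfl rfl rfl ?_ ?_ ?_ ?_ ?_)
  iterate 4 simp [RealExpr.rval, negE, r1, r3, r5, r6]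
  intro W₂ v₂ h₂
  refine Spec.seq (spec_call Λ (x := (y₀ + y₁) / 2) (y := q.1) (z := p.1) (u := y₀) (by omega)
    (by omega) rfl rfl rfl rfl ?_ ?_ ?_ ?_ ?_)
  iterate 4 simp [RealExpr.rval, r0, r2, r7, r8]
  intro W₃ v₃ h₃
  refine spec_call Λ (x := -((y₀ + y₁) / 2)) (y := q.1) (z := p.1) (u := -y₁) (by omega)
    (by omega) rfl rfl rfl rfl ?_ ?_ ?_ ?_ ?_
  iterate 4 simp [RealExpr.rval, negE, r0, r2, r7, r8]
  intro W₄ v₄ h₄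
  refine hQ _ (fun i hi => ?_) ?_ ?_
  · simp [show i ≠ 13 by omega, show i ≠ 14 by omega, show i ≠ 15 by omega, show i ≠ 16 by omega,
      show i ≠ 10 by omega, show i ≠ 11 by omega, show i ≠ 12 by omega]
  · simpa using isMaxMin_left_right hB h₁ h₂
  · simpa using isMaxMin_bottom_top hB h₃ h₄

theorem spec_cornerProgram (Λ : Layout M P L b) {p q : Point} {x₀ y₀ x₁ y₁ : ℝ} {σ : State}
    {Q : State → Prop}
    (r5 : σ.real 5 = x₁) (r6 : σ.real 6 = x₀) (r7 : σ.real 7 = y₁) (r8 : σ.real 8 = y₀)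
    (hB : IsBoundingBox (inRange P p q) x₀ y₀ x₁ y₁)
    (hQ : ∀ τ : State, (∀ i, i < 10 ∨ (13 ≤ i ∧ i < 17) → τ.real i = σ.real i) →
      IsMaxMin (inRange P p q) (fun p => p.1 - x₀) (fun p => y₁ - p.2)
        (max (τ.real 17 - x₀) (y₁ + τ.real 18)) →
      IsMaxMin (inRange P p q) (fun p => p.2 - y₀) (fun p => x₁ - p.1)
        (max (τ.real 19 - y₀) (x₁ + τ.real 20)) → Q τ) :
    Spec M L cornerProgram σ Q := by
  refine Spec.seq (spec_call Λ (x := x₁) (y := x₀ + y₁) (z := y₀) (u := x₀) (by omega)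
    (by omega) rfl rfl rfl rfl ?_ ?_ ?_ ?_ ?_)
  iterate 4 simp [RealExpr.rval, r5, r6, r7, r8]
  intro W₁ v₁ h₁
  refine Spec.seq (spec_call Λ (x := -y₀) (y := x₁) (z := x₀ + y₁) (u := -y₁) (by omega)
    (by omega) rfl rfl rfl rfl ?_ ?_ ?_ ?_ ?_)
  iterate 4 simp [RealExpr.rval, negE, r5, r6, r7, r8]
  intro W₂ v₂ h₂
  refine Spec.seq (spec_call Λ (x := y₁) (y := y₀ + x₁) (z := x₀) (u := y₀) (by omega)
    (by omega) rfl rfl rfl rfl ?_ ?_ ?_ ?_ ?_)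
  iterate 4 simp [RealExpr.rval, r5, r6, r7, r8]
  intro W₃ v₃ h₃
  refine spec_call Λ (x := -x₀) (y := y₁) (z := y₀ + x₁) (u := -x₁) (by omega)
    (by omega) rfl rfl rfl rfl ?_ ?_ ?_ ?_ ?_
  iterate 4 simp [RealExpr.rval, negE, r5, r6, r7, r8]
  intro W₄ v₄ h₄
  refine hQ _ (fun i hi => ?_) ?_ ?_
  · simp [show i ≠ 17 by omega, show i ≠ 18 by omega, show i ≠ 19 by omega, show i ≠ 20 by omega,
      show i ≠ 10 by omega, show i ≠ 11 by omega, show i ≠ 12 by omega]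
  · simpa using isMaxMin_left_top hB h₁ h₂
  · simpa using isMaxMin_bottom_right hB h₃ h₄

theorem spec_anticornerProgram (Λ : Layout M P L b) {p q : Point} {x₀ y₀ x₁ y₁ : ℝ} {σ : State}
    {Q : State → Prop}
    (r5 : σ.real 5 = x₁) (r6 : σ.real 6 = x₀) (r7 : σ.real 7 = y₁) (r8 : σ.real 8 = y₀)
    (hB : IsBoundingBox (inRange P p q) x₀ y₀ x₁ y₁)
    (hQ : ∀ τ : State, (∀ i, i < 10 ∨ (13 ≤ i ∧ i < 21) → τ.real i = σ.real i) →
      IsMaxMin (inRange P p q) (fun p => p.1 - x₀) (fun p => p.2 - y₀)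
        (max (τ.real 21 - x₀) (τ.real 22 - y₀)) →
      IsMaxMin (inRange P p q) (fun p => x₁ - p.1) (fun p => y₁ - p.2)
        (max (x₁ + τ.real 23) (y₁ + τ.real 24)) → Q τ) :
    Spec M L anticornerProgram σ Q := by
  refine Spec.seq (spec_call Λ (x := x₁) (y := x₀ - y₀) (z := -y₁) (u := x₀) (by omega)
    (by omega) rfl rfl rfl rfl ?_ ?_ ?_ ?_ ?_)
  iterate 4 simp [RealExpr.rval, negE, r5, r6, r7, r8]
  intro W₁ v₁ h₁
  refine Spec.seq (spec_call Λ (x := y₁) (y := x₁) (z := x₀ - y₀) (u := y₀) (by omega)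
    (by omega) rfl rfl rfl rfl ?_ ?_ ?_ ?_ ?_)
  iterate 4 simp [RealExpr.rval, r5, r6, r7, r8]
  intro W₂ v₂ h₂
  refine Spec.seq (spec_call Λ (x := -x₀) (y := y₁ - x₁) (z := y₀) (u := -x₁) (by omega)
    (by omega) rfl rfl rfl rfl ?_ ?_ ?_ ?_ ?_)
  iterate 4 simp [RealExpr.rval, negE, r5, r6, r7, r8]
  intro W₃ v₃ h₃
  refine spec_call Λ (x := -y₀) (y := x₁ - y₁) (z := x₀) (u := -y₁) (by omega)
    (by omega) rfl rfl rfl rfl ?_ ?_ ?_ ?_ ?_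
  iterate 4 simp [RealExpr.rval, negE, r5, r6, r7, r8]
  intro W₄ v₄ h₄
  refine hQ _ (fun i hi => ?_) ?_ ?_
  · simp [show i ≠ 21 by omega, show i ≠ 22 by omega, show i ≠ 23 by omega, show i ≠ 24 by omega,
      show i ≠ 10 by omega, show i ≠ 11 by omega, show i ≠ 12 by omega]
  · simpa using isMaxMin_left_bottom hB h₁ h₂
  · simpa using isMaxMin_right_top hB h₃ h₄

theorem spec_sideProgram {σ : State} {Q : State → Prop}
    (hQ : ∀ τ : State, (∀ i < 10, τ.real i = σ.real i) →
      τ.real 26 = max (max (max (σ.real 13 - σ.real 6) (σ.real 5 + σ.real 14))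
          (max (σ.real 15 - σ.real 8) (σ.real 7 + σ.real 16)))
        (max (max (σ.real 17 - σ.real 6) (σ.real 7 + σ.real 18))
          (max (σ.real 19 - σ.real 8) (σ.real 5 + σ.real 20))) →
      τ.real 27 = max (max (max (σ.real 13 - σ.real 6) (σ.real 5 + σ.real 14))
          (max (σ.real 15 - σ.real 8) (σ.real 7 + σ.real 16)))
        (max (max (σ.real 21 - σ.real 6) (σ.real 22 - σ.real 8))
          (max (σ.real 5 + σ.real 23) (σ.real 7 + σ.real 24))) → Q τ) :
    Spec M L sideProgram σ Q := by
  refine Spec.seq (Spec.setReal_of_noRead (v := σ.real 13 - σ.real 6) rfl rfl ?_)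
  refine Spec.seq (spec_maxTo (v := σ.real 5 + σ.real 14) rfl
    (by simp [RealExpr.rval]) ?_)
  refine Spec.seq (spec_maxTo (v := σ.real 15 - σ.real 8) rfl
    (by simp [RealExpr.rval]) ?_)
  refine Spec.seq (spec_maxTo (v := σ.real 7 + σ.real 16) rfl
    (by simp [RealExpr.rval]) ?_)
  set m := max (max (max (σ.real 13 - σ.real 6) (σ.real 5 + σ.real 14)) (σ.real 15 - σ.real 8))
    (σ.real 7 + σ.real 16) with hm
  refine Spec.seq (Spec.setReal_of_noRead (v := m) rfl (by simp [RealExpr.rval]) ?_)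
  refine Spec.seq (spec_maxTo (v := σ.real 17 - σ.real 6) rfl
    (by simp [RealExpr.rval]) ?_)
  refine Spec.seq (spec_maxTo (v := σ.real 7 + σ.real 18) rfl
    (by simp [RealExpr.rval]) ?_)
  refine Spec.seq (spec_maxTo (v := σ.real 19 - σ.real 8) rfl
    (by simp [RealExpr.rval]) ?_)
  refine Spec.seq (spec_maxTo (v := σ.real 5 + σ.real 20) rfl
    (by simp [RealExpr.rval]) ?_)
  refine Spec.seq (Spec.setReal_of_noRead (v := m) rfl (by simp [RealExpr.rval]) ?_)
  refine Spec.seq (spec_maxTo (v := σ.real 21 - σ.real 6) rfl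
    (by simp [RealExpr.rval]) ?_)
  refine Spec.seq (spec_maxTo (v := σ.real 22 - σ.real 8) rfl
    (by simp [RealExpr.rval]) ?_)
  refine Spec.seq (spec_maxTo (v := σ.real 5 + σ.real 23) rfl
    (by simp [RealExpr.rval]) ?_)
  refine spec_maxTo (v := σ.real 7 + σ.real 24) rfl
    (by simp [RealExpr.rval]) ?_
  refine hQ _ (fun i hi => ?_) ?_ ?_
  · simp only [ne_eq, show i ≠ 25 by omega, show i ≠ 26 by omega, show i ≠ 27 by omega,
      not_false_eq_true, Function.update_of_ne]
  · simp only [ne_eq, Nat.reduceEqDiff, not_false_eq_true, Function.update_of_ne,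
      Function.update_self, hm, max_assoc]
  · simp only [Function.update_self, hm, max_assoc]

theorem spec_queryProgram (Λ : Layout M P L b) {p q : Point} {σ : State}
    (r0 : σ.real 0 = p.1) (r1 : σ.real 1 = p.2) (r2 : σ.real 2 = q.1) (r3 : σ.real 3 = q.2) :
    Spec M L queryProgram σ (fun τ => IsOptimalTwoCenter (inRange P p q)
      (τ.real 0, τ.real 1) (τ.real 2, τ.real 3) (τ.real 4)) := by
  refine Spec.seq (spec_call Λ (x := q.1) (y := q.2) (z := p.2) (u := p.1 - 1) (by omega)
    (by omega) rfl rfl rfl rfl ?_ ?_ ?_ ?_ ?_)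
  iterate 4 simp [RealExpr.rval, r0, r1, r2, r3]
  intro W x₁ h₁
  refine Spec.ite ⟨trivial, trivial⟩ (fun h => ?_) (fun h => ?_)
  · refine Spec.setReal_of_noRead (v := 0) rfl (by simp [RealExpr.rval]) ?_
    have h' : x₁ < p.1 := by simpa [Cond.Sat, RealExpr.rval, r0] using h
    rw [inRange_eq_empty_of_isDomMax h₁ h']
    simpa using isOptimalTwoCenter_empty _ _
  · have h' : p.1 ≤ x₁ := by simpa [Cond.Sat, RealExpr.rval, r0] using h
    refine Spec.seq (spec_boxProgram Λ (p := p) (q := q) (by simpa using r0) (by simpa using r1)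
      (by simpa using r2) (by simpa using r3) h₁ h' ?_)
    intro τ₁ x₀ y₀ y₁ f₁ e6 e7 e8 hB
    have e0 : τ₁.real 0 = p.1 := by rw [f₁ 0 (by omega)]; simpa using r0
    have e1 : τ₁.real 1 = p.2 := by rw [f₁ 1 (by omega)]; simpa using r1
    have e2 : τ₁.real 2 = q.1 := by rw [f₁ 2 (by omega)]; simpa using r2
    have e3 : τ₁.real 3 = q.2 := by rw [f₁ 3 (by omega)]; simpa using r3
    have e5 : τ₁.real 5 = x₁ := by rw [f₁ 5 (by omega)]; simp
    refine Spec.seq (spec_middleProgram Λ e0 e1 e2 e3 e5 e6 e7 e8 hB ?_)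
    intro τ₂ f₂ m₁ m₂
    rw [← f₂ _ (by omega)] at e5 e6 e7 e8
    refine Spec.seq (spec_cornerProgram Λ e5 e6 e7 e8 hB ?_)
    intro τ₃ f₃ m₃ m₄
    rw [← f₃ _ (by omega)] at e5 e6 e7 e8
    rw [← f₃ 13 (by omega), ← f₃ 14 (by omega)] at m₁
    rw [← f₃ 15 (by omega), ← f₃ 16 (by omega)] at m₂
    refine Spec.seq (spec_anticornerProgram Λ e5 e6 e7 e8 hB ?_)
    intro τ₄ f₄ m₅ m₆
    rw [← f₄ _ (by omega)] at e5 e6 e7 e8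
    rw [← f₄ 13 (by omega), ← f₄ 14 (by omega)] at m₁
    rw [← f₄ 15 (by omega), ← f₄ 16 (by omega)] at m₂
    rw [← f₄ 17 (by omega), ← f₄ 18 (by omega)] at m₃
    rw [← f₄ 19 (by omega), ← f₄ 20 (by omega)] at m₄
    refine Spec.seq (spec_sideProgram ?_)
    intro τ₅ f₅ s s'
    rw [e5, e6, e7, e8] at s s'
    rw [← f₅ _ (by omega)] at e5 e6 e7 e8
    obtain ⟨o, o'⟩ := isOptimalTwoCenter_of_isMaxMin hB m₁ m₂ m₃ m₄ m₅ m₆ s s'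
    refine Spec.ite ⟨trivial, trivial⟩ (fun h => ?_) (fun h => ?_)
    · iterate 4 refine Spec.seq (Spec.setReal_of_noRead rfl rfl ?_)
      refine Spec.setReal_of_noRead rfl rfl ?_
      simpa [RealExpr.rval, e5, e6, e7, e8] using o' (le_of_lt h)
    · iterate 4 refine Spec.seq (Spec.setReal_of_noRead rfl rfl ?_)
      refine Spec.setReal_of_noRead rfl rfl ?_
      simpa [RealExpr.rval, e5, e6, e7, e8] using o (not_lt.1 h)

end Query

theorem queryProgram_isFlat : queryProgram.IsFlat := rfl

/-! ### Construction of the data structure -/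

/-- The extension of a permutation of `Fin n` to the natural numbers by the identity. -/
def natPerm {n : ℕ} (τ : Equiv.Perm (Fin n)) : Equiv.Perm ℕ := τ.extendDomain Fin.equivSubtype

theorem natPerm_of_lt {n : ℕ} (τ : Equiv.Perm (Fin n)) {i : ℕ} (h : i < n) :
    natPerm τ i = τ ⟨i, h⟩ := by
  have := Equiv.Perm.extendDomain_apply_subtype τ Fin.equivSubtype (b := i) h
  simpa [natPerm] using this

theorem natPerm_of_le {n : ℕ} (τ : Equiv.Perm (Fin n)) {i : ℕ} (h : n ≤ i) : natPerm τ i = i :=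
  Equiv.Perm.extendDomain_apply_not_subtype τ Fin.equivSubtype (not_lt.2 h)

theorem natPerm_lt_iff {n : ℕ} (τ : Equiv.Perm (Fin n)) (i : ℕ) : natPerm τ i < n ↔ i < n := by
  rcases Nat.lt_or_ge i n with h | h
  · simp [natPerm_of_lt τ h, h]
  · rw [natPerm_of_le τ h]

theorem exists_sorted (P : Finset Point) (f : Point → ℝ) :
    ∃ e : Fin P.card ≃ P, Monotone fun i => f (e i) := by
  refine ⟨(Tuple.sort fun i => f (P.equivFin.symm i)).trans P.equivFin.symm, ?_⟩
  exact Tuple.monotone_sort fun i => f (P.equivFin.symm i)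

noncomputable def sortedEquiv (P : Finset Point) (k j : ℕ) : Fin P.card ≃ P :=
  (exists_sorted P (lin (coef k j))).choose

theorem monotone_sortedEquiv (P : Finset Point) (k j : ℕ) :
    Monotone fun i => lin (coef k j) (sortedEquiv P k j i) :=
  (exists_sorted P (lin (coef k j))).choose_spec

/-- The points of `P` in the order of a functional. -/
noncomputable def sortedPts (P : Finset Point) (k j i : ℕ) : Point :=
  if h : i < P.card then sortedEquiv P k j ⟨i, h⟩ else 0

noncomputable def rankPerm (P : Finset Point) (k j : ℕ) : Equiv.Perm ℕ :=
  natPerm ((sortedEquiv P k 0).trans (sortedEquiv P k j).symm)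

/-- The bit sequences of the structure. -/
noncomputable def bits (P : Finset Point) (L k j : ℕ) : ℕ → Bool :=
  treeBits L (nodeFun L (rankPerm P k 1) (rankPerm P k 2) j)

/-- Entry `u` of the array `t` of words. -/
noncomputable def wordEntry (P : Finset Point) (L b t u : ℕ) : ℕ :=
  if t = 0 then (if u = 0 then P.card else if u = 1 then 2 ^ L else if u = 2 then b else 0)
  else if t = 1 then rankTable b u
  else if t % 2 = 0 then bitRank (bits P L ((t - 2) / 6) ((t - 2) % 6 / 2)) (b * u)
  else blockCode b (bits P L ((t - 2) / 6) ((t - 2) % 6 / 2)) u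

/-- Entry `i` of the array `t` of reals. -/
noncomputable def realEntry (P : Finset Point) (t i : ℕ) : ℝ :=
  if t % 2 = 0 then (sortedPts P (t / 6) (t % 6 / 2) i).1
  else (sortedPts P (t / 6) (t % 6 / 2) i).2

/-- The data structure. -/
noncomputable def dataStructure (w : ℕ) (P : Finset Point) (L b U : ℕ) : Memory w where
  words := (List.range (74 * U)).map fun a => BitVec.ofNat w (wordEntry P L b (a % 74) (a / 74))
  reals := (List.range (72 * P.card)).map fun a => realEntry P (a % 72) (a / 72)

theorem space_dataStructure (w : ℕ) (P : Finset Point) (L b U : ℕ) :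
    (dataStructure w P L b U).space = 74 * U + 72 * P.card := by
  simp [Memory.space, dataStructure]

theorem sortedPts_mem (P : Finset Point) (k j : ℕ) {i : ℕ} (h : i < P.card) :
    sortedPts P k j i ∈ P := by
  rw [sortedPts, dif_pos h]
  exact Subtype.prop _

theorem storesCoordinatesOf_dataStructure (w : ℕ) (P : Finset Point) (L b U : ℕ) :
    StoresCoordinatesOf (dataStructure w P L b U) P := by
  intro x hx
  simp only [dataStructure, List.mem_map, List.mem_range] at hx
  obtain ⟨a, ha, rfl⟩ := hx
  refine ⟨_, sortedPts_mem P (a % 72 / 6) (a % 72 % 6 / 2) (i := a / 72) (by omega), ?_⟩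
  unfold realEntry
  split_ifs <;> simp

theorem abs_word_dataStructure {w : ℕ} {P : Finset Point} {L b U t u : ℕ} (ht : t < 74) (hu : u < U)
    (hlt : wordEntry P L b t u < 2 ^ w) :
    (dataStructure w P L b U).abs.word (74 * u + t) = wordEntry P L b t u := by
  have h : 74 * u + t < 74 * U := by omega
  simp only [Memory.abs, dataStructure]
  rw [List.getD_eq_getElem _ _ (by simpa using h)]
  simp only [List.getElem_map, List.getElem_range, BitVec.toNat_ofNat]
  rw [Nat.mul_add_mod, Nat.mod_eq_of_lt ht, Nat.mul_add_div (by omega), Nat.div_eq_of_lt ht,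
    add_zero, Nat.mod_eq_of_lt hlt]

theorem abs_real_dataStructure {w : ℕ} {P : Finset Point} {L b U t i : ℕ} (ht : t < 72)
    (hi : i < P.card) :
    (dataStructure w P L b U).abs.real (72 * i + t) = realEntry P t i := by
  have h : 72 * i + t < 72 * P.card := by omega
  simp only [Memory.abs, dataStructure]
  rw [List.getD_eq_getElem _ _ (by simpa using h)]
  simp only [List.getElem_map, List.getElem_range]
  rw [Nat.mul_add_mod, Nat.mod_eq_of_lt ht, Nat.mul_add_div (by omega), Nat.div_eq_of_lt ht,
    add_zero]

theorem wordEntry_sample (P : Finset Point) (L b : ℕ) {k j : ℕ} (hj : j < 3) (u : ℕ) :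
    wordEntry P L b (6 * k + 2 * j + 2) u = bitRank (bits P L k j) (b * u) := by
  have h1 : (6 * k + 2 * j + 2 - 2) / 6 = k := by omega
  have h2 : (6 * k + 2 * j + 2 - 2) % 6 / 2 = j := by omega
  rw [wordEntry, if_neg (by omega), if_neg (by omega), if_pos (by omega), h1, h2]

theorem wordEntry_code (P : Finset Point) (L b : ℕ) {k j : ℕ} (hj : j < 3) (u : ℕ) :
    wordEntry P L b (6 * k + 2 * j + 3) u = blockCode b (bits P L k j) u := by
  have h1 : (6 * k + 2 * j + 3 - 2) / 6 = k := by omega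
  have h2 : (6 * k + 2 * j + 3 - 2) % 6 / 2 = j := by omega
  rw [wordEntry, if_neg (by omega), if_neg (by omega), if_neg (by omega), h1, h2]

theorem realEntry_fst (P : Finset Point) {k j : ℕ} (hj : j < 3) (i : ℕ) :
    realEntry P (6 * k + 2 * j) i = (sortedPts P k j i).1 := by
  have h1 : (6 * k + 2 * j) / 6 = k := by omega
  have h2 : (6 * k + 2 * j) % 6 / 2 = j := by omega
  rw [realEntry, if_pos (by omega), h1, h2]

theorem realEntry_snd (P : Finset Point) {k j : ℕ} (hj : j < 3) (i : ℕ) :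
    realEntry P (6 * k + 2 * j + 1) i = (sortedPts P k j i).2 := by
  have h1 : (6 * k + 2 * j + 1) / 6 = k := by omega
  have h2 : (6 * k + 2 * j + 1) % 6 / 2 = j := by omega
  rw [realEntry, if_neg (by omega), h1, h2]

/-- These bounds make the space linear. With blocks of `b = L / 2 + 1` bits, the lookup table has `2
^ b * b = O(2 ^ L)` entries because `b ≤ 2 ^ (L / 2)`, and `b ≥ (L + 1) / 2` cancels the factor `L +
1` in the number of bits. -/
theorem block_bounds (L : ℕ) :
    2 ^ (L / 2 + 1) * (L / 2 + 1) ≤ 2 * 2 ^ L ∧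
      2 * (2 ^ L * (L + 1)) / (L / 2 + 1) ≤ 4 * 2 ^ L := by
  constructor
  · have h1 : L / 2 + 1 ≤ 2 ^ (L / 2) := Nat.lt_two_pow_self
    calc 2 ^ (L / 2 + 1) * (L / 2 + 1) ≤ 2 ^ (L / 2 + 1) * 2 ^ (L / 2) := Nat.mul_le_mul_left _ h1
      _ = 2 * 2 ^ (L / 2 + L / 2) := by ring
      _ ≤ 2 * 2 ^ L := Nat.mul_le_mul_left _ (Nat.pow_le_pow_right two_pos (by omega))
  · refine Nat.div_le_of_le_mul ?_
    have h : L + 1 ≤ 2 * (L / 2 + 1) := by omega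
    nlinarith [Nat.mul_le_mul_left (2 * 2 ^ L) h]

/-- The layout of the data structure with blocks of `L / 2 + 1` bits. -/
noncomputable def layout {w : ℕ} {P : Finset Point} {L : ℕ} (hL : 1 ≤ L) (hcard : P.card < 2 ^ L)
    (hlarge : 2048 * (2 ^ L * (L + 1)) ≤ 2 ^ w) :
    Layout (dataStructure w P L (L / 2 + 1) (5 * 2 ^ L)) P L (L / 2 + 1) := by
  have hD : 2 ^ L ≤ 2 ^ L * (L + 1) := Nat.le_mul_of_pos_right _ L.succ_pos
  have h2 : 2 ≤ 2 ^ L := by simpa using Nat.pow_le_pow_right two_pos hL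
  have hpos : 0 < L / 2 + 1 := Nat.succ_pos _
  obtain ⟨hb1, hb2⟩ := block_bounds L
  have hLpow : L < 2 ^ L := Nat.lt_two_pow_self
  have hcodeb : ∀ β u, blockCode (L / 2 + 1) β u * (L / 2 + 1) + (L / 2 + 1) ≤ 2 * 2 ^ L := by
    intro β u
    have := Nat.mul_le_mul_right (L / 2 + 1) (Nat.succ_le_of_lt (blockCode_lt (L / 2 + 1) β u))
    rw [Nat.succ_mul] at this
    omega
  have hcode : ∀ β u, blockCode (L / 2 + 1) β u < 2 ^ w := by
    intro β u
    have := hcodeb β u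
    have := Nat.le_mul_of_pos_right (blockCode (L / 2 + 1) β u) hpos
    omega
  -- Block numbers are at most `4 * 2 ^ L`, including the one of the end position, and table indices
  -- are less than `2 * 2 ^ L`, so arrays of length `5 * 2 ^ L` suffice.
  have hq : ∀ q ≤ 2 * (2 ^ L * (L + 1)), q / (L / 2 + 1) < 5 * 2 ^ L := by
    intro q hq
    have := Nat.div_le_div_right (c := L / 2 + 1) hq
    omega
  have hcodeW : ∀ k < 12, ∀ j < 3, ∀ q ≤ 2 * (2 ^ L * (L + 1)),
      (dataStructure w P L (L / 2 + 1) (5 * 2 ^ L)).abs.word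
        (74 * (q / (L / 2 + 1)) + (6 * k + 2 * j + 3)) =
      blockCode (L / 2 + 1) (bits P L k j) (q / (L / 2 + 1)) := by
    intro k hk j hj q hqD
    rw [abs_word_dataStructure (by omega) (hq q hqD), wordEntry_code P L _ hj]
    rw [wordEntry_code P L _ hj]
    exact hcode _ _
  exact
  { pts := sortedPts P
    rk := rankPerm P
    card_lt := hcard
    block_pos := hpos
    large := hlarge
    word_card := by
      have e : wordEntry P L (L / 2 + 1) 0 0 = P.card := by simp [wordEntry]
      exact (abs_word_dataStructure (t := 0) (u := 0) (by omega) (by omega)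
        (by rw [e]; omega)).trans e
    word_size := by
      have e : wordEntry P L (L / 2 + 1) 0 1 = 2 ^ L := by simp [wordEntry]
      exact (abs_word_dataStructure (t := 0) (u := 1) (by omega) (by omega)
        (by rw [e]; omega)).trans e
    word_block := by
      have e : wordEntry P L (L / 2 + 1) 0 2 = L / 2 + 1 := by simp [wordEntry]
      exact (abs_word_dataStructure (t := 0) (u := 2) (by omega) (by omega)
        (by rw [e]; omega)).trans e
    real_fst := fun k hk j hj i hi => by
      rw [abs_real_dataStructure (by omega) hi, realEntry_fst P hj]
    real_snd := fun k hk j hj i hi => by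
      rw [abs_real_dataStructure (by omega) hi, realEntry_snd P hj]
    pts_mem := fun k _ j _ i hi => sortedPts_mem P k j hi
    pts_surj := fun k _ j _ p hp => by
      refine ⟨(sortedEquiv P k j).symm ⟨p, hp⟩, Fin.is_lt _, ?_⟩
      rw [sortedPts, dif_pos (Fin.is_lt _), Fin.eta, Equiv.apply_symm_apply]
    pts_mono := fun k _ j _ i i' h h' => by
      rw [sortedPts, dif_pos (h.trans_lt h'), sortedPts, dif_pos h']
      exact monotone_sortedEquiv P k j (a := ⟨i, h.trans_lt h'⟩) (b := ⟨i', h'⟩) h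
    rk_lt := fun k j i => natPerm_lt_iff _ i
    pts_rk := fun k _ j _ i hi => by
      have h : rankPerm P k j i < P.card := (natPerm_lt_iff _ i).2 hi
      rw [sortedPts, dif_pos h, sortedPts, dif_pos hi]
      simp [rankPerm, natPerm_of_lt _ hi]
    code_le := fun k hk j hj q hqD => by
      rw [hcodeW k hk j hj q hqD]
      have := hcodeb (bits P L k j) (q / (L / 2 + 1))
      omega
    rank_eq := fun k hk j hj q hqD => by
      have hmod := Nat.mod_lt q hpos
      have hc := hcodeb (bits P L k j) (q / (L / 2 + 1))
      have hle := bitRank_le (bits P L k j) ((L / 2 + 1) * (q / (L / 2 + 1)))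
      have hle' := Nat.mul_div_le q (L / 2 + 1)
      have htab := rankTable_le (L / 2 + 1)
        (blockCode (L / 2 + 1) (bits P L k j) (q / (L / 2 + 1)) * (L / 2 + 1) + q % (L / 2 + 1))
      have e1 : ∀ u, wordEntry P L (L / 2 + 1) 1 u = rankTable (L / 2 + 1) u := by
        intro u; simp [wordEntry]
      rw [hcodeW k hk j hj q hqD, abs_word_dataStructure (by omega) (hq q hqD)
        (by rw [wordEntry_sample P L _ hj]; omega), wordEntry_sample P L _ hj,
        abs_word_dataStructure (by omega) (by omega) (by rw [e1]; omega), e1]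
      exact (bitRank_eq_sample_add_rankTable hpos (bits P L k j) q).symm }

end RangeClustering

/-! ### Choice of the constants and the final bounds -/

theorem mainTheorem5 (δ : ℝ) (hδ : 0 < δ) :
    ∃ (p : RangeClustering.Program) (c : ℕ) (K : ℝ),
      ∀ P : Finset RangeClustering.Point, 2 ≤ P.card →
        ∃ M : RangeClustering.Memory (c * Nat.clog 2 P.card),
          RangeClustering.StoresCoordinatesOf M P ∧
          (M.space : ℝ) ≤ K * ((P.card : ℝ) * Real.log (P.card : ℝ) ^ δ) ∧
          ∀ a b : RangeClustering.Point, a ≤ b →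
            RangeClustering.AnswersTwoCenterQuery p M P a b (K * Real.log (P.card : ℝ)) := by
  have hlog2 : 0 < Real.log 2 := Real.log_pos one_lt_two
  obtain ⟨C, hC⟩ : ∃ C : ℕ, ∀ m, RangeClustering.queryProgram.maxCost m ≤ C * (m + 1) :=
    ⟨_, RangeClustering.Program.IsFlat.maxCost_le RangeClustering.queryProgram_isFlat⟩
  -- With `m = 2 ^ Nat.clog 2 n ≥ 2`, the required word range is at most `2048 * (2 * m) ^ 2 = 2 ^
  -- 13 * m ^ 2 ≤ m ^ 15`, whence 15. The first summand of `K` pays for the space: `812 = 74 * 5 * 2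
  -- + 72` cells per point because `2 ^ L ≤ 2 * n`, and `log n ≥ log 2` turns a linear bound into
  -- the stated one. The second summand pays for the time, with `L + 1 ≤ 3 * Nat.log 2 n`.
  refine ⟨RangeClustering.queryProgram, 15, 812 / Real.log 2 ^ δ + C * 3 / Real.log 2, ?_⟩
  intro P hP
  set n := P.card with hn
  have hlogn : Real.log 2 ≤ Real.log n := Real.log_le_log two_pos (by exact_mod_cast hP)
  set L := Nat.log 2 n + 1 with hL
  have hlog1 : 1 ≤ Nat.log 2 n := Nat.log_pos one_lt_two hP
  have hnL : n < 2 ^ L := Nat.lt_pow_succ_log_self one_lt_two n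
  have hLn : 2 ^ L ≤ 2 * n := by
    have := Nat.pow_log_le_self 2 (x := n) (by omega)
    rw [hL, pow_succ]
    omega
  have hlarge : 2048 * (2 ^ L * (L + 1)) ≤ 2 ^ (15 * Nat.clog 2 n) := by
    have h1 : n ≤ 2 ^ Nat.clog 2 n := Nat.le_pow_clog one_lt_two n
    have h2 : L + 1 ≤ 2 ^ L := Nat.lt_two_pow_self
    have h3 : 2 ^ L ≤ 2 * 2 ^ Nat.clog 2 n := hLn.trans (Nat.mul_le_mul_left 2 h1)
    have h4 : 2 ≤ 2 ^ Nat.clog 2 n := hP.trans h1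
    have h5 : 2 ^ 13 ≤ (2 ^ Nat.clog 2 n) ^ 13 := Nat.pow_le_pow_left h4 13
    calc 2048 * (2 ^ L * (L + 1))
        ≤ 2048 * ((2 * 2 ^ Nat.clog 2 n) * (2 * 2 ^ Nat.clog 2 n)) :=
          Nat.mul_le_mul_left _ (Nat.mul_le_mul h3 (h2.trans h3))
      _ = 2 ^ 13 * (2 ^ Nat.clog 2 n) ^ 2 := by ring
      _ ≤ (2 ^ Nat.clog 2 n) ^ 13 * (2 ^ Nat.clog 2 n) ^ 2 := Nat.mul_le_mul_right _ h5
      _ = 2 ^ (15 * Nat.clog 2 n) := by rw [← pow_add, ← pow_mul, mul_comm]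
  have Λ := RangeClustering.layout (P := P) (by omega) hnL hlarge
  refine ⟨RangeClustering.dataStructure _ P L (L / 2 + 1) (5 * 2 ^ L),
    RangeClustering.storesCoordinatesOf_dataStructure _ P L _ _, ?_, fun a b _ => ?_⟩
  · rw [RangeClustering.space_dataStructure]
    have h1 : ((74 * (5 * 2 ^ L) + 72 * P.card : ℕ) : ℝ) ≤ 812 * n := by
      rw [← hn]; exact_mod_cast (by omega : 74 * (5 * 2 ^ L) + 72 * n ≤ 812 * n)
    have h2 : Real.log 2 ^ δ ≤ Real.log n ^ δ := Real.rpow_le_rpow hlog2.le hlogn hδ.le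
    have h3 : 0 < Real.log 2 ^ δ := Real.rpow_pos_of_pos hlog2 δ
    calc ((74 * (5 * 2 ^ L) + 72 * P.card : ℕ) : ℝ) ≤ 812 * n := h1
      _ = 812 / Real.log 2 ^ δ * (n * Real.log 2 ^ δ) := by field_simp
      _ ≤ 812 / Real.log 2 ^ δ * (n * Real.log n ^ δ) := by gcongr
      _ ≤ (812 / Real.log 2 ^ δ + C * 3 / Real.log 2) * (n * Real.log n ^ δ) := by
        gcongr
        exact le_add_of_nonneg_right (by positivity)
  · obtain ⟨t, s, hrun, ht, hopt⟩ := RangeClustering.spec_queryProgram Λ (p := a) (q := b)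
      (σ := (RangeClustering.queryInput _ a b).abs) rfl rfl rfl rfl _ rfl
    refine ⟨t, s, hrun, ?_, hopt⟩
    have h1 : t ≤ C * (L + 1) := ht.trans (hC L)
    have h2 : (Nat.log 2 n : ℝ) * Real.log 2 ≤ Real.log n := by
      rw [← Real.log_pow]
      refine Real.log_le_log (by positivity) ?_
      exact_mod_cast Nat.pow_log_le_self 2 (x := n) (by omega)
    have h3 : ((L + 1 : ℕ) : ℝ) ≤ 3 * Nat.log 2 n := by
      exact_mod_cast (by omega : L + 1 ≤ 3 * Nat.log 2 n)
    calc (t : ℝ) ≤ C * ((L + 1 : ℕ) : ℝ) := by exact_mod_cast h1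
      _ ≤ C * (3 * Nat.log 2 n) := by gcongr
      _ = C * 3 / Real.log 2 * (Nat.log 2 n * Real.log 2) := by field_simp
      _ ≤ C * 3 / Real.log 2 * Real.log n := by gcongr
      _ ≤ (812 / Real.log 2 ^ δ + C * 3 / Real.log 2) * Real.log n := by
        gcongr
        exact le_add_of_nonneg_left (by positivity)
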